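/- Let $H\cong(\mathbb{C}^\times)^n$ be a complex torus with Lie algebra $\mathfrak h\cong\mathbb{C}^n$ and character lattice $Q=\mathrm{Hom}(H,\mathbb{C}^\times)\subset\mathfrak h^*$; write $h^\lambda$ for the value of $\lambda\in Q$ at $h\in H$, and $\theta_\xi$ for the translation invariant vector field of $\xi\in\mathfrak h$, so that $\theta_\xi(h^\lambda)=\lambda(\xi)h^\lambda$. Suppose that $Q$ carries an even integral (positive definite) scalar product $(\cdot,\cdot)$ such that $R=\{\alpha\in Q:(\alpha,\alpha)=2\}$ is an irreducible root system of rank $n$ and of type $A_n$ $(n\ge1)$, $D_n$ $(n\ge4)$, $E_6$, $E_7$ or $E_8$. Extend $(\cdot,\cdot)$ bilinearly to $\mathfrak h^*$, transfer it to $\mathfrak h\cong\mathfrak h^*$, and let $\alpha^\vee\in\mathfrak h$ correspond to $\alpha\in R$ under this isomorphism. Let $R_+$ be a system of positive roots (write $\alpha>0$ for $\alpha\in R_+$), let $W'$ be the group of all automorphisms of the lattice $Q$ that preserve $(\cdot,\cdot)$, acting also on $H$ and on $\mathfrak h$, and let $H^\circ=\{h\in H: h^\alpha\neq1\ \text{for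 all }\alpha\in R\}$. Let $k\in\mathbb{C}$, and put $$a=\tfrac{n+1}{4},\quad n-2,\quad 6,\quad 12,\quad 30\qquad\text{for type } A_n,\ D_n,\ E_6,\ E_7,\ E_8\text{ respectively.}$$ For $\xi,\eta\in\mathfrak h$ consider on $H^\circ$ the differential operator $$D_{\xi,\eta}=\theta_\xi\theta_\eta+\tfrac12k\sum_{\alpha>0}\alpha(\xi)\alpha(\eta)\,\frac{1+h^{-\alpha}}{1-h^{-\alpha}}\,\theta_{\alpha^\vee}+a\,k^2(\xi,\eta).$$ Theorem. The system of differential equations $D_{\xi,\eta}f=0$ for all $\xi,\eta\in\mathfrak h$ has the following properties. 1. It consists of $n(n+1)/2$ linearly independent equations: for every $p\in H^\circ$ the functionals $f\mapsto(D_{\xi,\eta}f)(p)$ on functions $f$ holomorphic near $p$, with $\xi,\eta\in\mathfrak h$, span a complex vector space of dimension $n(n+1)/2$. 2. It is integrable on $H^\circ$: for every $p\in H^\circ$ the complex vector space of germs at $p$ of holomorphic functions $f$ with $D_{\xi,\eta}f=0$ near $p$ for all $\xi,\eta\in\mathfrak h$ has dimension $n+1$. 3. It is invariant under $W'$: every $w\in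 W'$ maps $H^\circ$ to itself, and $D_{\xi,\eta}(f\circ w)(h)=(D_{w\xi,w\eta}f)(wh)$ for all $\xi,\eta\in\mathfrak h$, all $h\in H^\circ$ and all functions $f$ holomorphic near $wh$. -/

import Mathlib

open Topology Matrix

namespace ToricHypergeometric

/-! ### The torus, its characters and its invariant vector fields

The complex torus of dimension `n` is `H = (ℂˣ)ⁿ`, realised as the open subset
`{h | ∀ i, h i ≠ 0}` of `ℂⁿ = (Fin n → ℂ)`. Its character lattice is `Q = ℤⁿ = (Fin n → ℤ)`
and its Lie algebra is `𝔥 = Hom(Q, ℂ) = ℂⁿ = (Fin n → ℂ)`. -/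

/-- The value `h ^ lam = ∏ i, h i ^ lam i` of the character `lam` at the point `h`. -/
noncomputable def character {n : ℕ} (lam : Fin n → ℤ) (h : Fin n → ℂ) : ℂ :=
  ∏ i, h i ^ lam i

/-- The value `lam(ξ)` of a character (seen as a linear form on `𝔥`) at `ξ ∈ 𝔥`. -/
noncomputable def pairing {n : ℕ} (lam : Fin n → ℤ) (ξ : Fin n → ℂ) : ℂ :=
  ∑ i, (lam i : ℂ) * ξ i

/-- The translation invariant vector field `θ_ξ = ∑ i, ξ i * h i * ∂/∂h i` on `H`, acting on
functions. It satisfies `θ_ξ (h ^ lam) = lam(ξ) * h ^ lam`. -/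
noncomputable def theta {n : ℕ} (ξ : Fin n → ℂ) (f : (Fin n → ℂ) → ℂ) (h : Fin n → ℂ) : ℂ :=
  fderiv ℂ f h (fun i => ξ i * h i)

/-! ### The even lattice and its roots -/

/-- The scalar product `(lam, mu)` on `Q` with Gram matrix `B`. -/
def form {n : ℕ} (B : Matrix (Fin n) (Fin n) ℤ) (lam mu : Fin n → ℤ) : ℤ :=
  lam ⬝ᵥ B *ᵥ mu

/-- `B` is the Gram matrix of an even integral scalar product on `Q`. -/
structure IsEvenScalarProduct {n : ℕ} (B : Matrix (Fin n) (Fin n) ℤ) : Prop where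
  symm : B.IsSymm
  even : ∀ lam, Even (form B lam lam)
  pos : ∀ lam, lam ≠ 0 → 0 < form B lam lam

/-- `R = {α ∈ Q | (α, α) = 2}`. -/
def roots {n : ℕ} (B : Matrix (Fin n) (Fin n) ℤ) : Set (Fin n → ℤ) :=
  {α | form B α α = 2}

/-- The types of the irreducible simply laced root systems. -/
inductive ADEType : Type
  | A (n : ℕ) (hn : 1 ≤ n) : ADEType
  | D (n : ℕ) (hn : 4 ≤ n) : ADEType
  | E₆ : ADEType
  | E₇ : ADEType
  | E₈ : ADEType

/-- The rank of each type. -/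
def ADEType.rank : ADEType → ℕ
  | .A n _ => n
  | .D n _ => n
  | .E₆ => 6
  | .E₇ => 7
  | .E₈ => 8

/-- The Cartan matrix of each type. -/
def ADEType.cartanMatrix : (X : ADEType) → Matrix (Fin X.rank) (Fin X.rank) ℤ
  | .A n _ => CartanMatrix.A n
  | .D n _ => CartanMatrix.D n
  | .E₆ => CartanMatrix.E₆
  | .E₇ => CartanMatrix.E₇
  | .E₈ => CartanMatrix.E₈

/-- The constant `a` of each type. -/
noncomputable def ADEType.a : ADEType → ℂ
  | .A n _ => ((n : ℂ) + 1) / 4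
  | .D n _ => (n : ℂ) - 2
  | .E₆ => 6
  | .E₇ => 12
  | .E₈ => 30

/-- `R` is a root system of type `X` and of rank `n`: it has `n` simple roots with the Cartan
matrix of type `X` (all roots have squared length `2`, so Cartan integers are scalar products). -/
structure IsOfType {n : ℕ} (B : Matrix (Fin n) (Fin n) ℤ) (X : ADEType) : Prop where
  rank_eq : X.rank = n
  exists_simple : ∃ s : Fin X.rank → (Fin n → ℤ),
    (∀ i j, form B (s i) (s j) = X.cartanMatrix i j) ∧
    ∀ β ∈ roots B, ∃ c : Fin X.rank → ℕ, β = ∑ i, c i • s i ∨ β = -∑ i, c i • s i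

/-- A system of positive roots: `R = R₊ ⊔ (-R₊)` with `R₊` closed under sums that are roots. -/
structure IsPositiveSystem {n : ℕ} (B : Matrix (Fin n) (Fin n) ℤ)
    (Rp : Finset (Fin n → ℤ)) : Prop where
  subset : ∀ α ∈ Rp, α ∈ roots B
  mem_or_neg_mem : ∀ α ∈ roots B, α ∈ Rp ∨ -α ∈ Rp
  not_both : ∀ α ∈ Rp, -α ∉ Rp
  add_mem : ∀ α ∈ Rp, ∀ β ∈ Rp, α + β ∈ roots B → α + β ∈ Rp

/-- The coroot `α^∨ ∈ 𝔥` that corresponds to `α` under `𝔥* ≅ 𝔥`, that is `lam(α^∨) = (lam, α)`. -/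
def coroot {n : ℕ} (B : Matrix (Fin n) (Fin n) ℤ) (α : Fin n → ℤ) : Fin n → ℂ :=
  fun i => (((B *ᵥ α) i : ℤ) : ℂ)

/-- The complex bilinear form on `𝔥` obtained by extending the scalar product from `Q` to `𝔥*` and
transferring it to `𝔥` via `𝔥* ≅ 𝔥`; its Gram matrix is `B⁻¹`. -/
noncomputable def dualForm {n : ℕ} (B : Matrix (Fin n) (Fin n) ℤ) (ξ η : Fin n → ℂ) : ℂ :=
  ξ ⬝ᵥ (B.map (fun z : ℤ => (z : ℂ)))⁻¹ *ᵥ η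

/-- The complement `H°` in `H` of the mirrors `H_α = {h | h ^ α = 1}`, `α ∈ R`. -/
def mirrorComplement {n : ℕ} (B : Matrix (Fin n) (Fin n) ℤ) : Set (Fin n → ℂ) :=
  {h | (∀ i, h i ≠ 0) ∧ ∀ α ∈ roots B, character α h ≠ 1}

/-! ### The extended Weyl group and its actions -/

/-- The extended Weyl group `W'`: all automorphisms of the lattice `Q` with its scalar product. -/
def extendedWeylGroup {n : ℕ} (B : Matrix (Fin n) (Fin n) ℤ) :
    Subgroup ((Fin n → ℤ) ≃ₗ[ℤ] (Fin n → ℤ)) where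
  carrier := {w | ∀ lam mu, form B (w lam) (w mu) = form B lam mu}
  one_mem' := fun _ _ => rfl
  mul_mem' := fun {v w} hv hw lam mu => (hv (w lam) (w mu)).trans (hw lam mu)
  inv_mem' := fun {w} hw lam mu => by
    have h := hw (w⁻¹ lam) (w⁻¹ mu)
    have e : ∀ x, w (w⁻¹ x) = x := fun x => w.apply_symm_apply x
    rw [e, e] at h
    exact h.symm

/-- The action on `H`, determined by `(w h) ^ lam = h ^ (w⁻¹ lam)`. -/
noncomputable def actTorus {n : ℕ} (w : (Fin n → ℤ) ≃ₗ[ℤ] (Fin n → ℤ)) (h : Fin n → ℂ) :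
    Fin n → ℂ :=
  fun i => character (w⁻¹ (Pi.single i 1)) h

/-- The action on `𝔥`, determined by `lam(w ξ) = (w⁻¹ lam)(ξ)`. -/
noncomputable def actLie {n : ℕ} (w : (Fin n → ℤ) ≃ₗ[ℤ] (Fin n → ℤ)) (ξ : Fin n → ℂ) :
    Fin n → ℂ :=
  fun i => pairing (w⁻¹ (Pi.single i 1)) ξ

/-! ### The special hypergeometric system -/

/-- The differential operator
`θ_ξ θ_η + (k/2) ∑_{α > 0} α(ξ) α(η) (1 + h^{-α}) / (1 - h^{-α}) θ_{α^∨} + a k² (ξ, η)`. -/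
noncomputable def hypOp {n : ℕ} (B : Matrix (Fin n) (Fin n) ℤ) (Rp : Finset (Fin n → ℤ))
    (k a : ℂ) (ξ η : Fin n → ℂ) (f : (Fin n → ℂ) → ℂ) (h : Fin n → ℂ) : ℂ :=
  theta ξ (theta η f) h
    + 1 / 2 * k * ∑ α ∈ Rp, pairing α ξ * pairing α η
        * ((1 + character (-α) h) / (1 - character (-α) h)) * theta (coroot B α) f h
    + a * k ^ 2 * dualForm B ξ η * f h

/-- The equation with parameters `ξ, η` at the point `p`, as a functional on the functions that
are holomorphic around `p`. -/
noncomputable def equationAt {n : ℕ} (B : Matrix (Fin n) (Fin n) ℤ) (Rp : Finset (Fin n → ℤ))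
    (k a : ℂ) (p : Fin n → ℂ) (ξ η : Fin n → ℂ) :
    {f : (Fin n → ℂ) → ℂ // AnalyticAt ℂ f p} → ℂ :=
  fun f => hypOp B Rp k a ξ η f.1 p

theorem analyticAt_theta {n : ℕ} (ξ : Fin n → ℂ) {f : (Fin n → ℂ) → ℂ} {p : Fin n → ℂ}
    (hf : AnalyticAt ℂ f p) : AnalyticAt ℂ (theta ξ f) p := by
  have h2 : AnalyticAt ℂ (fun h : Fin n → ℂ => fun i => ξ i * h i) p := by
    rw [analyticAt_pi_iff]
    intro i
    exact analyticAt_const.mul ((ContinuousLinearMap.proj (R := ℂ) i).analyticAt p)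
  exact AnalyticAt.comp₂ (h := fun q : ((Fin n → ℂ) →L[ℂ] ℂ) × (Fin n → ℂ) => q.1 q.2)
    ((ContinuousLinearMap.id ℂ ((Fin n → ℂ) →L[ℂ] ℂ)).analyticAt_bilinear _) hf.fderiv h2

theorem theta_add {n : ℕ} (ξ : Fin n → ℂ) {f g : (Fin n → ℂ) → ℂ} {p : Fin n → ℂ}
    (hf : AnalyticAt ℂ f p) (hg : AnalyticAt ℂ g p) :
    theta ξ (f + g) p = theta ξ f p + theta ξ g p := by
  simp only [theta]
  rw [fderiv_add hf.differentiableAt hg.differentiableAt]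
  rfl

theorem theta_smul {n : ℕ} (ξ : Fin n → ℂ) (c : ℂ) {f : (Fin n → ℂ) → ℂ} {p : Fin n → ℂ}
    (hf : AnalyticAt ℂ f p) : theta ξ (c • f) p = c * theta ξ f p := by
  simp only [theta]
  rw [fderiv_const_smul hf.differentiableAt]
  rfl

theorem theta_congr {n : ℕ} (ξ : Fin n → ℂ) {f g : (Fin n → ℂ) → ℂ} {p : Fin n → ℂ}
    (h : f =ᶠ[𝓝 p] g) : theta ξ f p = theta ξ g p := by
  simp only [theta]
  rw [h.fderiv_eq]

theorem hypOp_add {n : ℕ} (B : Matrix (Fin n) (Fin n) ℤ) (Rp : Finset (Fin n → ℤ))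
    (k a : ℂ) (ξ η : Fin n → ℂ) {f g : (Fin n → ℂ) → ℂ} {p : Fin n → ℂ}
    (hf : AnalyticAt ℂ f p) (hg : AnalyticAt ℂ g p) :
    hypOp B Rp k a ξ η (f + g) p = hypOp B Rp k a ξ η f p + hypOp B Rp k a ξ η g p := by
  have h1 : theta η (f + g) =ᶠ[𝓝 p] theta η f + theta η g := by
    filter_upwards [hf.eventually_analyticAt, hg.eventually_analyticAt] with x hx hy
    exact theta_add η hx hy
  simp only [hypOp]
  rw [theta_congr ξ h1, theta_add ξ (analyticAt_theta η hf) (analyticAt_theta η hg)]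
  simp only [theta_add _ hf hg, mul_add, Finset.sum_add_distrib, Pi.add_apply]
  ring

theorem hypOp_smul {n : ℕ} (B : Matrix (Fin n) (Fin n) ℤ) (Rp : Finset (Fin n → ℤ))
    (k a : ℂ) (ξ η : Fin n → ℂ) (c : ℂ) {f : (Fin n → ℂ) → ℂ} {p : Fin n → ℂ}
    (hf : AnalyticAt ℂ f p) :
    hypOp B Rp k a ξ η (c • f) p = c * hypOp B Rp k a ξ η f p := by
  have h1 : theta η (c • f) =ᶠ[𝓝 p] c • theta η f := by
    filter_upwards [hf.eventually_analyticAt] with x hx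
    exact theta_smul η c hx
  simp only [hypOp]
  rw [theta_congr ξ h1, theta_smul ξ c (analyticAt_theta η hf)]
  simp only [theta_smul _ c hf, mul_add, Finset.mul_sum, Pi.smul_apply, smul_eq_mul]
  congr 1
  · congr 1
    refine Finset.sum_congr rfl fun α _ => ?_
    ring
  · ring

/-- The complex vector space of local solutions at `p`: germs at `p` of holomorphic functions that
satisfy all the equations around `p`. -/
noncomputable def localSolutions {n : ℕ} (B : Matrix (Fin n) (Fin n) ℤ)
    (Rp : Finset (Fin n → ℤ)) (k a : ℂ) (p : Fin n → ℂ) :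
    Submodule ℂ (Filter.Germ (𝓝 p) ℂ) where
  carrier := {φ | ∃ f : (Fin n → ℂ) → ℂ, (f : Filter.Germ (𝓝 p) ℂ) = φ ∧ AnalyticAt ℂ f p ∧
    ∀ ξ η, ∀ᶠ h in 𝓝 p, hypOp B Rp k a ξ η f h = 0}
  zero_mem' := by
    refine ⟨0, rfl, analyticAt_const, fun ξ η => Filter.Eventually.of_forall fun h => ?_⟩
    have h0 := hypOp_smul B Rp k a ξ η 0 (f := 0) (p := h) analyticAt_const
    simpa using h0
  add_mem' := by
    rintro _ _ ⟨f, rfl, hf, hf'⟩ ⟨g, rfl, hg, hg'⟩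
    refine ⟨f + g, rfl, hf.add hg, fun ξ η => ?_⟩
    filter_upwards [hf.eventually_analyticAt, hg.eventually_analyticAt, hf' ξ η, hg' ξ η]
      with x h1 h2 h3 h4
    rw [hypOp_add B Rp k a ξ η h1 h2, h3, h4, add_zero]
  smul_mem' := by
    rintro c _ ⟨f, rfl, hf, hf'⟩
    refine ⟨c • f, rfl, hf.const_smul, fun ξ η => ?_⟩
    filter_upwards [hf.eventually_analyticAt, hf' ξ η] with x h1 h3
    rw [hypOp_smul B Rp k a ξ η c h1, h3, mul_zero]

/-- The system consists of `n(n+1)/2` linearly independent equations, at each point of `H°`. -/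
def HasIndependentEquations {n : ℕ} (B : Matrix (Fin n) (Fin n) ℤ) (Rp : Finset (Fin n → ℤ))
    (k a : ℂ) : Prop :=
  ∀ p ∈ mirrorComplement B,
    Module.finrank ℂ (Submodule.span ℂ
      {L | ∃ ξ η : Fin n → ℂ, L = equationAt B Rp k a p ξ η}) = n * (n + 1) / 2

/-- The system is integrable on `H°`: the space of local solutions has dimension `n + 1`
at each point of `H°`. -/
def IsIntegrable {n : ℕ} (B : Matrix (Fin n) (Fin n) ℤ) (Rp : Finset (Fin n → ℤ))
    (k a : ℂ) : Prop :=
  ∀ p ∈ mirrorComplement B, Module.finrank ℂ (localSolutions B Rp k a p) = n + 1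

/-- The system is invariant under `W'`: each `w ∈ W'` maps `H°` to itself, and pulling back along
`w` transforms the equation with parameters `w ξ, w η` into the one with parameters `ξ, η`. -/
def IsInvariant {n : ℕ} (B : Matrix (Fin n) (Fin n) ℤ) (Rp : Finset (Fin n → ℤ))
    (k a : ℂ) : Prop :=
  ∀ w ∈ extendedWeylGroup B, ∀ h ∈ mirrorComplement B,
    actTorus w h ∈ mirrorComplement B ∧
    ∀ f : (Fin n → ℂ) → ℂ, AnalyticAt ℂ f (actTorus w h) → ∀ ξ η : Fin n → ℂ,
      hypOp B Rp k a ξ η (fun x => f (actTorus w x)) h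
        = hypOp B Rp k a (actLie w ξ) (actLie w η) f (actTorus w h)

end ToricHypergeometric

-- In coordinates h = p e^v the fields θ_ξ are constant, and the system expresses the Hessian of f
-- through f and df. A solution is therefore the same as a horizontal section F = (f, df) of a
-- linear total differential system dF = A F of rank n+1. Uniqueness bounds the solution space by
-- n+1; Frobenius' theorem gives equality once A is flat.
--
-- Apart from a constant term, A is a sum of terms cot_α · α ⊗ (constant endomorphism). Each
-- coefficient depends on v only through α(v), so dA = 0 and flatness means that A(v) and A(w)
-- commute. The surviving obstruction is the sum over α, β > 0 of (α,β) cot_α cot_β (α∧β)(v,w)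
-- α(η)β(μ), which has to equal 4a times the form induced on bivectors (`sum_cot_mul_cot`).
-- Antisymmetrising makes it a sum over all pairs of roots; proportional and orthogonal pairs drop
-- out, and the rest fall into triples α+β+γ = 0, on which the addition law of the hyperbolic
-- cotangent leaves a constant. What remains is the tensor Σ (α,β)² (α∧β)⊗(α∧β).
--
-- This tensor is invariant under reflections, hence a multiple of the form on Λ²𝔥. Irreducibility
-- of Λ²𝔥 is replaced by a direct argument: wedges of two simple roots are eigenvectors, and
-- eigenvalues propagate along the connected diagram (`eq_of_slide`). The multiple is found by a
-- partial trace against a dominant root, using that the Casimir tensor is 2h times the form, h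
-- being the Coxeter number. This yields 4a(n-1) = h(h-2), which the listed values of a satisfy.
--
-- The other two claims are more elementary. Products of two logarithmic coordinates separate the
-- symmetric second order symbols, whence independence. Elements of W' are linear in logarithmic
-- coordinates and permute the roots, while the summand for α does not change under α ↦ -α, whence
-- invariance.

namespace ToricHypergeometric

/-! ### Combinatorial data of the Cartan matrices -/

/-- A function on pairs of distinct vertices of a connected graph that is symmetric and does not
change when one of the two vertices moves along an edge is constant. -/
theorem eq_of_slide {ι κ : Type*} {r : ι → ι → Prop} (hirr : ∀ i, ¬ r i i)
    (hconn : ∀ i j, Relation.ReflTransGen r i j)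
    {c : ι → ι → κ} (hc : ∀ i j, c i j = c j i)
    (hslide : ∀ i j k, i ≠ j → i ≠ k → r j k → c i j = c i k)
    {i j k l : ι} (hij : i ≠ j) (hkl : k ≠ l) : c i j = c k l := by
  have fixed : ∀ i j k, i ≠ j → i ≠ k → c i j = c i k := by
    intro i j k hij hik
    -- A path from j may run through i, where the pair (i, i) is not allowed. The second clause
    -- jumps over i: for distinct neighbours x, b of i, sliding and symmetry give c(i,x) = c(x,b) =
    -- c(b,i).
    have key : ∀ x, Relation.ReflTransGen r j x →
        (x ≠ i → c i j = c i x) ∧ (x = i → ∀ b, r i b → c i j = c i b) := by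
      intro x hx
      induction hx with
      | refl => exact ⟨fun _ => rfl, fun h => absurd h.symm hij⟩
      | @tail x y _ hxy ih =>
        refine ⟨fun hy => ?_, ?_⟩
        · by_cases hx : x = i
          · exact ih.2 hx y (hx ▸ hxy)
          · exact (ih.1 hx).trans (hslide i x y (Ne.symm hx) (Ne.symm hy) hxy)
        · rintro rfl b hb
          have hx : x ≠ y := fun h => hirr y (h ▸ hxy)
          have hby : b ≠ y := fun h => hirr y (h ▸ hb)
          rw [ih.1 hx]
          by_cases hbx : b = x
          · rw [hbx]
          · rw [hc y x, hslide x y b hx (Ne.symm hbx) hb, hc x b,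
              hslide b x y hbx hby hxy, hc]
    exact (key k (hconn j k)).1 (Ne.symm hik)
  by_cases hli : l = i
  · subst hli
    rw [hc k l]
    exact fixed l j k hij (Ne.symm hkl)
  · rw [fixed i j l hij (Ne.symm hli), hc i l, fixed l i k hli (Ne.symm hkl), hc]

/-- Both vertices descend along edges to the base vertex `o`, and symmetry reverses one of the two
paths. -/
theorem connected_of_descent {ι : Type*} {r : ι → ι → Prop} (hsymm : ∀ i j, r i j → r j i)
    (o : ι) (rk : ι → ℕ) (h : ∀ i, i ≠ o → ∃ j, rk j < rk i ∧ r i j) (i j : ι) :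
    Relation.ReflTransGen r i j := by
  have key : ∀ m i, rk i = m → Relation.ReflTransGen r i o := by
    intro m
    induction m using Nat.strong_induction_on with
    | _ m ih =>
      intro i hi
      by_cases hio : i = o
      · rw [hio]
      · obtain ⟨j, hj, hij⟩ := h i hio
        exact .head hij (ih _ (hi ▸ hj) j rfl)
  refine (key _ i rfl).trans ?_
  have : Std.Symm r := ⟨hsymm⟩
  exact symm_of (Relation.ReflTransGen r) (key _ j rfl)

/-- A simply laced Cartan matrix with a connected diagram, and the coefficients `m` of a dominant
root whose height is `h - 1`. -/
structure IsDominantRoot {ι : Type*} [Fintype ι] (C : Matrix ι ι ℤ) (m : ι → ℤ) : Prop where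
  diag : ∀ i, C i i = 2
  symm : ∀ i j, C i j = C j i
  simplyLaced : ∀ i j, i ≠ j → C i j = 0 ∨ C i j = -1
  connected : ∀ i j, Relation.ReflTransGen (fun i j => C i j = -1) i j
  pos : ∀ i, 0 < m i
  dominant : ∀ i, 0 ≤ (C *ᵥ m) i
  norm : m ⬝ᵥ C *ᵥ m = 2

theorem sum_indicator {n : ℕ} (a : ℕ) (f : ℕ → ℤ) :
    ∑ j : Fin n, (if (j : ℕ) = a then f j else 0) = if a < n then f a else 0 := by
  split_ifs with h
  · rw [Finset.sum_eq_single (⟨a, h⟩ : Fin n)]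
    · simp
    · intro b _ hb
      exact if_neg fun h' => hb (Fin.ext h')
    · simp
  · refine Finset.sum_eq_zero fun j _ => if_neg ?_
    have := j.2
    omega

theorem isDominantRoot_A {n : ℕ} (hn : 1 ≤ n) :
    IsDominantRoot (CartanMatrix.A n) fun _ => 1 := by
  have hrow : ∀ i : Fin n, (CartanMatrix.A n *ᵥ fun _ => 1) i
      = (if (i : ℕ) = 0 then 1 else 0) + if (i : ℕ) = n - 1 then 1 else 0 := by
    intro i
    have hi := i.2
    -- The position `n` lies outside `Fin n` and stands for the missing left neighbour of vertex 0,
    -- where truncated subtraction would give 0 instead.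
    have h : ∀ j : Fin n, CartanMatrix.A n i j * 1
        = (if (j : ℕ) = i then 2 else 0) + (if (j : ℕ) = i + 1 then -1 else 0)
          + (if (j : ℕ) = (if (i : ℕ) = 0 then n else i - 1) then -1 else 0) := by
      intro j
      have hj := j.2
      simp only [CartanMatrix.A, Matrix.of_apply, Fin.ext_iff]
      split_ifs <;> omega
    rw [mulVec, dotProduct, Finset.sum_congr rfl fun j _ => h j, Finset.sum_add_distrib,
      Finset.sum_add_distrib, sum_indicator _ fun _ => 2, sum_indicator _ fun _ => -1,
      sum_indicator _ fun _ => -1]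
    split_ifs <;> omega
  refine ⟨fun i => by simp [CartanMatrix.A], fun i j => (CartanMatrix.A_isSymm n).apply j i,
    fun i j h => CartanMatrix.isSimplyLaced_A n h, ?_, fun _ => one_pos, fun i => ?_, ?_⟩
  · refine connected_of_descent
      (fun i j h => by rw [(CartanMatrix.A_isSymm n).apply i j]; exact h) ⟨0, hn⟩
      (fun i => i) fun i hi => ⟨⟨i - 1, by omega⟩, ?_, ?_⟩
    · have : (i : ℕ) ≠ 0 := fun h => hi (Fin.ext h)
      simp only
      omega
    · have : (i : ℕ) ≠ 0 := fun h => hi (Fin.ext h)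
      simp only [CartanMatrix.A, Matrix.of_apply, Fin.ext_iff]
      split_ifs <;> omega
  · rw [hrow]
    positivity
  · rw [dotProduct, Finset.sum_congr rfl fun i _ => by rw [one_mul, hrow],
      Finset.sum_add_distrib, sum_indicator _ fun _ => 1, sum_indicator _ fun _ => 1]
    split_ifs <;> omega

/-- The coefficients of the highest root of type `D n`. -/
def highestRootD (n i : ℕ) : ℤ :=
  if i = 0 then 1 else if i + 2 < n then 2 else 1

theorem isDominantRoot_D {n : ℕ} (hn : 4 ≤ n) :
    IsDominantRoot (CartanMatrix.D n) fun i => highestRootD n i := by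
  have hrow : ∀ i : Fin n, (CartanMatrix.D n *ᵥ fun i : Fin n => highestRootD n i) i
      = if (i : ℕ) = 1 then 1 else 0 := by
    intro i
    have hi := i.2
    -- The neighbours of i: `p` towards vertex 0, `q` the next one, and `r` the second branch at the
    -- fork n-3. The value `n` means that there is none.
    set p : ℕ := if (i : ℕ) = 0 then n else if (i : ℕ) + 1 = n then i - 2 else i - 1 with hp
    set q : ℕ := if (i : ℕ) + 3 ≤ n then i + 1 else n with hq
    set r : ℕ := if (i : ℕ) + 3 = n then n - 1 else n with hr
    have h : ∀ j : Fin n, CartanMatrix.D n i j * highestRootD n j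
        = (if (j : ℕ) = i then 2 * highestRootD n j else 0)
          + (if (j : ℕ) = p then -highestRootD n j else 0)
          + (if (j : ℕ) = q then -highestRootD n j else 0)
          + (if (j : ℕ) = r then -highestRootD n j else 0) := by
      intro j
      have hj := j.2
      have hC : CartanMatrix.D n i j = (if (j : ℕ) = i then 2 else 0)
          + (if (j : ℕ) = p then -1 else 0) + (if (j : ℕ) = q then -1 else 0)
          + (if (j : ℕ) = r then -1 else 0) := by
        simp only [CartanMatrix.D, Matrix.of_apply, Fin.ext_iff]
        grind
      rw [hC]
      split_ifs <;> ring
    rw [mulVec, dotProduct, Finset.sum_congr rfl fun j _ => h j, Finset.sum_add_distrib,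
      Finset.sum_add_distrib, Finset.sum_add_distrib,
      sum_indicator _ fun j => 2 * highestRootD n j, sum_indicator _ fun j => -highestRootD n j,
      sum_indicator _ fun j => -highestRootD n j, sum_indicator _ fun j => -highestRootD n j]
    simp only [highestRootD]
    grind
  refine ⟨CartanMatrix.D_diag n, fun i j => (CartanMatrix.D_isSymm n).apply j i,
    fun i j h => CartanMatrix.isSimplyLaced_D n h, ?_, fun i => ?_, fun i => ?_, ?_⟩
  · refine connected_of_descent
      (fun i j h => by rw [(CartanMatrix.D_isSymm n).apply i j]; exact h) ⟨0, by omega⟩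
      (fun i => i) fun i hi => ⟨⟨if (i : ℕ) + 1 = n then i - 2 else i - 1, ?_⟩, ?_, ?_⟩
    · have := i.2
      split_ifs <;> omega
    · have : (i : ℕ) ≠ 0 := fun h => hi (Fin.ext h)
      simp only
      split_ifs <;> omega
    · have : (i : ℕ) ≠ 0 := fun h => hi (Fin.ext h)
      have := i.2
      simp only [CartanMatrix.D, Matrix.of_apply, Fin.ext_iff]
      grind
  · simp only [highestRootD]
    split_ifs <;> norm_num
  · rw [hrow]
    positivity
  · have h : ∀ i : Fin n, highestRootD n i * (CartanMatrix.D n *ᵥ fun i : Fin n =>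
        highestRootD n i) i = if (i : ℕ) = 1 then highestRootD n i else 0 := by
      intro i
      rw [hrow, mul_ite, mul_one, mul_zero]
    rw [dotProduct, Finset.sum_congr rfl fun i _ => h i, sum_indicator _ fun i => highestRootD n i,
      if_pos (by omega), highestRootD, if_neg one_ne_zero, if_pos (by omega)]

theorem sum_highestRootD {n : ℕ} (hn : 4 ≤ n) :
    ∑ i : Fin n, highestRootD n i = 2 * n - 3 := by
  have h : ∀ i : Fin n, highestRootD n i = 2 + (if (i : ℕ) = 0 then -1 else 0)
      + (if (i : ℕ) = n - 1 then -1 else 0) + (if (i : ℕ) = n - 2 then -1 else 0) := by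
    intro i
    have := i.2
    simp only [highestRootD]
    split_ifs <;> omega
  rw [Finset.sum_congr rfl fun i _ => h i, Finset.sum_add_distrib, Finset.sum_add_distrib,
    Finset.sum_add_distrib, sum_indicator _ fun _ => -1, sum_indicator _ fun _ => -1,
    sum_indicator _ fun _ => -1, if_pos (by omega), if_pos (by omega), if_pos (by omega)]
  simp
  ring

theorem isDominantRoot_E₆ : IsDominantRoot CartanMatrix.E₆ ![1, 2, 2, 3, 2, 1] := by
  refine ⟨CartanMatrix.E₆_diag, fun i j => CartanMatrix.E₆_isSymm.apply j i,
    fun i j h => CartanMatrix.isSimplyLaced_E₆ h, ?_, by decide, by decide, by decide⟩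
  -- The vector lists for each vertex a neighbour with a larger number, so that every vertex is led
  -- to the last one. The same device serves the two larger diagrams.
  have h : ∀ i : Fin 6, i ≠ 5 →
      5 - (((![2, 3, 3, 4, 5, 5] : Fin 6 → Fin 6) i : Fin 6) : ℕ) < 5 - (i : ℕ) ∧
        CartanMatrix.E₆ i ((![2, 3, 3, 4, 5, 5] : Fin 6 → Fin 6) i) = -1 := by decide
  exact connected_of_descent (fun i j h => by rw [CartanMatrix.E₆_isSymm.apply i j]; exact h) 5
    (fun i => 5 - i) fun i hi => ⟨_, h i hi⟩

theorem isDominantRoot_E₇ : IsDominantRoot CartanMatrix.E₇ ![2, 2, 3, 4, 3, 2, 1] := by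
  refine ⟨CartanMatrix.E₇_diag, fun i j => CartanMatrix.E₇_isSymm.apply j i,
    fun i j h => CartanMatrix.isSimplyLaced_E₇ h, ?_, by decide, by decide, by decide⟩
  have h : ∀ i : Fin 7, i ≠ 6 →
      6 - (((![2, 3, 3, 4, 5, 6, 6] : Fin 7 → Fin 7) i : Fin 7) : ℕ) < 6 - (i : ℕ) ∧
        CartanMatrix.E₇ i ((![2, 3, 3, 4, 5, 6, 6] : Fin 7 → Fin 7) i) = -1 := by decide
  exact connected_of_descent (fun i j h => by rw [CartanMatrix.E₇_isSymm.apply i j]; exact h) 6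
    (fun i => 6 - i) fun i hi => ⟨_, h i hi⟩

theorem isDominantRoot_E₈ : IsDominantRoot CartanMatrix.E₈ ![2, 3, 4, 6, 5, 4, 3, 2] := by
  refine ⟨CartanMatrix.E₈_diag, fun i j => CartanMatrix.E₈_isSymm.apply j i,
    fun i j h => CartanMatrix.isSimplyLaced_E₈ h, ?_, by decide, by decide, by decide⟩
  have h : ∀ i : Fin 8, i ≠ 7 →
      7 - (((![2, 3, 3, 4, 5, 6, 7, 7] : Fin 8 → Fin 8) i : Fin 8) : ℕ) < 7 - (i : ℕ) ∧
        CartanMatrix.E₈ i ((![2, 3, 3, 4, 5, 6, 7, 7] : Fin 8 → Fin 8) i) = -1 := by decide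
  exact connected_of_descent (fun i j h => by rw [CartanMatrix.E₈_isSymm.apply i j]; exact h) 7
    (fun i => 7 - i) fun i hi => ⟨_, h i hi⟩

/-- The constant `a` in terms of the height `e` of the highest root, which is one less than the
Coxeter number. -/
theorem ADEType.exists_isDominantRoot (X : ADEType) :
    ∃ (m : Fin X.rank → ℤ) (e : ℤ), IsDominantRoot X.cartanMatrix m ∧ ∑ i, m i = e ∧ 0 < e ∧
      4 * X.a * (X.rank - 1) = (e + 1) * (e - 1) := by
  cases X with
  | A n hn =>
    refine ⟨_, n, isDominantRoot_A hn, ?_, by omega, ?_⟩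
    · change ∑ _ : Fin n, (1 : ℤ) = n
      simp
    · simp only [ADEType.a, ADEType.rank]
      push_cast
      ring
  | D n hn =>
    refine ⟨_, 2 * n - 3, isDominantRoot_D hn, sum_highestRootD hn, by omega, ?_⟩
    simp only [ADEType.a, ADEType.rank]
    push_cast
    ring
  | E₆ =>
    refine ⟨_, 11, isDominantRoot_E₆, ?_, by norm_num, ?_⟩
    · change ∑ i, ![1, 2, 2, 3, 2, 1] i = (11 : ℤ)
      decide
    · norm_num [ADEType.rank, ADEType.a]
  | E₇ =>
    refine ⟨_, 17, isDominantRoot_E₇, ?_, by norm_num, ?_⟩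
    · change ∑ i, ![2, 2, 3, 4, 3, 2, 1] i = (17 : ℤ)
      decide
    · norm_num [ADEType.rank, ADEType.a]
  | E₈ =>
    refine ⟨_, 29, isDominantRoot_E₈, ?_, by norm_num, ?_⟩
    · change ∑ i, ![2, 3, 4, 6, 5, 4, 3, 2] i = (29 : ℤ)
      decide
    · norm_num [ADEType.rank, ADEType.a]

/-- A Perron–Frobenius argument. Let o maximise c_i / m_i and suppose c_o > 0. Then d = c_o m - m_o
c is nonnegative, vanishes at o, and C d = c_o C m ≥ 0. At a zero of d the row of C d has only
nonpositive terms, so d vanishes at the neighbours too, and by connectedness everywhere. Then C m =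
0, against the norm 2 of m. -/
theorem IsDominantRoot.nonpos_of_mulVec_eq_zero {ι : Type*} [Fintype ι] {C : Matrix ι ι ℤ}
    {m : ι → ℤ} (h : IsDominantRoot C m) {c : ι → ℤ} (hc : C *ᵥ c = 0) (i : ι) : c i ≤ 0 := by
  obtain ⟨o, -, ho⟩ := Finset.exists_max_image Finset.univ (fun i => (c i : ℚ) / m i)
    ⟨i, Finset.mem_univ i⟩
  have hd : ∀ j, 0 ≤ c o * m j - c j * m o := by
    intro j
    have h1 := ho j (Finset.mem_univ j)
    have hj : (0 : ℚ) < m j := by exact_mod_cast h.pos j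
    have ho : (0 : ℚ) < m o := by exact_mod_cast h.pos o
    rw [div_le_div_iff₀ hj ho] at h1
    have h2 : c j * m o ≤ c o * m j := by exact_mod_cast h1
    omega
  by_contra! hci
  have hco : 0 < c o := by
    have := hd i
    have := h.pos i
    have := h.pos o
    by_contra! hneg
    nlinarith
  have hsum : ∀ j, ∑ l, C j l * (c o * m l - c l * m o) = c o * (C *ᵥ m) j := by
    intro j
    have h0 : ∑ l, C j l * c l = 0 := congrFun hc j
    calc ∑ l, C j l * (c o * m l - c l * m o)
        = c o * ∑ l, C j l * m l - m o * ∑ l, C j l * c l := by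
          rw [Finset.mul_sum, Finset.mul_sum, ← Finset.sum_sub_distrib]
          exact Finset.sum_congr rfl fun l _ => by ring
      _ = c o * (C *ᵥ m) j := by rw [h0, mul_zero, sub_zero]; rfl
  have hterm : ∀ j, c o * m j - c j * m o = 0 →
      ∀ l ∈ Finset.univ, C j l * (c o * m l - c l * m o) ≤ 0 := by
    intro j hj l _
    by_cases hjl : j = l
    · rw [← hjl, hj, mul_zero]
    · have := hd l
      rcases h.simplyLaced j l hjl with h' | h' <;> rw [h'] <;> omega
  have hall : ∀ j, c o * m j - c j * m o = 0 := by
    intro j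
    induction h.connected o j with
    | refl => ring
    | @tail x y _ hxy ih =>
      have h1 := Finset.sum_nonpos (hterm x ih)
      have h2 : 0 ≤ c o * (C *ᵥ m) x := mul_nonneg hco.le (h.dominant x)
      rw [hsum] at h1
      have h3 := (Finset.sum_eq_zero_iff_of_nonpos (hterm x ih)).1
        ((hsum x).trans (le_antisymm h1 h2)) y (Finset.mem_univ y)
      rw [hxy] at h3
      omega
  have hm : ∀ j, (C *ᵥ m) j = 0 := by
    intro j
    have h1 := Finset.sum_nonpos (hterm j (hall j))
    rw [hsum] at h1
    have h2 := h.dominant j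
    nlinarith
  have h2 := h.norm
  rw [dotProduct, Finset.sum_eq_zero fun j _ => by rw [hm, mul_zero]] at h2
  omega

/-- A Cartan matrix with a dominant root is nondegenerate. -/
theorem IsDominantRoot.eq_zero_of_mulVec_eq_zero {ι : Type*} [Fintype ι] {C : Matrix ι ι ℤ}
    {m : ι → ℤ} (h : IsDominantRoot C m) {c : ι → ℤ} (hc : C *ᵥ c = 0) : c = 0 := by
  funext i
  have h1 := h.nonpos_of_mulVec_eq_zero hc i
  have h2 := h.nonpos_of_mulVec_eq_zero (c := -c) (by rw [mulVec_neg, hc, neg_zero]) i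
  rw [Pi.neg_apply] at h2
  rw [Pi.zero_apply]
  omega

/-! ### Invariant tensors of a simply laced root system -/

section RootTensors

variable {V : Type*} [AddCommGroup V] [Module ℂ V]

/-- A finite set of vectors of squared length `2` that is stable under its reflections, and whose
mutual scalar products are `0`, `1`, `-1` except for proportional vectors. -/
structure IsSimplyLacedRootSet (b : LinearMap.BilinForm ℂ V) (R : Finset V) : Prop where
  symm : ∀ x y, b x y = b y x
  norm : ∀ α ∈ R, b α α = 2
  reflect : ∀ α ∈ R, ∀ β ∈ R, β - b α β • α ∈ R
  scalar : ∀ α ∈ R, ∀ β ∈ R, β = α ∨ β = -α ∨ b α β = 0 ∨ b α β = 1 ∨ b α β = -1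

/-- A system of simple roots that spans and whose diagram is connected. -/
structure IsConnectedBase (b : LinearMap.BilinForm ℂ V) (R : Finset V) {ι : Type*}
    (s : ι → V) : Prop where
  mem : ∀ i, s i ∈ R
  span : Submodule.span ℂ (Set.range s) = ⊤
  scalar : ∀ i j, i ≠ j → b (s i) (s j) = 0 ∨ b (s i) (s j) = -1
  connected : ∀ i j, Relation.ReflTransGen (fun i j => b (s i) (s j) = -1) i j

/-- The quadratic tensor of a set of roots. -/
def casimir (b : LinearMap.BilinForm ℂ V) (R : Finset V) (x y : V) : ℂ :=
  ∑ α ∈ R, b α x * b α y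

/-- The contraction of `α ∧ β` with `x ∧ y`. -/
def wedge (b : LinearMap.BilinForm ℂ V) (α β x y : V) : ℂ :=
  b α x * b β y - b α y * b β x

/-- The tensor `∑ (α, β) ^ 2 (α ∧ β) ⊗ (α ∧ β)` of a set of roots. -/
def wedgeTensor (b : LinearMap.BilinForm ℂ V) (R : Finset V) (x y z w : V) : ℂ :=
  ∑ α ∈ R, ∑ β ∈ R, b α β ^ 2 * (wedge b α β x y * wedge b α β z w)

variable {b : LinearMap.BilinForm ℂ V} {R : Finset V}

namespace IsSimplyLacedRootSet

theorem reflect_reflect (h : IsSimplyLacedRootSet b R) {α : V} (hα : α ∈ R) (x : V) :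
    (x - b α x • α) - b α (x - b α x • α) • α = x := by
  simp only [map_sub, map_smul, smul_eq_mul, h.norm α hα]
  module

theorem sum_reflect (h : IsSimplyLacedRootSet b R) {α : V} (hα : α ∈ R) (f : V → ℂ) :
    ∑ β ∈ R, f (β - b α β • α) = ∑ β ∈ R, f β :=
  Finset.sum_nbij' (fun β => β - b α β • α) (fun β => β - b α β • α)
    (h.reflect α hα) (h.reflect α hα) (fun β _ => h.reflect_reflect hα β)
    (fun β _ => h.reflect_reflect hα β) fun _ _ => rfl

theorem neg_mem (h : IsSimplyLacedRootSet b R) {α : V} (hα : α ∈ R) : -α ∈ R := by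
  have h1 := h.reflect α hα α hα
  rwa [h.norm α hα, show α - (2 : ℂ) • α = -α by module] at h1

theorem apply_reflect (h : IsSimplyLacedRootSet b R) (α x y : V) :
    b x (y - b α y • α) = b (x - b α x • α) y := by
  simp only [map_sub, map_smul, LinearMap.sub_apply, LinearMap.smul_apply, smul_eq_mul,
    h.symm x α]
  ring

theorem apply_reflect_reflect (h : IsSimplyLacedRootSet b R) {α : V} (hα : α ∈ R) (x y : V) :
    b (x - b α x • α) (y - b α y • α) = b x y := by
  rw [h.apply_reflect, h.reflect_reflect hα]

theorem casimir_reflect (h : IsSimplyLacedRootSet b R) {α : V} (hα : α ∈ R) (x y : V) :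
    casimir b R (x - b α x • α) (y - b α y • α) = casimir b R x y := by
  simp only [casimir, h.apply_reflect]
  exact h.sum_reflect hα fun β => b β x * b β y

theorem wedgeTensor_reflect (h : IsSimplyLacedRootSet b R) {α : V} (hα : α ∈ R) (x y z w : V) :
    wedgeTensor b R (x - b α x • α) (y - b α y • α) (z - b α z • α) (w - b α w • α)
      = wedgeTensor b R x y z w := by
  simp only [wedgeTensor, wedge, h.apply_reflect]
  rw [← h.sum_reflect hα]
  refine Finset.sum_congr rfl fun β _ => ?_
  rw [← h.sum_reflect hα]
  refine Finset.sum_congr rfl fun γ _ => ?_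
  simp only [h.apply_reflect_reflect hα, h.reflect_reflect hα]

end IsSimplyLacedRootSet

theorem casimir_comm (x y : V) : casimir b R x y = casimir b R y x :=
  Finset.sum_congr rfl fun _ _ => mul_comm _ _

theorem casimir_add_smul (x y z : V) (c : ℂ) :
    casimir b R x (y + c • z) = casimir b R x y + c * casimir b R x z := by
  simp only [casimir, map_add, map_smul, smul_eq_mul, Finset.mul_sum, ← Finset.sum_add_distrib]
  exact Finset.sum_congr rfl fun _ _ => by ring

theorem wedgeTensor_comm (x y z w : V) : wedgeTensor b R x y z w = wedgeTensor b R z w x y :=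
  Finset.sum_congr rfl fun _ _ => Finset.sum_congr rfl fun _ _ => by ring

theorem wedgeTensor_swap_left (x y z w : V) :
    wedgeTensor b R y x z w = -wedgeTensor b R x y z w := by
  simp only [wedgeTensor, wedge, ← Finset.sum_neg_distrib]
  exact Finset.sum_congr rfl fun _ _ => Finset.sum_congr rfl fun _ _ => by ring

theorem wedgeTensor_swap_right (x y z w : V) :
    wedgeTensor b R x y w z = -wedgeTensor b R x y z w := by
  rw [wedgeTensor_comm, wedgeTensor_swap_left, wedgeTensor_comm]

theorem wedgeTensor_add_smul (x y z w u : V) (c : ℂ) :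
    wedgeTensor b R x y z (w + c • u) = wedgeTensor b R x y z w + c * wedgeTensor b R x y z u := by
  simp only [wedgeTensor, wedge, map_add, map_smul, smul_eq_mul, Finset.mul_sum,
    ← Finset.sum_add_distrib]
  exact Finset.sum_congr rfl fun _ _ => Finset.sum_congr rfl fun _ _ => by ring

theorem wedgeTensor_sub_smul_right (x y z w u : V) (c : ℂ) :
    wedgeTensor b R x y z (w - c • u) = wedgeTensor b R x y z w - c * wedgeTensor b R x y z u := by
  have := wedgeTensor_add_smul (b := b) (R := R) x y z w u (-c)
  rw [neg_smul, ← sub_eq_add_neg] at this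
  rw [this]
  ring

theorem wedgeTensor_sub_smul_left (x y z w u : V) (c : ℂ) :
    wedgeTensor b R x y (z - c • u) w = wedgeTensor b R x y z w - c * wedgeTensor b R x y u w := by
  rw [← neg_inj, ← wedgeTensor_swap_right, wedgeTensor_sub_smul_right, wedgeTensor_swap_right,
    wedgeTensor_swap_right x y u w]
  ring

theorem wedgeTensor_self_left (x z w : V) : wedgeTensor b R x x z w = 0 := by
  simp only [wedgeTensor, wedge]
  exact Finset.sum_eq_zero fun _ _ => Finset.sum_eq_zero fun _ _ => by ring

theorem wedgeTensor_self_right (x y z : V) : wedgeTensor b R x y z z = 0 := by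
  rw [wedgeTensor_comm, wedgeTensor_self_left]

namespace IsSimplyLacedRootSet

/-- Invariance under the reflection in x, which sends x to -x and y to y - b(x,y) x. -/
theorem two_mul_casimir (h : IsSimplyLacedRootSet b R) {x : V} (hx : x ∈ R) (y : V) :
    2 * casimir b R x y = b x y * casimir b R x x := by
  have h1 := h.casimir_reflect hx x y
  rw [h.norm x hx, show x - (2 : ℂ) • x = x + (-2 : ℂ) • x by module,
    show y - b x y • x = y + (-b x y) • x by module, casimir_add_smul,
    casimir_comm (x + (-2 : ℂ) • x), casimir_comm (x + (-2 : ℂ) • x), casimir_add_smul,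
    casimir_add_smul, casimir_comm y x] at h1
  linear_combination -h1

/-- The reflection in x negates x ∧ y, because the multiple of x subtracted from y is killed by the
wedge. Expanding the reflected z ∧ w then gives the relation. -/
theorem two_mul_wedgeTensor (h : IsSimplyLacedRootSet b R) {x : V} (hx : x ∈ R) (y z w : V) :
    2 * wedgeTensor b R x y z w
      = b x z * wedgeTensor b R x y x w - b x w * wedgeTensor b R x y x z := by
  have h1 := h.wedgeTensor_reflect hx x y z w
  have h2 : wedgeTensor b R (x - b x x • x) (y - b x y • x) (z - b x z • x) (w - b x w • x)
      = -wedgeTensor b R x y (z - b x z • x) (w - b x w • x) := by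
    rw [wedgeTensor_comm, wedgeTensor_sub_smul_left]
    simp only [wedgeTensor_sub_smul_right (z - _) (w - _), wedgeTensor_self_right, h.norm x hx]
    rw [wedgeTensor_comm x y]
    ring
  rw [h2, wedgeTensor_sub_smul_left, wedgeTensor_sub_smul_right, wedgeTensor_sub_smul_right,
    wedgeTensor_self_right, wedgeTensor_swap_right x y x z] at h1
  linear_combination -h1

/-- The bivector of two roots is an eigenvector of the wedge tensor. -/
theorem wedgeTensor_root (h : IsSimplyLacedRootSet b R) {x y : V} (hx : x ∈ R) (hy : y ∈ R)
    (z w : V) :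
    (4 - b x y ^ 2) * wedgeTensor b R x y z w = wedgeTensor b R x y x y * wedge b x y z w := by
  have hx' := h.two_mul_wedgeTensor hx y
  have hy' : ∀ z w, 2 * wedgeTensor b R x y z w
      = b y z * wedgeTensor b R x y y w - b y w * wedgeTensor b R x y y z := by
    intro z w
    have := h.two_mul_wedgeTensor hy x z w
    rw [wedgeTensor_swap_left, wedgeTensor_swap_left x y y w,
      wedgeTensor_swap_left x y y z] at this
    linear_combination -this
  -- The reflections in x and in y express the values on x ∧ w and y ∧ w through each other;
  -- eliminating the second leaves the determinant 4 - b(x,y)².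
  have h1 : ∀ w, (4 - b x y ^ 2) * wedgeTensor b R x y x w
      = wedgeTensor b R x y x y * (2 * b y w - b x y * b x w) := by
    intro w
    have e1 := hy' x w
    have e2 := hx' y w
    rw [wedgeTensor_swap_right x y x y] at e1
    rw [h.symm y x] at e1
    linear_combination 2 * e1 + b x y * e2
  rw [wedge]
  linear_combination (4 - b x y ^ 2) / 2 * hx' z w + b x z / 2 * h1 w - b x w / 2 * h1 z

end IsSimplyLacedRootSet

theorem wedge_swap_left (x y z w : V) : wedge b y x z w = -wedge b x y z w := by
  rw [wedge, wedge]
  ring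

theorem wedge_add_smul_left (x y u z w : V) (c : ℂ) :
    wedge b (x + c • u) y z w = wedge b x y z w + c * wedge b u y z w := by
  simp only [wedge, map_add, map_smul, LinearMap.add_apply, LinearMap.smul_apply, smul_eq_mul]
  ring

theorem wedgeTensor_add_smul_left (x y z w u : V) (c : ℂ) :
    wedgeTensor b R (x + c • u) y z w = wedgeTensor b R x y z w + c * wedgeTensor b R u y z w := by
  rw [wedgeTensor_comm, wedgeTensor_swap_right, wedgeTensor_add_smul, wedgeTensor_comm x,
    wedgeTensor_comm u, wedgeTensor_swap_right z w y x, wedgeTensor_swap_right z w y u]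
  ring

theorem wedge_smul_smul (x : V) (c d : ℂ) (z w : V) : wedge b (c • x) (d • x) z w = 0 := by
  simp only [wedge, map_smul, LinearMap.smul_apply, smul_eq_mul]
  ring

namespace IsConnectedBase

variable {ι : Type*} {s : ι → V}

theorem eq_zero (hs : IsConnectedBase b R s) {f : V → ℂ}
    (hf : ∀ x y (c : ℂ), f (x + c • y) = f x + c * f y) (h : ∀ i, f (s i) = 0) (x : V) :
    f x = 0 := by
  have h0 : f 0 = 0 := by
    have := hf 0 0 1
    rw [smul_zero, add_zero] at this
    linear_combination -this
  have hx : x ∈ Submodule.span ℂ (Set.range s) := hs.span ▸ Submodule.mem_top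
  induction hx using Submodule.span_induction with
  | mem x hx => obtain ⟨i, rfl⟩ := hx; exact h i
  | zero => exact h0
  | add x y _ _ hx hy => rw [← one_smul ℂ y, hf, hx, hy]; ring
  | smul c x _ hx => rw [← zero_add (c • x), hf, hx, h0]; ring

/-- A hands-on Schur lemma: `two_mul_casimir`, read from either end of an edge of the diagram, shows
that adjacent simple roots have the same Casimir norm. Connectedness makes the tensor proportional
to `b`, and θ fixes the factor. -/
theorem casimir_eq (hs : IsConnectedBase b R s) (h : IsSimplyLacedRootSet b R) {θ : V} {k : ℂ}
    (hθ : b θ θ = 2) (hk : casimir b R θ θ = 4 * k) (x y : V) :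
    casimir b R x y = 2 * k * b x y := by
  obtain ⟨c, hc⟩ : ∃ c, ∀ i, casimir b R (s i) (s i) = c := by
    by_cases hι : Nonempty ι
    · obtain ⟨o⟩ := hι
      refine ⟨casimir b R (s o) (s o), fun i => ?_⟩
      induction hs.connected o i with
      | refl => rfl
      | @tail i j _ hij ih =>
        rw [← ih]
        have h1 := h.two_mul_casimir (hs.mem i) (s j)
        have h2 := h.two_mul_casimir (hs.mem j) (s i)
        rw [casimir_comm, h.symm, hij] at h2
        rw [hij] at h1
        linear_combination h2 - h1
    · exact ⟨0, fun i => absurd ⟨i⟩ hι⟩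
  have key : ∀ x y, 2 * casimir b R x y - c * b x y = 0 := by
    intro x y
    refine hs.eq_zero (f := fun x => 2 * casimir b R x y - c * b x y) (fun x z d => ?_)
      (fun i => ?_) x
    · rw [casimir_comm, casimir_add_smul, casimir_comm x, casimir_comm z, map_add, map_smul,
        LinearMap.add_apply, LinearMap.smul_apply, smul_eq_mul]
      ring
    · rw [h.two_mul_casimir (hs.mem i), hc]
      ring
  have h1 := key θ θ
  rw [hk, hθ] at h1
  linear_combination (key x y) / 2 - b x y / 4 * h1

/-- Each s_i ∧ s_j is an eigenvector, with eigenvalue c(i,j). As the tensor is symmetric, two such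
bivectors with nonzero scalar product share their eigenvalue. This applies to s_i ∧ s_j and s_i ∧
s_k for adjacent j, k, so `eq_of_slide` makes all eigenvalues equal. -/
theorem exists_wedgeTensor_eq (hs : IsConnectedBase b R s) (h : IsSimplyLacedRootSet b R) :
    ∃ c : ℂ, ∀ x y z w, wedgeTensor b R x y z w = c * wedge b x y z w := by
  have hne : ∀ i j, i ≠ j → 4 - b (s i) (s j) ^ 2 ≠ 0 := by
    intro i j hij
    rcases hs.scalar i j hij with h' | h' <;> rw [h'] <;> norm_num
  let c : ι → ι → ℂ := fun i j =>
    wedgeTensor b R (s i) (s j) (s i) (s j) / (4 - b (s i) (s j) ^ 2)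
  have hT : ∀ i j, i ≠ j → ∀ z w,
      wedgeTensor b R (s i) (s j) z w = c i j * wedge b (s i) (s j) z w := by
    intro i j hij z w
    have h1 := h.wedgeTensor_root (hs.mem i) (hs.mem j) z w
    rw [div_mul_eq_mul_div, eq_div_iff (hne i j hij), ← h1, mul_comm]
  have hsymm : ∀ i j, c i j = c j i := by
    intro i j
    simp only [c]
    rw [wedgeTensor_swap_left, wedgeTensor_swap_right, neg_neg, h.symm (s i)]
  have hslide : ∀ i j k, i ≠ j → i ≠ k → b (s j) (s k) = -1 → c i j = c i k := by
    intro i j k hij hik hjk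
    have h1 := hT i j hij (s i) (s k)
    rw [wedgeTensor_comm, hT i k hik (s i) (s j)] at h1
    have h2 : wedge b (s i) (s k) (s i) (s j) = wedge b (s i) (s j) (s i) (s k) := by
      rw [wedge, wedge, h.symm (s k) (s j), h.symm (s k) (s i), h.symm (s j) (s i)]
      ring
    -- The value is -2 - (s_i,s_k)(s_i,s_j), that is -2 or -3.
    have h3 : wedge b (s i) (s j) (s i) (s k) ≠ 0 := by
      rw [wedge, h.norm _ (hs.mem i), hjk, h.symm (s j) (s i)]
      rcases hs.scalar i j hij with e1 | e1 <;> rcases hs.scalar i k hik with e2 | e2 <;>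
        rw [e1, e2] <;> norm_num
    rw [h2] at h1
    exact (mul_right_cancel₀ h3 h1).symm
  obtain ⟨d, hd⟩ : ∃ d, ∀ i j, i ≠ j → c i j = d := by
    by_cases hι : ∃ i j : ι, i ≠ j
    · obtain ⟨i, j, hij⟩ := hι
      refine ⟨c i j, fun k l hkl => ?_⟩
      refine eq_of_slide (r := fun i j => b (s i) (s j) = -1) (fun i hi => ?_) hs.connected hsymm
        hslide hkl hij
      rw [h.norm _ (hs.mem i)] at hi
      norm_num at hi
    · push Not at hι
      exact ⟨0, fun i j hij => absurd (hι i j) hij⟩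
  have key : ∀ i j z w, wedgeTensor b R (s i) (s j) z w - d * wedge b (s i) (s j) z w = 0 := by
    intro i j z w
    by_cases hij : i = j
    · subst hij
      rw [wedgeTensor_self_left, wedge]
      ring
    · rw [hT i j hij, hd i j hij, sub_self]
  refine ⟨d, fun x y z w => sub_eq_zero.1 ?_⟩
  have hlin : ∀ y x u (e : ℂ), wedgeTensor b R (x + e • u) y z w - d * wedge b (x + e • u) y z w
      = (wedgeTensor b R x y z w - d * wedge b x y z w)
        + e * (wedgeTensor b R u y z w - d * wedge b u y z w) := by
    intro y x u e
    rw [wedgeTensor_add_smul_left, wedge_add_smul_left]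
    ring
  refine hs.eq_zero (f := fun x => wedgeTensor b R x y z w - d * wedge b x y z w)
    (hlin y) (fun i => ?_) x
  have h1 := hs.eq_zero (f := fun y => wedgeTensor b R y (s i) z w - d * wedge b y (s i) z w)
    (hlin (s i)) (fun j => key j i z w) y
  simp only [wedgeTensor_swap_left (s i), wedge_swap_left (s i)] at h1
  linear_combination -h1

end IsConnectedBase

/-- The cube of b(α,β) equals b(α,β) itself unless β = ±α. So the sum is a Casimir contraction plus
8 - 2 = 6 times b(α,z) for each of the two exceptional roots. -/
theorem sum_cube (h : IsSimplyLacedRootSet b R) {k : ℂ}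
    (hk : ∀ x y, casimir b R x y = 2 * k * b x y) {α : V} (hα : α ∈ R) (z : V) :
    ∑ β ∈ R, b α β ^ 3 * b β z = (2 * k + 12) * b α z := by
  classical
  have hne : α ≠ -α := by
    intro h0
    have h1 := h.norm α hα
    have h2 : b α α = b α (-α) := congrArg (b α) h0
    rw [map_neg, h1] at h2
    norm_num at h2
  have hterm : ∀ β ∈ R, b α β ^ 3 * b β z = b β α * b β z + (if β = α then 6 * b α z else 0)
      + (if β = -α then 6 * b α z else 0) := by
    intro β hβ
    rw [h.symm β α]
    rcases h.scalar α hα β hβ with rfl | rfl | h'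
    · rw [if_pos rfl, if_neg hne, h.norm _ hα]
      ring
    · rw [if_neg hne.symm, if_pos rfl, map_neg, map_neg, h.norm _ hα, LinearMap.neg_apply]
      ring
    · have h1 : β ≠ α := by
        rintro rfl
        rw [h.norm _ hα] at h'
        norm_num at h'
      have h2 : β ≠ -α := by
        rintro rfl
        rw [map_neg, h.norm _ hα] at h'
        norm_num at h'
      rw [if_neg h1, if_neg h2]
      rcases h' with h' | h' | h' <;> rw [h'] <;> ring
  rw [Finset.sum_congr rfl hterm, Finset.sum_add_distrib, Finset.sum_add_distrib,
    Finset.sum_ite_eq', Finset.sum_ite_eq', if_pos hα, if_pos (h.neg_mem hα)]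
  have := hk α z
  rw [casimir] at this
  rw [this]
  ring

variable [FiniteDimensional ℂ V]

/-- The number of roots is the rank times the Coxeter number. -/
theorem card_eq_of_casimir (h : IsSimplyLacedRootSet b R) (hb : ∀ x, (∀ y, b x y = 0) → x = 0)
    {k : ℂ} (hk : ∀ x y, casimir b R x y = 2 * k * b x y) :
    (R.card : ℂ) = k * Module.finrank ℂ V := by
  -- The Casimir tensor read as an endomorphism; its trace is 2|R| on one side and 2k dim V on the
  -- other.
  have h1 : ∑ α ∈ R, (b α).smulRight α = (2 * k) • (LinearMap.id : V →ₗ[ℂ] V) := by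
    ext x
    rw [← sub_eq_zero]
    refine hb _ fun y => ?_
    have := hk x y
    simp only [casimir] at this
    simp [LinearMap.sum_apply, this]
  have h2 := congrArg (LinearMap.trace ℂ V) h1
  rw [map_sum, map_smul, LinearMap.trace_id] at h2
  simp only [LinearMap.trace_smulRight] at h2
  rw [Finset.sum_congr rfl h.norm, Finset.sum_const, nsmul_eq_mul, smul_eq_mul] at h2
  linear_combination h2 / 2

/-- The wedge tensor of an irreducible simply laced root system, in terms of its Coxeter number. -/
theorem IsConnectedBase.wedgeTensor_eq {ι : Type*} {s : ι → V} (hs : IsConnectedBase b R s)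
    (h : IsSimplyLacedRootSet b R) (hb : ∀ x, (∀ y, b x y = 0) → x = 0) {θ : V} {k a : ℂ}
    (hθ : b θ θ = 2) (hk : casimir b R θ θ = 4 * k) (hk0 : k ≠ 0)
    (ha : 4 * a * (Module.finrank ℂ V - 1) = k * (k - 2)) (x y z w : V) :
    wedgeTensor b R x y z w = 96 * a * wedge b x y z w := by
  obtain ⟨c, hc⟩ := hs.exists_wedgeTensor_eq h
  have hE := hs.casimir_eq h hθ hk
  have hcard := card_eq_of_casimir h hb hE
  have hsq : ∀ α ∈ R, ∑ β ∈ R, b α β ^ 2 = 4 * k := by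
    intro α hα
    have := hE α α
    rw [casimir, h.norm α hα] at this
    rw [Finset.sum_congr rfl fun β _ => by rw [h.symm α β, sq], this]
    ring
  -- The factor c is determined by the partial trace Σ_γ T(θ∧γ, θ∧γ). Here it is computed from the
  -- definition of the tensor, and in `hright` from its proportionality to the form.
  have hleft : ∑ γ ∈ R, wedgeTensor b R θ γ θ γ = 96 * k ^ 2 * (k - 2) := by
    have hγ : ∀ α ∈ R, ∀ β ∈ R,
        ∑ γ ∈ R, b α β ^ 2 * (wedge b α β θ γ * wedge b α β θ γ)
          = 4 * k * (b α θ * b α θ * b α β ^ 2) + 4 * k * (b β θ * b β θ * b β α ^ 2)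
            - 4 * k * (b α θ * (b α β ^ 3 * b β θ)) := by
      intro α hα β hβ
      have h1 : ∀ x y, ∑ γ ∈ R, b x γ * b y γ = 2 * k * b x y := by
        intro x y
        rw [← hE, casimir]
        exact Finset.sum_congr rfl fun γ _ => by rw [h.symm x, h.symm y]
      calc ∑ γ ∈ R, b α β ^ 2 * (wedge b α β θ γ * wedge b α β θ γ)
          = b α β ^ 2 * (b α θ ^ 2 * ∑ γ ∈ R, b β γ * b β γ
              - 2 * b α θ * b β θ * ∑ γ ∈ R, b α γ * b β γ
              + b β θ ^ 2 * ∑ γ ∈ R, b α γ * b α γ) := by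
            simp only [Finset.mul_sum, ← Finset.sum_sub_distrib, ← Finset.sum_add_distrib]
            exact Finset.sum_congr rfl fun γ _ => by rw [wedge]; ring
        _ = _ := by
            rw [h1, h1, h1, h.norm α hα, h.norm β hβ, h.symm β α]
            ring
    have e1 : ∑ α ∈ R, ∑ β ∈ R, b α θ * b α θ * b α β ^ 2 = 16 * k ^ 2 := by
      rw [Finset.sum_congr rfl fun α hα => by rw [← Finset.mul_sum, hsq α hα], ← Finset.sum_mul]
      rw [casimir] at hk
      rw [hk]
      ring
    have e2 : ∑ α ∈ R, ∑ β ∈ R, b β θ * b β θ * b β α ^ 2 = 16 * k ^ 2 := by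
      rw [Finset.sum_comm, e1]
    have e3 : ∑ α ∈ R, ∑ β ∈ R, b α θ * (b α β ^ 3 * b β θ) = (2 * k + 12) * (4 * k) := by
      rw [Finset.sum_congr rfl fun α hα => by rw [← Finset.mul_sum, sum_cube h hE hα], ← hk,
        casimir, Finset.mul_sum]
      exact Finset.sum_congr rfl fun _ _ => by ring
    calc ∑ γ ∈ R, wedgeTensor b R θ γ θ γ
        = ∑ α ∈ R, ∑ β ∈ R, ∑ γ ∈ R, b α β ^ 2 * (wedge b α β θ γ * wedge b α β θ γ) := by
          simp only [wedgeTensor]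
          rw [Finset.sum_comm]
          exact Finset.sum_congr rfl fun α _ => Finset.sum_comm
      _ = 4 * k * (∑ α ∈ R, ∑ β ∈ R, b α θ * b α θ * b α β ^ 2)
            + 4 * k * (∑ α ∈ R, ∑ β ∈ R, b β θ * b β θ * b β α ^ 2)
            - 4 * k * (∑ α ∈ R, ∑ β ∈ R, b α θ * (b α β ^ 3 * b β θ)) := by
          simp only [Finset.mul_sum, ← Finset.sum_sub_distrib, ← Finset.sum_add_distrib]
          exact Finset.sum_congr rfl fun α hα => Finset.sum_congr rfl fun β hβ => by
            rw [hγ α hα β hβ]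
      _ = 96 * k ^ 2 * (k - 2) := by
          rw [e1, e2, e3]
          ring
  have hright : ∑ γ ∈ R, wedgeTensor b R θ γ θ γ
      = c * (4 * k * (Module.finrank ℂ V - 1)) := by
    have h1 : ∀ γ ∈ R, wedgeTensor b R θ γ θ γ = c * 4 - c * (b γ θ * b γ θ) := by
      intro γ hγ
      rw [hc, wedge, hθ, h.norm γ hγ, h.symm θ γ]
      ring
    rw [Finset.sum_congr rfl h1, Finset.sum_sub_distrib, ← Finset.mul_sum, ← Finset.mul_sum,
      Finset.sum_const, nsmul_eq_mul, hcard]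
    rw [casimir] at hk
    rw [hk]
    ring
  -- In rank one there are no bivectors: both sides vanish and no condition on `a` is needed.
  by_cases hN : (Module.finrank ℂ V : ℂ) - 1 = 0
  · have hN' : Module.finrank ℂ V = 1 := by exact_mod_cast sub_eq_zero.1 hN
    obtain ⟨v, -, hv⟩ := finrank_eq_one_iff'.1 hN'
    obtain ⟨p, rfl⟩ := hv x
    obtain ⟨q, rfl⟩ := hv y
    rw [hc, wedge_smul_smul, mul_zero, mul_zero]
  · have h4 : c = 96 * a := by
      have h5 : (4 * k * (Module.finrank ℂ V - 1)) * c
          = (4 * k * (Module.finrank ℂ V - 1)) * (96 * a) := by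
        linear_combination hleft - hright - 96 * k * ha
      exact mul_left_cancel₀ (mul_ne_zero (mul_ne_zero (by norm_num) hk0) hN) h5
    rw [hc, h4]

end RootTensors

/-! ### The root lattice -/

section Lattice

variable {n : ℕ} {B : Matrix (Fin n) (Fin n) ℤ}

theorem form_add_left (x y z : Fin n → ℤ) : form B (x + y) z = form B x z + form B y z :=
  add_dotProduct _ _ _

theorem form_add_right (x y z : Fin n → ℤ) : form B x (y + z) = form B x y + form B x z := by
  rw [form, mulVec_add, dotProduct_add, form, form]

theorem form_neg_left (x z : Fin n → ℤ) : form B (-x) z = -form B x z :=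
  neg_dotProduct _ _

theorem form_neg_right (x z : Fin n → ℤ) : form B x (-z) = -form B x z := by
  rw [form, mulVec_neg, dotProduct_neg, form]

theorem form_sub_left (x y z : Fin n → ℤ) : form B (x - y) z = form B x z - form B y z :=
  sub_dotProduct _ _ _

theorem form_sub_right (x y z : Fin n → ℤ) : form B x (y - z) = form B x y - form B x z := by
  rw [form, mulVec_sub, dotProduct_sub, form, form]

theorem form_smul_left (c : ℤ) (x z : Fin n → ℤ) : form B (c • x) z = c * form B x z :=
  smul_dotProduct _ _ _

theorem form_smul_right (c : ℤ) (x z : Fin n → ℤ) : form B x (c • z) = c * form B x z := by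
  rw [form, mulVec_smul, dotProduct_smul, form, smul_eq_mul]

theorem form_sum_left {ι : Type*} (t : Finset ι) (f : ι → Fin n → ℤ) (z : Fin n → ℤ) :
    form B (∑ i ∈ t, f i) z = ∑ i ∈ t, form B (f i) z :=
  sum_dotProduct _ _ _

theorem form_sum_right {ι : Type*} (t : Finset ι) (f : ι → Fin n → ℤ) (z : Fin n → ℤ) :
    form B z (∑ i ∈ t, f i) = ∑ i ∈ t, form B z (f i) := by
  rw [form, mulVec_sum, dotProduct_sum]
  rfl

theorem neg_mem_roots {α : Fin n → ℤ} (hα : α ∈ roots B) : -α ∈ roots B := by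
  change form B (-α) (-α) = 2
  rw [form_neg_left, form_neg_right, neg_neg]
  exact hα

namespace IsEvenScalarProduct

variable (hB : IsEvenScalarProduct B)
include hB

theorem form_comm (x y : Fin n → ℤ) : form B x y = form B y x := by
  rw [form, form, dotProduct_mulVec, ← mulVec_transpose, hB.symm, dotProduct_comm]

/-- The norms of β - α and β + α are 4 ∓ 2(α,β), and they are positive unless β = ±α. -/
theorem form_root_cases {α β : Fin n → ℤ} (hα : α ∈ roots B) (hβ : β ∈ roots B) :
    β = α ∨ β = -α ∨ form B α β = 0 ∨ form B α β = 1 ∨ form B α β = -1 := by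
  have hα' : form B α α = 2 := hα
  have hβ' : form B β β = 2 := hβ
  have h1 : form B (β - α) (β - α) = 4 - 2 * form B α β := by
    rw [form_sub_left, form_sub_right, form_sub_right, hα', hβ', hB.form_comm β α]
    ring
  have h2 : form B (β + α) (β + α) = 4 + 2 * form B α β := by
    rw [form_add_left, form_add_right, form_add_right, hα', hβ', hB.form_comm β α]
    ring
  by_cases e1 : β = α
  · exact Or.inl e1
  by_cases e2 : β = -α
  · exact Or.inr (Or.inl e2)
  have h3 := hB.pos _ (sub_ne_zero.2 e1)
  have h4 := hB.pos (β + α) fun h => e2 (eq_neg_of_add_eq_zero_left h)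
  omega

theorem reflect_mem_roots {α β : Fin n → ℤ} (hα : α ∈ roots B) (hβ : β ∈ roots B) :
    β - form B α β • α ∈ roots B := by
  have hα' : form B α α = 2 := hα
  have hβ' : form B β β = 2 := hβ
  change form B _ _ = 2
  rw [form_sub_left, form_sub_right, form_sub_right, form_smul_left, form_smul_left,
    form_smul_right, form_smul_right, hα', hβ', hB.form_comm β α]
  ring

theorem det_ne_zero : B.det ≠ 0 := by
  intro h
  obtain ⟨v, hv, h0⟩ := exists_mulVec_eq_zero_iff.2 h
  have := hB.pos v hv
  rw [form, h0, dotProduct_zero] at this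
  exact lt_irrefl _ this

theorem isUnit_det_map : IsUnit (B.map (fun z : ℤ => (z : ℂ))).det := by
  have h : (B.map (fun z : ℤ => (z : ℂ))).det = ((B.det : ℤ) : ℂ) :=
    ((Int.castRingHom ℂ).map_det B).symm
  rw [h, isUnit_iff_ne_zero]
  exact_mod_cast hB.det_ne_zero

end IsEvenScalarProduct

theorem coroot_eq (α : Fin n → ℤ) :
    coroot B α = B.map (fun z : ℤ => (z : ℂ)) *ᵥ fun i => (α i : ℂ) := by
  funext i
  simp [coroot, mulVec, dotProduct]

theorem pairing_eq (α : Fin n → ℤ) (x : Fin n → ℂ) :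
    pairing α x = (fun i => (α i : ℂ)) ⬝ᵥ x := rfl

theorem pairing_neg (α : Fin n → ℤ) (x : Fin n → ℂ) : pairing (-α) x = -pairing α x := by
  simp [pairing]

theorem pairing_add_left (α β : Fin n → ℤ) (x : Fin n → ℂ) :
    pairing (α + β) x = pairing α x + pairing β x := by
  simp [pairing, add_mul, Finset.sum_add_distrib]

theorem coroot_neg (α : Fin n → ℤ) : coroot B (-α) = -coroot B α := by
  funext i
  simp [coroot, mulVec_neg]

theorem pairing_coroot (α β : Fin n → ℤ) : pairing α (coroot B β) = (form B α β : ℂ) := by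
  simp [pairing, coroot, form, dotProduct]

theorem coroot_sub_smul (c : ℤ) (α β : Fin n → ℤ) :
    coroot B (β - c • α) = coroot B β - (c : ℂ) • coroot B α := by
  funext i
  rw [coroot, mulVec_sub, mulVec_smul]
  simp [coroot]

/-- The bilinear form on `𝔥`. -/
noncomputable def dualBilin (B : Matrix (Fin n) (Fin n) ℤ) : LinearMap.BilinForm ℂ (Fin n → ℂ) :=
  Matrix.toBilin' (B.map (fun z : ℤ => (z : ℂ)))⁻¹

theorem dualBilin_apply (x y : Fin n → ℂ) : dualBilin B x y = dualForm B x y :=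
  Matrix.toBilin'_apply' _ _ _

namespace IsEvenScalarProduct

variable (hB : IsEvenScalarProduct B)
include hB

theorem map_transpose :
    (B.map (fun z : ℤ => (z : ℂ)))ᵀ = B.map (fun z : ℤ => (z : ℂ)) := by
  rw [← transpose_map, hB.symm]

theorem dualForm_comm (x y : Fin n → ℂ) : dualForm B x y = dualForm B y x := by
  rw [dualForm, dualForm, dotProduct_mulVec, ← mulVec_transpose, transpose_nonsing_inv,
    hB.map_transpose, dotProduct_comm]

theorem dualForm_mulVec (x y : Fin n → ℂ) :
    dualForm B (B.map (fun z : ℤ => (z : ℂ)) *ᵥ x) y = x ⬝ᵥ y := by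
  rw [dualForm, ← vecMul_transpose, hB.map_transpose, ← dotProduct_mulVec, mulVec_mulVec,
    mul_nonsing_inv _ hB.isUnit_det_map, one_mulVec]

theorem dualForm_coroot (α : Fin n → ℤ) (x : Fin n → ℂ) :
    dualForm B (coroot B α) x = pairing α x := by
  rw [coroot_eq, hB.dualForm_mulVec, pairing_eq]

theorem dualBilin_nondegenerate {x : Fin n → ℂ} (h : ∀ y, dualBilin B x y = 0) : x = 0 := by
  funext i
  have h1 := h (coroot B (Pi.single i 1))
  rw [dualBilin_apply, hB.dualForm_comm, hB.dualForm_coroot, pairing,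
    Finset.sum_eq_single i (by intro j _ hj; simp [hj]) (by simp)] at h1
  simpa using h1

theorem coroot_injective : Function.Injective (coroot B) := by
  intro α β h
  funext i
  have h1 := hB.dualForm_coroot α (Pi.single i 1)
  rw [h, hB.dualForm_coroot] at h1
  simpa [pairing, Pi.single_apply] using h1.symm

end IsEvenScalarProduct

/-- The finite set of all roots, from a system of positive roots. -/
def allRoots (Rp : Finset (Fin n → ℤ)) : Finset (Fin n → ℤ) :=
  Rp ∪ Rp.image fun α => -α

namespace IsPositiveSystem

variable {Rp : Finset (Fin n → ℤ)} (hRp : IsPositiveSystem B Rp)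
include hRp

theorem mem_allRoots {α : Fin n → ℤ} : α ∈ allRoots Rp ↔ α ∈ roots B := by
  rw [allRoots, Finset.mem_union, Finset.mem_image]
  constructor
  · rintro (h | ⟨β, hβ, rfl⟩)
    · exact hRp.subset α h
    · exact neg_mem_roots (hRp.subset β hβ)
  · intro h
    rcases hRp.mem_or_neg_mem α h with h' | h'
    · exact Or.inl h'
    · exact Or.inr ⟨-α, h', neg_neg α⟩

theorem sum_allRoots (f : (Fin n → ℤ) → ℂ) :
    ∑ α ∈ allRoots Rp, f α = ∑ α ∈ Rp, (f α + f (-α)) := by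
  rw [allRoots, Finset.sum_union, Finset.sum_image fun _ _ _ _ h => neg_injective h,
    Finset.sum_add_distrib]
  rw [Finset.disjoint_left]
  intro α hα h
  obtain ⟨β, hβ, rfl⟩ := Finset.mem_image.1 h
  exact hRp.not_both β hβ hα

theorem sum_allRoots_neg (f : (Fin n → ℤ) → ℂ) :
    ∑ α ∈ allRoots Rp, f (-α) = ∑ α ∈ allRoots Rp, f α := by
  rw [hRp.sum_allRoots, hRp.sum_allRoots]
  exact Finset.sum_congr rfl fun α _ => by rw [neg_neg, add_comm]

theorem isSimplyLacedRootSet (hB : IsEvenScalarProduct B) :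
    IsSimplyLacedRootSet (dualBilin B) ((allRoots Rp).image (coroot B)) where
  symm x y := by rw [dualBilin_apply, dualBilin_apply, hB.dualForm_comm]
  norm x hx := by
    obtain ⟨α, hα, rfl⟩ := Finset.mem_image.1 hx
    have hα' : form B α α = 2 := hRp.mem_allRoots.1 hα
    rw [dualBilin_apply, hB.dualForm_coroot, pairing_coroot, hα']
    norm_num
  reflect x hx y hy := by
    obtain ⟨α, hα, rfl⟩ := Finset.mem_image.1 hx
    obtain ⟨β, hβ, rfl⟩ := Finset.mem_image.1 hy
    rw [dualBilin_apply, hB.dualForm_coroot, pairing_coroot, ← coroot_sub_smul]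
    exact Finset.mem_image_of_mem _ (hRp.mem_allRoots.2
      (hB.reflect_mem_roots (hRp.mem_allRoots.1 hα) (hRp.mem_allRoots.1 hβ)))
  scalar x hx y hy := by
    obtain ⟨α, hα, rfl⟩ := Finset.mem_image.1 hx
    obtain ⟨β, hβ, rfl⟩ := Finset.mem_image.1 hy
    rw [dualBilin_apply, hB.dualForm_coroot, pairing_coroot]
    rcases hB.form_root_cases (hRp.mem_allRoots.1 hα) (hRp.mem_allRoots.1 hβ) with
      rfl | rfl | h | h | h
    · exact Or.inl rfl
    · exact Or.inr (Or.inl (coroot_neg α))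
    all_goals rw [h]; simp

end IsPositiveSystem

/-! ### Heights -/

section Heights

variable {ι : Type*} [Fintype ι] {C : Matrix ι ι ℤ} {m : ι → ℤ} {s : ι → Fin n → ℤ}

theorem form_sum_simple (hs : ∀ i j, form B (s i) (s j) = C i j) (c d : ι → ℤ) :
    form B (∑ i, c i • s i) (∑ j, d j • s j) = c ⬝ᵥ C *ᵥ d := by
  rw [form_sum_left, dotProduct]
  refine Finset.sum_congr rfl fun i _ => ?_
  rw [form_smul_left, form_sum_right, mulVec, dotProduct]
  congr 1
  exact Finset.sum_congr rfl fun j _ => by rw [form_smul_right, hs, mul_comm]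

theorem form_simple_sum (hs : ∀ i j, form B (s i) (s j) = C i j) (i : ι) (d : ι → ℤ) :
    form B (s i) (∑ j, d j • s j) = (C *ᵥ d) i := by
  rw [form_sum_right, mulVec, dotProduct]
  exact Finset.sum_congr rfl fun j _ => by rw [form_smul_right, hs, mul_comm]

theorem IsDominantRoot.eq_zero_of_sum (h : IsDominantRoot C m)
    (hs : ∀ i j, form B (s i) (s j) = C i j) {c : ι → ℤ} (hc : ∑ i, c i • s i = 0) : c = 0 := by
  refine h.eq_zero_of_mulVec_eq_zero (funext fun i => ?_)
  rw [← form_simple_sum hs, hc, form, mulVec_zero, dotProduct_zero, Pi.zero_apply]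

variable (hB : IsEvenScalarProduct B) (h : IsDominantRoot C m)
  (hs : ∀ i j, form B (s i) (s j) = C i j)
  (hroots : ∀ β ∈ roots B, ∃ c : ι → ℕ, β = ∑ i, c i • s i ∨ β = -∑ i, c i • s i)
  {P : Finset (Fin n → ℤ)} (hP : ∀ β, β ∈ P ↔ β ∈ roots B ∧ ∃ c : ι → ℕ, β = ∑ i, c i • s i)

include hB h hs hroots hP in
-- A positive root other than s_i has a positive coefficient at some j ≠ i, since a multiple of s_i
-- of norm 2 with nonnegative coefficient is s_i itself. The reflection in s_i leaves that
-- coefficient unchanged, so the image can be neither negative nor equal to s_i.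
theorem reflect_mem_positive {i : ι} {β : Fin n → ℤ} (hβ : β ∈ P) (hβi : β ≠ s i) :
    β - form B (s i) β • s i ∈ P.erase (s i) := by
  classical
  obtain ⟨hβr, c, hc⟩ := (hP β).1 hβ
  have hi : s i ∈ roots B := (hs i i).trans (h.diag i)
  have hcz : β = ∑ j, (c j : ℤ) • s j := by simpa using hc
  obtain ⟨j, hji, hj⟩ : ∃ j, j ≠ i ∧ 0 < c j := by
    by_contra! h0
    have h1 : β = (c i : ℤ) • s i := by
      rw [hcz, Finset.sum_eq_single i (fun j _ hj => by
        rw [Nat.le_zero.1 (h0 j hj)]; simp) (by simp)]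
    have h2 : form B β β = 2 := hβr
    rw [h1, form_smul_left, form_smul_right, hs, h.diag] at h2
    have h3 : (c i : ℤ) = 1 := by nlinarith [Int.natCast_nonneg (c i)]
    rw [h3, one_smul] at h1
    exact hβi h1
  have hr := hB.reflect_mem_roots hi hβr
  rw [Finset.mem_erase, hP]
  refine ⟨fun h1 => ?_, hr, ?_⟩
  · have h2 : ∑ l, ((c l : ℤ) - if l = i then form B (s i) β + 1 else 0) • s l = 0 := by
      simp only [sub_smul, Finset.sum_sub_distrib, ite_smul, zero_smul, Finset.sum_ite_eq',
        Finset.mem_univ, if_true]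
      rw [← hcz, add_smul, one_smul, ← sub_sub, h1, sub_self]
    have h3 := congrFun (h.eq_zero_of_sum hs h2) j
    simp only [if_neg hji, Pi.zero_apply] at h3
    omega
  · obtain ⟨d, hd | hd⟩ := hroots _ hr
    · exact ⟨d, hd⟩
    · have hdz : β - form B (s i) β • s i = -∑ l, (d l : ℤ) • s l := by simpa using hd
      have h2 : ∑ l, ((c l : ℤ) + d l - if l = i then form B (s i) β else 0) • s l = 0 := by
        simp only [add_smul, sub_smul, Finset.sum_sub_distrib, Finset.sum_add_distrib, ite_smul,
          zero_smul, Finset.sum_ite_eq', Finset.mem_univ, if_true]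
        rw [← hcz, add_sub_right_comm, hdz, neg_add_cancel]
      have h3 := congrFun (h.eq_zero_of_sum hs h2) j
      simp only [if_neg hji, Pi.zero_apply] at h3
      omega

include hB h hs hroots hP in
/-- A simple root has scalar product `2` with the sum of the positive roots. -/
theorem sum_form_simple (i : ι) : ∑ β ∈ P, form B (s i) β = 2 := by
  classical
  have hi : s i ∈ roots B := (hs i i).trans (h.diag i)
  have hiP : s i ∈ P := (hP _).2 ⟨hi, Pi.single i 1, by
    rw [Finset.sum_eq_single i (by intro j _ hj; simp [hj]) (by simp)]; simp⟩
  have hinv : ∀ β, form B (s i) (β - form B (s i) β • s i) = -form B (s i) β := by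
    intro β
    rw [form_sub_right, form_smul_right, hs, h.diag]
    ring
  -- The reflection in s_i permutes the positive roots other than s_i and negates (s_i, β), so their
  -- contributions cancel.
  rw [← Finset.add_sum_erase P _ hiP, hs, h.diag, Finset.sum_involution
    (fun β _ => β - form B (s i) β • s i), add_zero]
  · intro β _
    rw [hinv, add_neg_cancel]
  · intro β _ h0 h1
    rw [sub_eq_self, smul_eq_zero] at h1
    rcases h1 with h1 | h1
    · exact h0 h1
    · have := hs i i
      rw [h1, h.diag, form, zero_dotProduct] at this
      omega
  · intro β hβ
    exact reflect_mem_positive hB h hs hroots hP (Finset.mem_of_mem_erase hβ)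
      (Finset.ne_of_mem_erase hβ)
  · intro β _
    rw [hinv]
    module

include hB h hs hroots hP in
/-- The norm of the highest root with respect to the Casimir tensor. -/
theorem sum_form_dominant_sq :
    ∑ β ∈ P, form B β (∑ i, m i • s i) ^ 2 = 2 * (∑ i, m i + 1) := by
  classical
  set θ := ∑ i, m i • s i with hθ
  have hθr : θ ∈ roots B := (form_sum_simple hs m m).trans h.norm
  have hθP : θ ∈ P := (hP _).2 ⟨hθr, fun i => (m i).toNat, by
    rw [hθ]
    refine Finset.sum_congr rfl fun i _ => ?_
    rw [← natCast_zsmul, Int.toNat_of_nonneg (h.pos i).le]⟩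
  -- Dominance makes (β,θ) nonnegative, hence 0 or 1 for β ≠ θ, and squaring changes nothing. At β =
  -- θ the square 4 exceeds 2 by 2.
  have hterm : ∀ β ∈ P, form B β θ ^ 2 = form B β θ + if β = θ then 2 else 0 := by
    intro β hβ
    obtain ⟨hβr, c, hc⟩ := (hP β).1 hβ
    have hpos : 0 ≤ form B β θ := by
      rw [hc, form_sum_left]
      refine Finset.sum_nonneg fun i _ => ?_
      rw [← natCast_zsmul, form_smul_left, hθ, form_simple_sum hs]
      exact mul_nonneg (Int.natCast_nonneg _) (h.dominant i)
    have hθ2 : form B θ θ = 2 := hθr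
    rcases hB.form_root_cases hθr hβr with h1 | h1 | h1
    · rw [if_pos h1, h1, hθ2]
      norm_num
    · rw [h1, form_neg_left, hθ2] at hpos
      omega
    · have h2 : β ≠ θ := by
        rintro rfl
        omega
      rw [if_neg h2]
      rw [hB.form_comm] at hpos ⊢
      rcases h1 with h1 | h1 | h1 <;> rw [h1] at hpos ⊢ <;> omega
  -- The sum of the positive roots pairs to 2 with every simple root, hence to 2 Σ m_i with θ.
  have hsum : ∑ β ∈ P, form B β θ = 2 * ∑ i, m i := by
    have h1 : ∀ β, form B β θ = ∑ i, m i * form B (s i) β := by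
      intro β
      rw [hθ, form_sum_right]
      exact Finset.sum_congr rfl fun i _ => by rw [form_smul_right, hB.form_comm]
    simp only [h1]
    rw [Finset.sum_comm, Finset.mul_sum]
    refine Finset.sum_congr rfl fun i _ => ?_
    rw [← Finset.mul_sum, sum_form_simple hB h hs hroots hP, mul_comm]
  rw [Finset.sum_congr rfl hterm, Finset.sum_add_distrib, hsum, Finset.sum_ite_eq', if_pos hθP]
  ring

end Heights

end Lattice

-- The trigonometric root identity behind flatness.

section RootIdentity

variable {n : ℕ} {B : Matrix (Fin n) (Fin n) ℤ} {Rp : Finset (Fin n → ℤ)} {X : ADEType}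

theorem linearIndependent_coroot {ι : Type*} [Fintype ι] {C : Matrix ι ι ℤ} {m : ι → ℤ}
    {s : ι → Fin n → ℤ} (h : IsDominantRoot C m) (hs : ∀ i j, form B (s i) (s j) = C i j) :
    LinearIndependent ℂ fun i => coroot B (s i) := by
  classical
  have hdet : C.det ≠ 0 := by
    intro h0
    obtain ⟨v, hv, hv0⟩ := exists_mulVec_eq_zero_iff.2 h0
    exact hv (h.eq_zero_of_mulVec_eq_zero hv0)
  have hdet' : (C.map (fun z : ℤ => (z : ℂ))).det ≠ 0 := by
    have e : (C.map (fun z : ℤ => (z : ℂ))).det = ((C.det : ℤ) : ℂ) :=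
      ((Int.castRingHom ℂ).map_det C).symm
    rw [e]
    exact_mod_cast hdet
  rw [Fintype.linearIndependent_iff]
  intro c hc
  refine congrFun (eq_zero_of_mulVec_eq_zero hdet' (funext fun j => ?_))
  have h1 : pairing (s j) (∑ i, c i • coroot B (s i)) = 0 := by rw [hc]; simp [pairing]
  rw [pairing_eq, dotProduct_sum] at h1
  rw [mulVec, dotProduct, Pi.zero_apply, ← h1]
  refine Finset.sum_congr rfl fun i _ => ?_
  rw [dotProduct_smul, ← pairing_eq, pairing_coroot, hs, smul_eq_mul, mul_comm, map_apply]

/-- The given positive system need not be the one of the base `s`. The sum is even in β, so it may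
be computed with the positive roots of `s`, which generate the same set of all roots. -/
theorem sum_form_highest_sq (hB : IsEvenScalarProduct B) (hRp : IsPositiveSystem B Rp)
    {ι : Type*} [Fintype ι] {C : Matrix ι ι ℤ} {m : ι → ℤ} {s : ι → Fin n → ℤ}
    (h : IsDominantRoot C m) (hs : ∀ i j, form B (s i) (s j) = C i j)
    (hroots : ∀ β ∈ roots B, ∃ c : ι → ℕ, β = ∑ i, c i • s i ∨ β = -∑ i, c i • s i) :
    ∑ β ∈ allRoots Rp, (form B β (∑ i, m i • s i) : ℂ) ^ 2 = 4 * (∑ i, m i + 1 : ℤ) := by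
  classical
  set P := (allRoots Rp).filter fun β => ∃ c : ι → ℕ, β = ∑ i, c i • s i with hPdef
  have hP : ∀ β, β ∈ P ↔ β ∈ roots B ∧ ∃ c : ι → ℕ, β = ∑ i, c i • s i := by
    intro β
    rw [hPdef, Finset.mem_filter, hRp.mem_allRoots]
  have hPos : IsPositiveSystem B P := by
    refine ⟨fun β hβ => ((hP β).1 hβ).1, fun β hβ => ?_, fun β hβ hβ' => ?_, ?_⟩
    · obtain ⟨c, hc | hc⟩ := hroots β hβ
      · exact Or.inl ((hP β).2 ⟨hβ, c, hc⟩)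
      · exact Or.inr ((hP _).2 ⟨neg_mem_roots hβ, c, by rw [hc, neg_neg]⟩)
    · obtain ⟨hβr, c, hc⟩ := (hP β).1 hβ
      obtain ⟨-, d, hd⟩ := (hP _).1 hβ'
      have h1 : ∑ i, ((c i : ℤ) + d i) • s i = 0 := by
        simp only [add_smul, Finset.sum_add_distrib, natCast_zsmul]
        rw [← hc, ← hd, add_neg_cancel]
      have h2 := h.eq_zero_of_sum hs h1
      have h3 : β = 0 := by
        rw [hc]
        refine Finset.sum_eq_zero fun i _ => ?_
        have := congrFun h2 i
        simp only [Pi.zero_apply] at this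
        rw [show c i = 0 by omega, zero_smul]
      have h4 : form B β β = 2 := hβr
      rw [h3, form, zero_dotProduct] at h4
      omega
    · intro α hα β hβ hαβ
      obtain ⟨-, c, hc⟩ := (hP α).1 hα
      obtain ⟨-, d, hd⟩ := (hP β).1 hβ
      exact (hP _).2 ⟨hαβ, c + d, by
        simp only [Pi.add_apply, add_smul, Finset.sum_add_distrib, ← hc, ← hd]⟩
  have hR : allRoots Rp = allRoots P := by
    ext β
    rw [hRp.mem_allRoots, hPos.mem_allRoots]
  have h1 := congrArg (Int.cast : ℤ → ℂ) (sum_form_dominant_sq hB h hs hroots hP)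
  push_cast at h1
  rw [hR, hPos.sum_allRoots]
  simp only [form_neg_left, Int.cast_neg, neg_sq, ← two_mul]
  rw [← Finset.mul_sum, h1]
  push_cast
  ring

/-- The contraction of `α ∧ β` with `ξ ∧ ζ`. -/
noncomputable def wedgePairing (α β : Fin n → ℤ) (ξ ζ : Fin n → ℂ) : ℂ :=
  pairing α ξ * pairing β ζ - pairing α ζ * pairing β ξ

/-- The sum of `(α, β) ^ 2 (α ∧ β) ⊗ (α ∧ β)` over all pairs of roots. -/
theorem sum_wedgePairing (hB : IsEvenScalarProduct B) (hX : IsOfType B X)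
    (hRp : IsPositiveSystem B Rp) (ξ ζ η μ : Fin n → ℂ) :
    ∑ α ∈ allRoots Rp, ∑ β ∈ allRoots Rp,
        (form B α β : ℂ) ^ 2 * (wedgePairing α β ξ ζ * wedgePairing α β η μ)
      = 96 * X.a * (dualForm B ξ η * dualForm B ζ μ - dualForm B ξ μ * dualForm B ζ η) := by
  obtain ⟨m, e, hm, he, he0, ha⟩ := X.exists_isDominantRoot
  obtain ⟨s, hs, hroots⟩ := hX.exists_simple
  have hrank := hX.rank_eq
  have hset := hRp.isSimplyLacedRootSet hB
  have hbase : IsConnectedBase (dualBilin B) ((allRoots Rp).image (coroot B))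
      fun i => coroot B (s i) := by
    have hval : ∀ i j, dualBilin B (coroot B (s i)) (coroot B (s j))
        = (X.cartanMatrix i j : ℂ) := by
      intro i j
      rw [dualBilin_apply, hB.dualForm_coroot, pairing_coroot, hs]
    refine ⟨fun i => Finset.mem_image_of_mem _ (hRp.mem_allRoots.2 ((hs i i).trans (hm.diag i))),
      ?_, fun i j hij => ?_, fun i j =>
        Relation.ReflTransGen.mono (fun i j hij => ?_) _ _ (hm.connected i j)⟩
    · refine (linearIndependent_coroot hm hs).span_eq_top_of_card_eq_finrank' ?_
      simp [hrank]
    · rw [hval]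
      rcases hm.simplyLaced i j hij with h | h <;> rw [h] <;> simp
    · rw [hval, hij]
      simp
  have hθ := (form_sum_simple hs m m).trans hm.norm
  have hsum : ∀ f : (Fin n → ℂ) → ℂ, ∑ x ∈ (allRoots Rp).image (coroot B), f x
      = ∑ α ∈ allRoots Rp, f (coroot B α) := fun f =>
    Finset.sum_image fun _ _ _ _ h => hB.coroot_injective h
  -- The parameter `k` of the tensor lemma is the Coxeter number e + 1, and its θ is the dominant
  -- root with coefficients `m`.
  have key := hbase.wedgeTensor_eq hset (fun x => hB.dualBilin_nondegenerate)
    (θ := coroot B (∑ i, m i • s i)) (k := (e + 1 : ℤ)) (a := X.a) ?_ ?_ ?_ ?_ ξ ζ η μ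
  · simp only [wedgeTensor, wedge, hsum, dualBilin_apply, hB.dualForm_coroot, pairing_coroot]
      at key
    rw [← key]
    rfl
  · rw [dualBilin_apply, hB.dualForm_coroot, pairing_coroot, hθ]
    norm_num
  · rw [← he, ← sum_form_highest_sq hB hRp hm hs hroots, casimir, hsum]
    refine Finset.sum_congr rfl fun β _ => ?_
    rw [dualBilin_apply, hB.dualForm_coroot, pairing_coroot, sq]
  · exact_mod_cast (by omega : e + 1 ≠ 0)
  · have hr : (Module.finrank ℂ (Fin n → ℂ) : ℂ) = X.rank := by simp [hrank]
    rw [hr, ha]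
    push_cast
    ring

/-- The identity behind the integrability of the system: only the addition law of the hyperbolic
cotangent is used about the coefficients `c`. -/
theorem sum_cot_mul_cot (hB : IsEvenScalarProduct B) (hX : IsOfType B X)
    (hRp : IsPositiveSystem B Rp) {c : (Fin n → ℤ) → ℂ} (hneg : ∀ α ∈ roots B, c (-α) = -c α)
    (hadd : ∀ α ∈ roots B, ∀ β ∈ roots B, -α - β ∈ roots B →
      c α * c β + c β * c (-α - β) + c (-α - β) * c α = -1) (ξ ζ η μ : Fin n → ℂ) :
    ∑ α ∈ Rp, ∑ β ∈ Rp,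
        (form B α β : ℂ) * (c α * c β) * wedgePairing α β ξ ζ * (pairing α η * pairing β μ)
      = 4 * X.a * (dualForm B ξ η * dualForm B ζ μ - dualForm B ξ μ * dualForm B ζ η) := by
  set W : (Fin n → ℤ) → (Fin n → ℤ) → ℂ := fun α β =>
    wedgePairing α β ξ ζ * wedgePairing α β η μ with hW
  have hWr : ∀ α β, W α (-β) = W α β := by
    intro α β
    simp only [hW, wedgePairing, pairing_neg]
    ring
  have hWl : ∀ α β, W (-α) β = W α β := by
    intro α β
    simp only [hW, wedgePairing, pairing_neg]
    ring
  have hWself : ∀ α, W α α = 0 := by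
    intro α
    simp only [hW, wedgePairing]
    ring
  have hWrot : ∀ α β, W β (-α - β) = W α β := by
    intro α β
    simp only [hW, wedgePairing, sub_eq_add_neg, pairing_add_left, pairing_neg]
    ring
  let g : (Fin n → ℤ) → (Fin n → ℤ) → ℂ := fun α β => (form B α β : ℂ) * (c α * c β) * W α β
  have hgr : ∀ α, ∀ β ∈ roots B, g α (-β) = g α β := by
    intro α β hβ
    simp only [g, hWr, form_neg_right, hneg β hβ]
    push_cast
    ring
  have hgl : ∀ α ∈ roots B, ∀ β, g (-α) β = g α β := by
    intro α hα β
    simp only [g, hWl, form_neg_left, hneg α hα]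
    push_cast
    ring
  -- All other factors together are antisymmetric under α ↔ β, so adding the sum with α and β
  -- exchanged turns α(η)β(μ) into (α∧β)(η,μ).
  have hanti : 2 * ∑ α ∈ Rp, ∑ β ∈ Rp,
      (form B α β : ℂ) * (c α * c β) * wedgePairing α β ξ ζ * (pairing α η * pairing β μ)
      = ∑ α ∈ Rp, ∑ β ∈ Rp, g α β := by
    rw [two_mul]
    nth_rewrite 2 [Finset.sum_comm]
    simp only [← Finset.sum_add_distrib]
    refine Finset.sum_congr rfl fun α _ => Finset.sum_congr rfl fun β _ => ?_
    simp only [g, hW, wedgePairing, hB.form_comm β α]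
    ring
  -- The summand is even in α and in β, so each pair of positive roots is counted four times.
  have hall : ∑ α ∈ allRoots Rp, ∑ β ∈ allRoots Rp, g α β
      = 4 * ∑ α ∈ Rp, ∑ β ∈ Rp, g α β := by
    rw [hRp.sum_allRoots, Finset.mul_sum]
    refine Finset.sum_congr rfl fun α hα => ?_
    rw [hRp.sum_allRoots, hRp.sum_allRoots, Finset.mul_sum, ← Finset.sum_add_distrib]
    refine Finset.sum_congr rfl fun β hβ => ?_
    rw [hgr _ β (hRp.subset β hβ), hgr _ β (hRp.subset β hβ), hgl α (hRp.subset α hα)]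
    ring
  -- Indicator of (α,β) = -1. Only pairs with (α,β) = ±1 contribute, and β ↦ -β exchanges the two
  -- signs; this is the factor 2 in `hsplit`.
  let d : (Fin n → ℤ) → (Fin n → ℤ) → ℂ := fun α β => if form B α β = -1 then 1 else 0
  have hsplit : ∀ f : (Fin n → ℤ) → (Fin n → ℤ) → ℂ, (∀ α, ∀ β ∈ roots B, f α (-β) = f α β) →
      (∀ α ∈ roots B, ∀ β ∈ roots B, form B α β = 0 ∨ β = α ∨ β = -α → f α β = 0) →
      ∑ α ∈ allRoots Rp, ∑ β ∈ allRoots Rp, f α β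
        = 2 * ∑ α ∈ allRoots Rp, ∑ β ∈ allRoots Rp, d α β * f α β := by
    intro f hf hf0
    rw [Finset.mul_sum]
    refine Finset.sum_congr rfl fun α hα => ?_
    rw [two_mul]
    nth_rewrite 2 [← hRp.sum_allRoots_neg]
    rw [← Finset.sum_add_distrib]
    refine Finset.sum_congr rfl fun β hβ => ?_
    have hα' := hRp.mem_allRoots.1 hα
    have hβ' := hRp.mem_allRoots.1 hβ
    rw [hf α β hβ']
    simp only [d, form_neg_right]
    rcases hB.form_root_cases hα' hβ' with h | h | h | h | h
    · rw [hf0 α hα' β hβ' (Or.inr (Or.inl h))]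
      ring
    · rw [hf0 α hα' β hβ' (Or.inr (Or.inr h))]
      ring
    · rw [hf0 α hα' β hβ' (Or.inl h)]
      ring
    all_goals rw [h]; norm_num
  have hW0 : ∀ α β, β = α ∨ β = -α → W α β = 0 := by
    rintro α β (rfl | rfl)
    · exact hWself _
    · rw [hWr, hWself]
  have hg : ∑ α ∈ allRoots Rp, ∑ β ∈ allRoots Rp, g α β
      = 2 * ∑ α ∈ allRoots Rp, ∑ β ∈ allRoots Rp, d α β * g α β := by
    refine hsplit g hgr ?_
    rintro α - β - (h | h)
    · simp only [g, h]
      push_cast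
      ring
    · simp only [g, hW0 α β h, mul_zero]
  have hT : ∑ α ∈ allRoots Rp, ∑ β ∈ allRoots Rp, (form B α β : ℂ) ^ 2 * W α β
      = 2 * ∑ α ∈ allRoots Rp, ∑ β ∈ allRoots Rp, d α β * ((form B α β : ℂ) ^ 2 * W α β) := by
    refine hsplit (fun α β => (form B α β : ℂ) ^ 2 * W α β) ?_ ?_
    · intro α β _
      simp only [hWr, form_neg_right]
      push_cast
      ring
    · rintro α - β - (h | h)
      · simp only [h]
        push_cast
        ring
      · simp only [hW0 α β h, mul_zero]
  have hthird : ∀ α β, α ∈ roots B → β ∈ roots B → form B α β = -1 → -α - β ∈ roots B := by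
    intro α β hα hβ h
    have := neg_mem_roots (hB.reflect_mem_roots hα hβ)
    rwa [h, show -(β - (-1 : ℤ) • α) = -α - β by module] at this
  -- Pairs in S are those that complete to a triple of roots α, β, -α-β with sum zero. The rotation
  -- (α,β) ↦ (β,-α-β) permutes S and preserves the bivector α∧β.
  let S := (allRoots Rp ×ˢ allRoots Rp).filter fun p => form B p.1 p.2 = -1
  have hS : ∀ p, p ∈ S ↔ p.1 ∈ roots B ∧ p.2 ∈ roots B ∧ form B p.1 p.2 = -1 := by
    intro p
    rw [Finset.mem_filter, Finset.mem_product, hRp.mem_allRoots, hRp.mem_allRoots, and_assoc]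
  have hd : ∀ f : (Fin n → ℤ) → (Fin n → ℤ) → ℂ,
      ∑ α ∈ allRoots Rp, ∑ β ∈ allRoots Rp, d α β * f α β = ∑ p ∈ S, f p.1 p.2 := by
    intro f
    rw [Finset.sum_filter, Finset.sum_product]
    simp only [d, ite_mul, one_mul, zero_mul]
  have hrot : ∀ f : (Fin n → ℤ) → (Fin n → ℤ) → ℂ,
      ∑ p ∈ S, f p.2 (-p.1 - p.2) = ∑ p ∈ S, f p.1 p.2 := by
    intro f
    refine Finset.sum_nbij' (fun p => (p.2, -p.1 - p.2)) (fun p => (-p.1 - p.2, p.1)) ?_ ?_ ?_ ?_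
      fun _ _ => rfl
    · intro p hp
      obtain ⟨h1, h2, h3⟩ := (hS p).1 hp
      have h4 : form B p.2 p.2 = 2 := h2
      refine (hS _).2 ⟨h2, hthird _ _ h1 h2 h3, ?_⟩
      rw [form_sub_right, form_neg_right, h4, hB.form_comm, h3]
      norm_num
    · intro p hp
      obtain ⟨h1, h2, h3⟩ := (hS p).1 hp
      have h4 : form B p.1 p.1 = 2 := h1
      refine (hS _).2 ⟨hthird _ _ h1 h2 h3, h1, ?_⟩
      rw [form_sub_left, form_neg_left, h4, hB.form_comm, h3]
      norm_num
    · intro p _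
      ext1
      · simp only
        abel
      · rfl
    · intro p _
      ext1
      · rfl
      · simp only
        abel
  have h1 : ∑ p ∈ S, g p.1 p.2 = -∑ p ∈ S, c p.1 * c p.2 * W p.1 p.2 := by
    rw [← Finset.sum_neg_distrib]
    refine Finset.sum_congr rfl fun p hp => ?_
    simp only [g, ((hS p).1 hp).2.2]
    push_cast
    ring
  have h2 : ∑ p ∈ S, (form B p.1 p.2 : ℂ) ^ 2 * W p.1 p.2 = ∑ p ∈ S, W p.1 p.2 := by
    refine Finset.sum_congr rfl fun p hp => ?_
    rw [((hS p).1 hp).2.2]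
    push_cast
    ring
  -- Averaging over the three rotations turns c_α c_β into one third of the left side of the
  -- addition law.
  have h3 : 3 * ∑ p ∈ S, c p.1 * c p.2 * W p.1 p.2 = -∑ p ∈ S, W p.1 p.2 := by
    have e1 := hrot fun α β => c α * c β * W α β
    have e2 := hrot fun α β => c β * c (-α - β) * W α β
    have e3 : ∑ p ∈ S, (c p.1 * c p.2 * W p.1 p.2 + c p.2 * c (-p.1 - p.2) * W p.2 (-p.1 - p.2)
        + c (-p.1 - p.2) * c (-p.2 - (-p.1 - p.2)) * W p.2 (-p.1 - p.2))
        = ∑ p ∈ S, -W p.1 p.2 := by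
      refine Finset.sum_congr rfl fun p hp => ?_
      obtain ⟨h1, h2, h3⟩ := (hS p).1 hp
      rw [hWrot, show -p.2 - (-p.1 - p.2) = p.1 by abel]
      linear_combination W p.1 p.2 * hadd p.1 h1 p.2 h2 (hthird _ _ h1 h2 h3)
    rw [Finset.sum_add_distrib, Finset.sum_add_distrib, Finset.sum_neg_distrib] at e3
    have e4 : ∑ p ∈ S, c p.2 * c (-p.1 - p.2) * W p.2 (-p.1 - p.2)
        = ∑ p ∈ S, c p.2 * c (-p.1 - p.2) * W p.1 p.2 :=
      Finset.sum_congr rfl fun p _ => by rw [hWrot]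
    linear_combination e3 - 2 * e1 - e2 + e4
  have h4 := sum_wedgePairing hB hX hRp ξ ζ η μ
  rw [hT, hd, h2] at h4
  rw [hg, hd, h1] at hall
  -- With Σ_S W = 48a(…) from the wedge tensor, the sum of c_α c_β W over S is -16a(…), the sum of g
  -- over all pairs of roots 32a(…), over positive pairs 8a(…), and half of that is the claim.
  linear_combination hanti / 2 - hall / 8 - h3 / 12 + h4 / 24

end RootIdentity

/-! ### Linear total differential equations -/

section Frobenius

set_option maxSynthPendingDepth 3

open Metric

variable {E W : Type*} [NormedAddCommGroup E] [NormedSpace ℂ E]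
  [NormedAddCommGroup W] [NormedSpace ℂ W]

/-- The path `t ↦ t ^ j • w` on the unit interval. -/
noncomputable def monomialPath (j : ℕ) : W →L[ℂ] C(unitInterval, W) :=
  LinearMap.mkContinuous
    { toFun := fun w => ⟨fun t => ((t : ℝ) : ℂ) ^ j • w, by fun_prop⟩
      map_add' := fun v w => by ext t; simp
      map_smul' := fun c w => by
        ext t
        simp only [ContinuousMap.coe_mk, ContinuousMap.coe_smul, Pi.smul_apply, RingHom.id_apply]
        rw [smul_comm] } 1
    fun w => by
      rw [one_mul, ContinuousMap.norm_le _ (norm_nonneg w)]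
      intro t
      simp only [LinearMap.coe_mk, AddHom.coe_mk, ContinuousMap.coe_mk]
      rw [norm_smul, norm_pow, Complex.norm_real, Real.norm_of_nonneg t.2.1]
      exact mul_le_of_le_one_left (norm_nonneg w) (pow_le_one₀ t.2.1 t.2.2)

theorem monomialPath_apply (j : ℕ) (w : W) (t : unitInterval) :
    monomialPath j w t = ((t : ℝ) : ℂ) ^ j • w := rfl

theorem norm_monomialPath_le (j : ℕ) : ‖(monomialPath j : W →L[ℂ] C(unitInterval, W))‖ ≤ 1 :=
  LinearMap.mkContinuous_norm_le _ zero_le_one _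

/-- The primitive of a path on the unit interval. -/
noncomputable def primitive : C(unitInterval, W) →L[ℂ] C(unitInterval, W) :=
  LinearMap.mkContinuous
    { toFun := fun g => ⟨fun t => ∫ s in (0 : ℝ)..t, g (Set.projIcc 0 1 zero_le_one s),
        (intervalIntegral.continuous_primitive (fun _ _ =>
          (g.continuous.comp continuous_projIcc).intervalIntegrable _ _) 0).comp
          continuous_subtype_val⟩
      map_add' := fun f g => by
        ext t
        exact intervalIntegral.integral_add
          ((f.continuous.comp continuous_projIcc).intervalIntegrable _ _)
          ((g.continuous.comp continuous_projIcc).intervalIntegrable _ _)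
      map_smul' := fun c g => by
        ext t
        exact intervalIntegral.integral_smul c _ } 1
    fun g => by
      rw [one_mul, ContinuousMap.norm_le _ (norm_nonneg g)]
      intro t
      refine (intervalIntegral.norm_integral_le_of_norm_le_const
        fun s _ => g.norm_coe_le_norm _).trans ?_
      rw [sub_zero, abs_of_nonneg t.2.1]
      exact mul_le_of_le_one_right (norm_nonneg g) t.2.2

/-- Evaluation of a path of linear maps at a vector. -/
noncomputable def pathApply : C(unitInterval, E →L[ℂ] W) →L[ℂ] E →L[ℂ] C(unitInterval, W) :=
  LinearMap.mkContinuous₂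
    (LinearMap.mk₂ ℂ (fun (g : C(unitInterval, E →L[ℂ] W)) v =>
      (⟨fun t => g t v, by fun_prop⟩ : C(unitInterval, W)))
      (fun _ _ _ => rfl) (fun _ _ _ => rfl)
      (fun g v w => by ext t; exact map_add (g t) v w)
      fun c g v => by ext t; exact map_smul (g t) c v) 1
    fun g v => by
      rw [one_mul, ContinuousMap.norm_le _ (by positivity)]
      intro t
      exact ((g t).le_opNorm v).trans
        (mul_le_mul_of_nonneg_right (g.norm_coe_le_norm t) (norm_nonneg v))

theorem pathApply_apply (g : C(unitInterval, E →L[ℂ] W)) (v : E) (t : unitInterval) :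
    pathApply g v t = g t v := rfl

variable [CompleteSpace W]

omit [CompleteSpace W] in
theorem analyticAt_clm {X : Type*} [NormedAddCommGroup X] [NormedSpace ℂ X] (L : X →L[ℂ] W)
    {f : E → X} {p : E} (hf : AnalyticAt ℂ f p) : AnalyticAt ℂ (fun v => L (f v)) p :=
  (L.analyticAt _).comp hf

omit [CompleteSpace W] in
theorem analyticAt_bilinear {X Y : Type*} [NormedAddCommGroup X] [NormedSpace ℂ X]
    [NormedAddCommGroup Y] [NormedSpace ℂ Y] (L : X →L[ℂ] Y →L[ℂ] W) {f : E → X} {g : E → Y}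
    {p : E} (hf : AnalyticAt ℂ f p) (hg : AnalyticAt ℂ g p) :
    AnalyticAt ℂ (fun v => L (f v) (g v)) p :=
  AnalyticAt.comp₂ (h := fun q : X × Y => L q.1 q.2) (L.analyticAt_bilinear _) hf hg

/-- The restriction of an analytic function to the segment from the origin to `v` depends
analytically on `v`. -/
theorem exists_analyticAt_segment {a : E → W} (ha : AnalyticAt ℂ a 0) :
    ∃ g : E → C(unitInterval, W), AnalyticAt ℂ g 0 ∧
      ∀ᶠ v in 𝓝 0, ∀ t : unitInterval, g v t = a (((t : ℝ) : ℂ) • v) := by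
  obtain ⟨p, r, hp⟩ := ha
  -- The j-th term is homogeneous, so its value at t v is t^j times its value at v. Storing t^j as a
  -- path of norm at most 1 gives a power series with values in paths whose radius has not shrunk.
  let q : FormalMultilinearSeries ℂ E C(unitInterval, W) := fun j =>
    (monomialPath j).compContinuousMultilinearMap (p j)
  have hq : ∀ j, ‖q j‖ ≤ ‖p j‖ := fun j =>
    (ContinuousLinearMap.norm_compContinuousMultilinearMap_le _ _).trans
      (mul_le_of_le_one_left (norm_nonneg _) (norm_monomialPath_le j))
  have hrad : r ≤ q.radius := by
    refine hp.r_le.trans (ENNReal.le_of_forall_nnreal_lt fun ρ hρ => ?_)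
    obtain ⟨C, -, hC⟩ := p.norm_mul_pow_le_of_lt_radius hρ
    exact q.le_radius_of_bound C fun j =>
      (mul_le_mul_of_nonneg_right (hq j) (by positivity)).trans (hC j)
  have hqs := (q.hasFPowerSeriesOnBall (hp.r_pos.trans_le hrad)).mono hp.r_pos hrad
  refine ⟨q.sum, hqs.analyticAt, ?_⟩
  filter_upwards [Metric.eball_mem_nhds (0 : E) hp.r_pos] with v hv t
  have h1 := (hqs.hasSum hv).mapL (ContinuousMap.evalCLM ℂ t)
  have htv : ((t : ℝ) : ℂ) • v ∈ Metric.eball (0 : E) r := by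
    rw [Metric.mem_eball, edist_zero_right] at hv ⊢
    refine lt_of_le_of_lt ?_ hv
    rw [← ofReal_norm, ← ofReal_norm]
    refine ENNReal.ofReal_le_ofReal ?_
    rw [norm_smul, Complex.norm_real, Real.norm_of_nonneg t.2.1]
    exact mul_le_of_le_one_left (norm_nonneg v) t.2.2
  have h2 := hp.hasSum htv
  rw [zero_add] at h1 h2
  refine h1.unique ?_
  convert h2 using 2 with j
  have := (p j).map_smul_univ (fun _ => ((t : ℝ) : ℂ)) fun _ => v
  rw [this]
  simp [q, monomialPath_apply]

variable {U : Type*} [NormedAddCommGroup U] [NormedSpace ℂ U] [CompleteSpace U]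

omit [CompleteSpace W] in
/-- The curves `φ' = T(t) φ` with bounded `T` and `φ 0 = 0` vanish. -/
theorem eq_zero_of_linear_ode {φ : ℝ → W} {φ' : ℝ → W} {K : ℝ}
    (hφ : ∀ t ∈ Set.Icc (0 : ℝ) 1, HasDerivAt φ (φ' t) t) (h0 : φ 0 = 0)
    (hK : ∀ t ∈ Set.Icc (0 : ℝ) 1, ‖φ' t‖ ≤ K * ‖φ t‖) : φ 1 = 0 :=
  eq_zero_of_abs_deriv_le_mul_abs_self_of_eq_zero_right (f' := φ')
    (fun t ht => (hφ t ht).continuousAt.continuousWithinAt)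
    (fun t ht => (hφ t (Set.Ico_subset_Icc_self ht)).hasDerivWithinAt) h0
    (fun t ht => hK t (Set.Ico_subset_Icc_self ht)) 1 (Set.right_mem_Icc.2 zero_le_one)

omit [CompleteSpace W] in
theorem hasDerivAt_ray (v : E) (t : ℝ) : HasDerivAt (fun t : ℝ => (t : ℂ) • v) v t := by
  have := (Complex.ofRealCLM.hasDerivAt (x := t)).smul_const v
  simpa using this

omit [CompleteSpace W] in
theorem hasDerivAt_comp_ray {f : E → W} {v : E} {t : ℝ}
    (hf : DifferentiableAt ℂ f ((t : ℂ) • v)) :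
    HasDerivAt (fun t : ℝ => f ((t : ℂ) • v)) (fderiv ℂ f ((t : ℂ) • v) v) t :=
  (hf.hasFDerivAt.restrictScalars ℝ).comp_hasDerivAt
    (f := fun t : ℝ => (t : ℂ) • v) t (hasDerivAt_ray v t)

theorem ray_mem_ball {v : E} {r : ℝ} (hv : v ∈ ball (0 : E) r) {t : ℝ}
    (ht : t ∈ Set.Icc (0 : ℝ) 1) : (t : ℂ) • v ∈ ball (0 : E) r := by
  rw [mem_ball_zero_iff] at hv ⊢
  refine lt_of_le_of_lt ?_ hv
  rw [norm_smul, Complex.norm_real, Real.norm_of_nonneg ht.1]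
  exact mul_le_of_le_one_left (norm_nonneg v) ht.2

omit [CompleteSpace W] in
theorem eventually_norm_lt {f : E → W} (hf : AnalyticAt ℂ f 0) {c : ℝ} (h : ‖f 0‖ < c) :
    ∀ᶠ x in 𝓝 0, ‖f x‖ < c :=
  hf.continuousAt.norm.eventually_lt_const h

/-- Uniqueness for linear total differential equations. -/
theorem eventually_eq_zero_of_fderiv_eq {A : E → E →L[ℂ] U →L[ℂ] U} (hA : AnalyticAt ℂ A 0)
    {F : E → U} (hF : AnalyticAt ℂ F 0) (h : ∀ᶠ x in 𝓝 0, ∀ v, fderiv ℂ F x v = A x v (F x))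
    (h0 : F 0 = 0) : ∀ᶠ x in 𝓝 0, F x = 0 := by
  have hM : ∀ᶠ x in 𝓝 0, ‖A x‖ < ‖A 0‖ + 1 :=
    eventually_norm_lt hA (lt_add_one _)
  obtain ⟨r, hr, hball⟩ := eventually_nhds_iff_ball.1
    (hF.eventually_analyticAt.and (h.and hM))
  refine eventually_nhds_iff_ball.2 ⟨r, hr, fun v hv => ?_⟩
  have key := eq_zero_of_linear_ode (φ := fun t : ℝ => F ((t : ℂ) • v))
    (φ' := fun t : ℝ => fderiv ℂ F ((t : ℂ) • v) v) (K := (‖A 0‖ + 1) * ‖v‖)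
    (fun t ht => hasDerivAt_comp_ray (hball _ (ray_mem_ball hv ht)).1.differentiableAt)
    (by simpa using h0) fun t ht => ?_
  · simpa using key
  · obtain ⟨-, h1, h2⟩ := hball _ (ray_mem_ball hv ht)
    rw [h1]
    refine ((A _ v).le_opNorm _).trans (mul_le_mul_of_nonneg_right ?_ (norm_nonneg _))
    exact ((A _).le_opNorm v).trans (mul_le_mul_of_nonneg_right h2.le (norm_nonneg v))

/-- A linear fixed point equation that depends analytically on parameters. -/
theorem exists_analyticAt_fixedPoint {K : E → W →L[ℂ] W} (hK : AnalyticAt ℂ K 0) (hK0 : K 0 = 0)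
    (c : W) : ∃ Z : E → W, AnalyticAt ℂ Z 0 ∧ Z 0 = c ∧
      ∀ᶠ v in 𝓝 0, ∀ z, z = c + K v z ↔ z = Z v := by
  have h1 : AnalyticAt ℂ (fun v => Ring.inverse (1 - K v)) 0 :=
    AnalyticAt.comp_of_eq (g := fun x => Ring.inverse (1 - x))
      (analyticAt_inverse_one_sub ℂ (W →L[ℂ] W)) hK hK0
  refine ⟨fun v => Ring.inverse (1 - K v) c,
    ((ContinuousLinearMap.apply ℂ W c).analyticAt _).comp h1, by simp [hK0], ?_⟩
  have h2 : ∀ᶠ v in 𝓝 0, ‖K v‖ < 1 :=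
    eventually_norm_lt hK (by simp [hK0])
  filter_upwards [h2] with v hv z
  have hu := isUnit_one_sub_of_norm_lt_one hv
  have e : z = c + K v z ↔ (1 - K v) z = c := sub_eq_iff_eq_add.symm
  rw [e]
  constructor
  · rintro rfl
    exact (congrArg (fun T : W →L[ℂ] W => T z) (Ring.inverse_mul_cancel _ hu)).symm
  · rintro rfl
    exact congrArg (fun T : W →L[ℂ] W => T c) (Ring.mul_inverse_cancel _ hu)

/-- The path of values of a path of operators on a path of vectors. -/
noncomputable def pathAct : C(unitInterval, U →L[ℂ] U) →L[ℂ]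
    C(unitInterval, U) →L[ℂ] C(unitInterval, U) :=
  LinearMap.mkContinuous₂
    (LinearMap.mk₂ ℂ (fun (G : C(unitInterval, U →L[ℂ] U)) z =>
      (⟨fun t => G t (z t), by fun_prop⟩ : C(unitInterval, U)))
      (fun _ _ _ => rfl) (fun _ _ _ => rfl)
      (fun G v w => by ext t; exact map_add (G t) (v t) (w t))
      fun c G v => by ext t; exact map_smul (G t) c (v t)) 1
    fun G v => by
      rw [one_mul, ContinuousMap.norm_le _ (by positivity)]
      intro t
      exact ((G t).le_opNorm (v t)).trans
        (mul_le_mul (G.norm_coe_le_norm t) (v.norm_coe_le_norm t) (norm_nonneg _) (norm_nonneg G))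

/-- The integral operator `z ↦ ∫ G z` of a path `G` of operators. -/
noncomputable def volterra : C(unitInterval, U →L[ℂ] U) →L[ℂ]
    C(unitInterval, U) →L[ℂ] C(unitInterval, U) :=
  (ContinuousLinearMap.compL ℂ C(unitInterval, U) C(unitInterval, U) C(unitInterval, U)
    primitive).comp pathAct

omit [CompleteSpace U] in
theorem volterra_apply (G : C(unitInterval, U →L[ℂ] U)) (z : C(unitInterval, U))
    (t : unitInterval) : volterra G z t = ∫ s in (0 : ℝ)..t,
      G (Set.projIcc 0 1 zero_le_one s) (z (Set.projIcc 0 1 zero_le_one s)) := rfl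

/-- The coefficient of the equation along the ray t ↦ t v. It vanishes at v = 0, which makes the
integral equation there a small perturbation of the identity. -/
theorem exists_analyticAt_operatorPath {A : E → E →L[ℂ] U →L[ℂ] U} (hA : AnalyticAt ℂ A 0) :
    ∃ G : E → C(unitInterval, U →L[ℂ] U), AnalyticAt ℂ G 0 ∧ G 0 = 0 ∧
      ∀ᶠ v in 𝓝 0, ∀ t : unitInterval, G v t = A (((t : ℝ) : ℂ) • v) v := by
  obtain ⟨g, hg, hgA⟩ := exists_analyticAt_segment hA
  refine ⟨fun v => pathApply (g v) v, ?_, map_zero _, ?_⟩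
  · exact analyticAt_bilinear pathApply hg analyticAt_id
  · filter_upwards [hgA] with v hv t
    rw [pathApply_apply, hv]

/-- The integral equation `Z(v)(t) = u + ∫ A(s v)(v) Z(v)(s)` has a solution that depends
analytically on `v` and is a function of `t v`. -/
theorem exists_integral_solution {A : E → E →L[ℂ] U →L[ℂ] U} (hA : AnalyticAt ℂ A 0) (u : U) :
    ∃ Z : E → C(unitInterval, U), AnalyticAt ℂ Z 0 ∧ Z 0 1 = u ∧ ∃ r > 0, ∀ v ∈ ball (0 : E) r,
      ∀ t : unitInterval, Z v t = Z (((t : ℝ) : ℂ) • v) 1 ∧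
        Z v t = u + ∫ s in (0 : ℝ)..t,
          A ((s : ℂ) • v) v (Z v (Set.projIcc 0 1 zero_le_one s)) := by
  obtain ⟨G, hG, hG0, hGA⟩ := exists_analyticAt_operatorPath hA
  obtain ⟨Z, hZ, hZ0, hfix⟩ := exists_analyticAt_fixedPoint (K := fun v => volterra (G v))
    (analyticAt_clm volterra hG) (by rw [hG0, map_zero])
    (ContinuousMap.const unitInterval u)
  obtain ⟨r, hr, hball⟩ := eventually_nhds_iff_ball.1 (hfix.and hGA)
  have hZint : ∀ v ∈ ball (0 : E) r, ∀ t : unitInterval, Z v t = u + ∫ s in (0 : ℝ)..t,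
      A ((s : ℂ) • v) v (Z v (Set.projIcc 0 1 zero_le_one s)) := by
    intro v hv t
    have h1 := congrArg (fun z : C(unitInterval, U) => z t) ((((hball v hv).1 (Z v)).2 rfl))
    simp only [ContinuousMap.add_apply, ContinuousMap.const_apply, volterra_apply] at h1
    rw [h1]
    congr 1
    refine intervalIntegral.integral_congr fun s hs => ?_
    rw [Set.uIcc_of_le t.2.1] at hs
    have hs' : s ∈ Set.Icc (0 : ℝ) 1 := ⟨hs.1, hs.2.trans t.2.2⟩
    rw [(hball v hv).2, Set.projIcc_of_mem _ hs']
  -- After the substitution s ↦ c s, the path t ↦ Z(v)(c t) solves the integral equation for the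
  -- vector c v, and solutions are unique.
  have hscale : ∀ v ∈ ball (0 : E) r, ∀ c t : unitInterval,
      Z v (c * t) = Z (((c : ℝ) : ℂ) • v) t := by
    intro v hv c t
    have hcv := ray_mem_ball hv c.2
    have h1 := ((hball _ hcv).1 ((Z v).comp ⟨fun t => c * t, by fun_prop⟩)).1 ?_
    · exact congrArg (fun z : C(unitInterval, U) => z t) h1
    · ext t
      simp only [ContinuousMap.add_apply, ContinuousMap.const_apply, volterra_apply,
        ContinuousMap.comp_apply, ContinuousMap.coe_mk]
      rw [hZint v hv]
      congr 1
      rw [Set.Icc.coe_mul]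
      have h2 := intervalIntegral.smul_integral_comp_mul_left (a := 0) (b := t)
        (fun s : ℝ => A ((s : ℂ) • v) v (Z v (Set.projIcc 0 1 zero_le_one s))) (c : ℝ)
      rw [mul_zero] at h2
      rw [← h2, ← intervalIntegral.integral_smul]
      refine intervalIntegral.integral_congr fun s hs => ?_
      rw [Set.uIcc_of_le t.2.1] at hs
      have hs' : s ∈ Set.Icc (0 : ℝ) 1 := ⟨hs.1, hs.2.trans t.2.2⟩
      have hcs : (c : ℝ) * s ∈ Set.Icc (0 : ℝ) 1 := ⟨mul_nonneg c.2.1 hs.1,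
        mul_le_one₀ c.2.2 hs.1 hs'.2⟩
      rw [(hball _ hcv).2, Set.projIcc_of_mem _ hs', Set.projIcc_of_mem _ hcs, map_smul,
        smul_smul, Complex.ofReal_mul, mul_comm (s : ℂ)]
      rfl
  refine ⟨Z, hZ, by rw [hZ0]; rfl, r, hr, fun v hv t => ⟨?_, hZint v hv t⟩⟩
  rw [← hscale v hv t 1, mul_one]

/-- The radial equation `DF(x)(x) = A(x)(x) F(x)` has an analytic solution with prescribed value
at the origin. -/
theorem exists_radial_solution {A : E → E →L[ℂ] U →L[ℂ] U} (hA : AnalyticAt ℂ A 0) (u : U) :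
    ∃ F : E → U, AnalyticAt ℂ F 0 ∧ F 0 = u ∧
      ∀ᶠ x in 𝓝 0, fderiv ℂ F x x = A x x (F x) := by
  obtain ⟨Z, hZ, hZ0, r, hr, hint⟩ := exists_integral_solution hA u
  have hF : AnalyticAt ℂ (fun v => Z v 1) 0 :=
    analyticAt_clm (ContinuousMap.evalCLM ℂ (1 : unitInterval)) hZ
  refine ⟨fun v => Z v 1, hF, hZ0, ?_⟩
  obtain ⟨r', hr', hball⟩ := eventually_nhds_iff_ball.1
    (hF.eventually_analyticAt.and hA.eventually_analyticAt)
  have hm : 0 < min r r' := lt_min hr hr'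
  refine eventually_nhds_iff_ball.2 ⟨min r r' / 2, half_pos hm, fun x hx => ?_⟩
  -- Paths live on [0,1], so x is made the midpoint of the segment from 0 to v; the derivative at t
  -- = 1/2 is then two-sided.
  set v : E := (2 : ℂ) • x with hv
  have hvm : v ∈ ball (0 : E) (min r r') := by
    rw [mem_ball_zero_iff] at hx ⊢
    rw [hv, norm_smul, Complex.norm_ofNat]
    linarith
  have hvr := ball_subset_ball (min_le_left r r') hvm
  have hvr' := ball_subset_ball (min_le_right r r') hvm
  have hxv : (((1 / 2 : ℝ)) : ℂ) • v = x := by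
    rw [hv, smul_smul]
    norm_num
  have hmem : (1 / 2 : ℝ) ∈ Set.Icc (0 : ℝ) 1 := by norm_num
  have hd1 := hasDerivAt_comp_ray (f := fun v => Z v 1) (v := v) (t := 1 / 2)
    (hball _ (ray_mem_ball hvr' hmem)).1.differentiableAt
  rw [hxv] at hd1
  let G : ℝ → U := fun s => A ((s : ℂ) • v) v (Z v (Set.projIcc 0 1 zero_le_one s))
  have hGc : ∀ s ∈ Set.Icc (0 : ℝ) 1, ContinuousAt G s := by
    intro s hs
    have h1 : ContinuousAt (fun s : ℝ => A ((s : ℂ) • v)) s :=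
      ContinuousAt.comp (f := fun s : ℝ => (s : ℂ) • v)
        (hball _ (ray_mem_ball hvr' hs)).2.continuousAt (hasDerivAt_ray v s).continuousAt
    exact (h1.clm_apply continuousAt_const).clm_apply
      ((Z v).continuous.comp continuous_projIcc).continuousAt
  have hd2 : HasDerivAt (fun t => u + ∫ s in (0 : ℝ)..t, G s) (G (1 / 2)) (1 / 2) := by
    refine (intervalIntegral.integral_hasDerivAt_right ?_ ?_ (hGc _ hmem)).const_add u
    · refine ContinuousOn.intervalIntegrable fun s hs => (hGc s ?_).continuousWithinAt
      rw [Set.uIcc_of_le (by norm_num)] at hs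
      exact ⟨hs.1, hs.2.trans (by norm_num)⟩
    · refine ContinuousOn.stronglyMeasurableAtFilter isOpen_Ioo
        (fun s hs => (hGc s (Set.Ioo_subset_Icc_self hs)).continuousWithinAt) _ ?_
      exact (by norm_num : (1 / 2 : ℝ) ∈ Set.Ioo (0 : ℝ) 1)
  have heq : (fun t : ℝ => Z ((t : ℂ) • v) 1) =ᶠ[𝓝 (1 / 2)]
      fun t => u + ∫ s in (0 : ℝ)..t, G s := by
    filter_upwards [Icc_mem_nhds (by norm_num : (0 : ℝ) < 1 / 2) (by norm_num : (1 / 2 : ℝ) < 1)]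
      with t ht
    obtain ⟨h1, h2⟩ := hint v hvr ⟨t, ht⟩
    exact h1.symm.trans h2
  have h3 := hd1.unique (hd2.congr_of_eventuallyEq heq)
  have h4 : G (1 / 2) = A x v (Z x 1) := by
    simp only [G]
    rw [hxv, Set.projIcc_of_mem _ hmem, (hint v hvr ⟨1 / 2, hmem⟩).1]
    simp only
    rw [hxv]
  rw [h4, hv, map_smul, map_smul] at h3
  exact smul_right_injective U (two_ne_zero' ℂ) h3

end Frobenius

-- The Frobenius theorem for flat connections.

section FlatConnection

set_option maxSynthPendingDepth 3

open Metric

variable {E U : Type*} [NormedAddCommGroup E] [NormedSpace ℂ E]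
  [NormedAddCommGroup U] [NormedSpace ℂ U] [CompleteSpace U]

/-- The second derivative along a radial solution of a flat linear total differential equation. -/
theorem fderiv_radial {A : E → E →L[ℂ] U →L[ℂ] U} {F : E → U} {x : E}
    (hA : AnalyticAt ℂ A x) (hF : AnalyticAt ℂ F x)
    (hrad : ∀ᶠ y in 𝓝 x, fderiv ℂ F y y = A y y (F y)) (w : E) :
    fderiv ℂ (fderiv ℂ F) x w x + fderiv ℂ F x w
      = fderiv ℂ A x w x (F x) + A x w (F x) + A x x (fderiv ℂ F x w) := by
  have hF' := hF.fderiv.differentiableAt.hasFDerivAt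
  have hF0 := hF.differentiableAt.hasFDerivAt
  have hA' := hA.differentiableAt.hasFDerivAt
  have h1 := hF'.clm_apply (hasFDerivAt_id x)
  have h2 := (hA'.clm_apply (hasFDerivAt_id x)).clm_apply hF0
  have h3 : (fun y => fderiv ℂ F y (id y)) =ᶠ[𝓝 x] fun y => A y (id y) (F y) := hrad
  have h4 := congrArg (fun T : E →L[ℂ] U => T w) (h1.unique (h2.congr_of_eventuallyEq h3))
  simp only [_root_.add_apply, ContinuousLinearMap.comp_apply,
    ContinuousLinearMap.flip_apply, ContinuousLinearMap.id_apply, id] at h4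
  rw [add_comm, h4]
  abel

theorem fderiv_fderiv_comm {F : E → U} {x : E} (hF : AnalyticAt ℂ F x) (v w : E) :
    fderiv ℂ (fderiv ℂ F) x v w = fderiv ℂ (fderiv ℂ F) x w v :=
  second_derivative_symmetric_of_eventually
    (hF.eventually_analyticAt.mono fun _ hy => hy.differentiableAt.hasFDerivAt)
    hF.fderiv.differentiableAt.hasFDerivAt v w

/-- **Frobenius theorem** for flat linear total differential equations with analytic
coefficients. -/
theorem exists_flat_solution {A : E → E →L[ℂ] U →L[ℂ] U} (hA : AnalyticAt ℂ A 0)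
    (hflat : ∀ᶠ x in 𝓝 0, ∀ v w u,
      fderiv ℂ A x v w u - fderiv ℂ A x w v u = A x v (A x w u) - A x w (A x v u)) (u : U) :
    ∃ F : E → U, AnalyticAt ℂ F 0 ∧ F 0 = u ∧
      ∀ᶠ x in 𝓝 0, ∀ w, fderiv ℂ F x w = A x w (F x) := by
  obtain ⟨F, hF, hF0, hrad⟩ := exists_radial_solution hA u
  refine ⟨F, hF, hF0, ?_⟩
  have hM : ∀ᶠ x in 𝓝 0, ‖A x‖ < ‖A 0‖ + 1 := eventually_norm_lt hA (lt_add_one _)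
  obtain ⟨r, hr, hball⟩ := eventually_nhds_iff_ball.1
    ((hF.eventually_analyticAt.and hA.eventually_analyticAt).and
      (hrad.eventually_nhds.and (hflat.and hM)))
  refine eventually_nhds_iff_ball.2 ⟨r, hr, fun v hv w => ?_⟩
  let Ψ : E → U := fun x => fderiv ℂ F x w - A x w (F x)
  have hΨ : ∀ x ∈ ball (0 : E) r, HasFDerivAt Ψ (fderiv ℂ Ψ x) x ∧ ∀ y, fderiv ℂ Ψ x y
      = fderiv ℂ (fderiv ℂ F) x y w - (fderiv ℂ A x y w (F x) + A x w (fderiv ℂ F x y)) := by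
    intro x hx
    obtain ⟨⟨hFx, hAx⟩, -⟩ := hball x hx
    have h1 := hFx.fderiv.differentiableAt.hasFDerivAt.clm_apply (hasFDerivAt_const w x)
    have h2 := (hAx.differentiableAt.hasFDerivAt.clm_apply (hasFDerivAt_const w x)).clm_apply
      hFx.differentiableAt.hasFDerivAt
    have h3 : HasFDerivAt Ψ _ x := h1.sub h2
    refine ⟨h3.differentiableAt.hasFDerivAt, fun y => ?_⟩
    rw [h3.fderiv]
    simp only [_root_.sub_apply, _root_.add_apply,
      ContinuousLinearMap.comp_apply, ContinuousLinearMap.flip_apply, map_zero, zero_add,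
      _root_.zero_apply]
    abel
  -- Ψ is the defect of the radial solution in the direction w. Differentiating the radial equation
  -- along w produces an extra term Ψ; the factor t absorbs it, and flatness turns the rest into
  -- A(tv)(v) applied to tΨ(tv). The factor t also supplies the zero initial value.
  have key := eq_zero_of_linear_ode (φ := fun t : ℝ => (t : ℂ) • Ψ ((t : ℂ) • v))
    (φ' := fun t : ℝ => A ((t : ℂ) • v) v ((t : ℂ) • Ψ ((t : ℂ) • v)))
    (K := (‖A 0‖ + 1) * ‖v‖) (fun t ht => ?_) (by simp) fun t ht => ?_
  · simp only [Complex.ofReal_one, one_smul] at key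
    exact sub_eq_zero.1 key
  · obtain ⟨⟨hFx, hAx⟩, hradx, hflatx, -⟩ := hball _ (ray_mem_ball hv ht)
    obtain ⟨hΨ1, hΨ2⟩ := hΨ _ (ray_mem_ball hv ht)
    have d1 := (Complex.ofRealCLM.hasDerivAt (x := t)).smul
      (hasDerivAt_comp_ray hΨ1.differentiableAt)
    refine d1.congr_deriv ?_
    have hmix := fderiv_radial hAx hFx hradx w
    rw [fderiv_fderiv_comm hFx] at hmix
    have hF1 := hradx.self_of_nhds
    have hfl := hflatx w ((t : ℂ) • v) (F ((t : ℂ) • v))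
    have hΨx := hΨ2 ((t : ℂ) • v)
    have e4 : A ((t : ℂ) • v) v ((t : ℂ) • Ψ ((t : ℂ) • v))
        = A ((t : ℂ) • v) ((t : ℂ) • v) (fderiv ℂ F ((t : ℂ) • v) w)
          - A ((t : ℂ) • v) ((t : ℂ) • v) (A ((t : ℂ) • v) w (F ((t : ℂ) • v))) := by
      rw [← map_sub, map_smul, map_smul]
      rfl
    rw [e4]
    simp only [Complex.ofRealCLM_apply, Complex.ofReal_one, one_smul]
    rw [← map_smul, hΨx, hF1]
    simp only [Ψ]
    linear_combination (norm := abel) hmix + hfl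
  · obtain ⟨-, -, -, h2⟩ := hball _ (ray_mem_ball hv ht)
    refine ((A _ v).le_opNorm _).trans (mul_le_mul_of_nonneg_right ?_ (norm_nonneg _))
    exact ((A _).le_opNorm v).trans (mul_le_mul_of_nonneg_right h2.le (norm_nonneg v))

end FlatConnection

/-! ### Characters and the coefficients of the system -/

section Characters

variable {n : ℕ}

theorem character_neg (α : Fin n → ℤ) (h : Fin n → ℂ) : character (-α) h = (character α h)⁻¹ := by
  simp [character, _root_.zpow_neg]

theorem character_ne_zero (α : Fin n → ℤ) {h : Fin n → ℂ} (hh : ∀ i, h i ≠ 0) :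
    character α h ≠ 0 :=
  Finset.prod_ne_zero_iff.2 fun i _ => zpow_ne_zero _ (hh i)

theorem character_add (α β : Fin n → ℤ) {h : Fin n → ℂ} (hh : ∀ i, h i ≠ 0) :
    character (α + β) h = character α h * character β h := by
  simp only [character, Pi.add_apply, zpow_add₀ (hh _), Finset.prod_mul_distrib]

/-- The coefficient `(1 + h ^ (-α)) / (1 - h ^ (-α))`. -/
noncomputable def cot (α : Fin n → ℤ) (h : Fin n → ℂ) : ℂ :=
  (1 + character (-α) h) / (1 - character (-α) h)

variable {B : Matrix (Fin n) (Fin n) ℤ}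

theorem one_sub_character_ne_zero {h : Fin n → ℂ} (hh : h ∈ mirrorComplement B) {α : Fin n → ℤ}
    (hα : α ∈ roots B) : 1 - character (-α) h ≠ 0 :=
  sub_ne_zero.2 (hh.2 _ (neg_mem_roots hα)).symm

theorem cot_neg {h : Fin n → ℂ} (hh : h ∈ mirrorComplement B) {α : Fin n → ℤ}
    (hα : α ∈ roots B) : cot (-α) h = -cot α h := by
  have h1 := one_sub_character_ne_zero hh hα
  have h2 := one_sub_character_ne_zero hh (neg_mem_roots hα)
  have h0 := character_ne_zero (-α) hh.1
  rw [cot, cot, ← neg_div, div_eq_div_iff h2 h1]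
  rw [character_neg (-α)]
  field_simp
  ring

/-- The addition law of the hyperbolic cotangent for three arguments with sum zero, since `cot α h`
is formally coth of half the logarithm of h^α. With x = h^{-α} and y = h^{-β} it is an identity of
rational functions. -/
theorem cot_mul_cot_add {h : Fin n → ℂ} (hh : h ∈ mirrorComplement B) {α β : Fin n → ℤ}
    (hα : α ∈ roots B) (hβ : β ∈ roots B) (hγ : -α - β ∈ roots B) :
    cot α h * cot β h + cot β h * cot (-α - β) h + cot (-α - β) h * cot α h = -1 := by
  have h1 := one_sub_character_ne_zero hh hα
  have h2 := one_sub_character_ne_zero hh hβ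
  have h3 := one_sub_character_ne_zero hh hγ
  have h01 := character_ne_zero (-α) hh.1
  have h02 := character_ne_zero (-β) hh.1
  have e : character (-(-α - β)) h = (character (-α) h * character (-β) h)⁻¹ := by
    rw [← character_add _ _ hh.1, ← character_neg]
    congr 1
  simp only [cot]
  rw [e] at h3 ⊢
  set x := character (-α) h
  set y := character (-β) h
  have h3' : x * y - 1 ≠ 0 := by
    intro h'
    apply h3
    rw [sub_eq_zero.1 h', inv_one, sub_self]
  have e3 : (1 + (x * y)⁻¹) / (1 - (x * y)⁻¹) = (x * y + 1) / (x * y - 1) := by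
    rw [div_eq_div_iff h3 h3']
    field_simp
  rw [e3]
  field_simp
  ring

/-- The character as a linear form. -/
noncomputable def pairingL (α : Fin n → ℤ) : (Fin n → ℂ) →L[ℂ] ℂ :=
  ∑ i, (α i : ℂ) • ContinuousLinearMap.proj i

theorem pairingL_apply (α : Fin n → ℤ) (ξ : Fin n → ℂ) : pairingL α ξ = pairing α ξ := by
  simp [pairingL, pairing]

end Characters

/-! ### Logarithmic coordinates -/

section Log

variable {n : ℕ}

/-- The chart `v ↦ p e^v` of the torus at `p`. -/
noncomputable def expChart (p v : Fin n → ℂ) : Fin n → ℂ := fun i => p i * Complex.exp (v i)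

/-- The inverse of the chart `expChart p` near `p`. -/
noncomputable def logChart (p h : Fin n → ℂ) : Fin n → ℂ := fun i => Complex.log (h i / p i)

theorem expChart_zero (p : Fin n → ℂ) : expChart p 0 = p := by
  funext i
  simp [expChart]

theorem analyticAt_expChart (p v : Fin n → ℂ) : AnalyticAt ℂ (expChart p) v := by
  rw [analyticAt_pi_iff]
  intro i
  exact analyticAt_const.mul
    ((ContinuousLinearMap.proj (R := ℂ) (φ := fun _ : Fin n => ℂ) i).analyticAt v).cexp'

theorem hasFDerivAt_expChart (p v : Fin n → ℂ) :
    HasFDerivAt (expChart p) (ContinuousLinearMap.pi fun i =>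
      expChart p v i • (ContinuousLinearMap.proj i : (Fin n → ℂ) →L[ℂ] ℂ)) v := by
  rw [hasFDerivAt_pi]
  intro i
  have h1 : HasFDerivAt (fun v : Fin n → ℂ => v i)
      (ContinuousLinearMap.proj i : (Fin n → ℂ) →L[ℂ] ℂ) v :=
    (ContinuousLinearMap.proj i : (Fin n → ℂ) →L[ℂ] ℂ).hasFDerivAt
  have h2 := (h1.cexp).const_mul (p i)
  rwa [smul_smul] at h2

theorem logChart_self {p : Fin n → ℂ} (hp : ∀ i, p i ≠ 0) : logChart p p = 0 := by
  funext i
  simp [logChart, hp i]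

theorem analyticAt_logChart {p : Fin n → ℂ} (hp : ∀ i, p i ≠ 0) :
    AnalyticAt ℂ (logChart p) p := by
  rw [analyticAt_pi_iff]
  intro i
  refine AnalyticAt.clog
    (((ContinuousLinearMap.proj (R := ℂ) i).analyticAt p).div analyticAt_const (hp i)) ?_
  rw [div_self (hp i)]
  exact Complex.one_mem_slitPlane

theorem expChart_logChart {p h : Fin n → ℂ} (hp : ∀ i, p i ≠ 0) (hh : ∀ i, h i ≠ 0) :
    expChart p (logChart p h) = h := by
  funext i
  rw [expChart, logChart, Complex.exp_log (div_ne_zero (hh i) (hp i)), mul_div_cancel₀ _ (hp i)]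

theorem eventually_logChart_expChart {p : Fin n → ℂ} (hp : ∀ i, p i ≠ 0) :
    ∀ᶠ v in 𝓝 0, logChart p (expChart p v) = v := by
  have h1 : ∀ i, ∀ᶠ v : Fin n → ℂ in 𝓝 0, |(v i).im| < Real.pi := by
    intro i
    have hc : Continuous fun v : Fin n → ℂ => |(v i).im| := by fun_prop
    exact hc.continuousAt.eventually_lt_const (by simpa using Real.pi_pos)
  filter_upwards [Filter.eventually_all.2 h1] with v hv
  funext i
  have := abs_lt.1 (hv i)
  rw [logChart, expChart, mul_div_cancel_left₀ _ (hp i), Complex.log_exp this.1 this.2.le]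

theorem eventually_ne_zero {p : Fin n → ℂ} (hp : ∀ i, p i ≠ 0) :
    ∀ᶠ h in 𝓝 p, ∀ i, h i ≠ 0 :=
  Filter.eventually_all.2 fun i => (continuous_apply i).continuousAt.eventually_ne (hp i)

/-- Points near `p` are described by small logarithmic coordinates. -/
theorem eventually_nhds_iff_expChart {p : Fin n → ℂ} (hp : ∀ i, p i ≠ 0)
    {P : (Fin n → ℂ) → Prop} :
    (∀ᶠ h in 𝓝 p, P h) ↔ ∀ᶠ v in 𝓝 0, P (expChart p v) := by
  constructor
  · intro h
    have := (analyticAt_expChart p 0).continuousAt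
    rw [ContinuousAt, expChart_zero] at this
    exact this.eventually h
  · intro h
    have := (analyticAt_logChart hp).continuousAt
    rw [ContinuousAt, logChart_self hp] at this
    filter_upwards [this.eventually h, eventually_ne_zero hp] with x hx hx0
    rwa [expChart_logChart hp hx0] at hx

/-- By the chain rule: the chart turns the invariant field into the constant directional derivative
along ξ. -/
theorem theta_expChart {p v : Fin n → ℂ} {f : (Fin n → ℂ) → ℂ}
    (hf : DifferentiableAt ℂ f (expChart p v)) (ξ : Fin n → ℂ) :
    theta ξ f (expChart p v) = fderiv ℂ (fun x => f (expChart p x)) v ξ := by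
  have h1 := hf.hasFDerivAt.comp v (hasFDerivAt_expChart p v)
  rw [show (fun x => f (expChart p x)) = f ∘ expChart p from rfl, h1.fderiv, theta]
  simp only [ContinuousLinearMap.comp_apply]
  congr 1
  funext i
  simp [mul_comm]

theorem character_expChart (α : Fin n → ℤ) {p : Fin n → ℂ} (v : Fin n → ℂ) :
    character α (expChart p v) = character α p * Complex.exp (pairing α v) := by
  simp only [character, expChart, pairing, mul_zpow, Finset.prod_mul_distrib, Complex.exp_sum]
  congr 1
  exact Finset.prod_congr rfl fun i _ => (Complex.exp_int_mul _ _).symm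

theorem analyticAt_character_expChart (α : Fin n → ℤ) (p v : Fin n → ℂ) :
    AnalyticAt ℂ (fun v => character α (expChart p v)) v := by
  simp only [character_expChart, ← pairingL_apply]
  exact analyticAt_const.mul ((pairingL α).analyticAt v).cexp'

variable {B : Matrix (Fin n) (Fin n) ℤ}

/-- The coefficient depends on v only through α(v). Closedness of the connection form needs just the
direction of the differential, so the factor stays unspecified. -/
theorem hasFDerivAt_cot {p v : Fin n → ℂ} {α : Fin n → ℤ}
    (hα : 1 - character (-α) (expChart p v) ≠ 0) :
    AnalyticAt ℂ (fun v => cot α (expChart p v)) v ∧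
      ∃ c : ℂ, HasFDerivAt (fun v => cot α (expChart p v)) (c • pairingL α) v := by
  refine ⟨(analyticAt_const.add (analyticAt_character_expChart _ p v)).div
    (analyticAt_const.sub (analyticAt_character_expChart _ p v)) hα, ?_⟩
  have h1 : HasFDerivAt (fun v => character (-α) (expChart p v))
      (character (-α) (expChart p v) • -pairingL α) v := by
    have h2 := ((pairingL (-α)).hasFDerivAt (x := v)).cexp.const_mul (character (-α) p)
    have e : pairingL (-α) = -pairingL α := by
      ext x
      simp [pairingL_apply, pairing_neg]
    have e2 : (fun v => character (-α) (expChart p v))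
        = fun v => character (-α) p * Complex.exp (pairingL (-α) v) := by
      funext v
      rw [character_expChart, pairingL_apply]
    rw [e2, character_expChart, ← e, ← smul_smul, ← pairingL_apply]
    exact h2
  have h2 : HasDerivAt (fun z : ℂ => (1 + z) / (1 - z)) _ (character (-α) (expChart p v)) :=
    ((hasDerivAt_id _).const_add 1).fun_div ((hasDerivAt_id _).const_sub 1) hα
  have h3 := h2.comp_hasFDerivAt v h1
  rw [smul_neg, ← neg_smul, smul_smul] at h3
  exact ⟨_, h3⟩

end Log

/-! ### The system in logarithmic coordinates -/

section Connection

set_option maxSynthPendingDepth 3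

variable {n : ℕ} {B : Matrix (Fin n) (Fin n) ℤ} {Rp : Finset (Fin n → ℤ)} {k a : ℂ}

theorem analyticAt_comp_expChart {f : (Fin n → ℂ) → ℂ} {p v : Fin n → ℂ}
    (hf : AnalyticAt ℂ f (expChart p v)) : AnalyticAt ℂ (fun x => f (expChart p x)) v :=
  hf.comp (analyticAt_expChart p v)

theorem hypOp_expChart {f : (Fin n → ℂ) → ℂ} {p v : Fin n → ℂ}
    (hf : AnalyticAt ℂ f (expChart p v)) (ξ η : Fin n → ℂ) :
    hypOp B Rp k a ξ η f (expChart p v)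
      = fderiv ℂ (fderiv ℂ fun x => f (expChart p x)) v ξ η
        + 1 / 2 * k * ∑ α ∈ Rp, pairing α ξ * pairing α η * cot α (expChart p v)
          * fderiv ℂ (fun x => f (expChart p x)) v (coroot B α)
        + a * k ^ 2 * dualForm B ξ η * f (expChart p v) := by
  have h1 : (fun x => theta η f (expChart p x))
      =ᶠ[𝓝 v] fun x => fderiv ℂ (fun x => f (expChart p x)) x η := by
    filter_upwards [(analyticAt_expChart p v).continuousAt.eventually hf.eventually_analyticAt]
      with x hx
    exact theta_expChart hx.differentiableAt η
  have h2 := (analyticAt_comp_expChart hf).fderiv.differentiableAt.hasFDerivAt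
  have h3 := ((ContinuousLinearMap.apply ℂ ℂ η).hasFDerivAt.comp v h2).fderiv
  rw [hypOp, theta_expChart (analyticAt_theta η hf).differentiableAt, h1.fderiv_eq]
  simp only [theta_expChart hf.differentiableAt]
  congr 2
  exact congrArg (fun L : (Fin n → ℂ) →L[ℂ] ℂ => L ξ) h3

/-- The equations depend bilinearly and symmetrically on their parameters. -/
theorem exists_hypOp_eq_bilinForm (hB : IsEvenScalarProduct B) {f : (Fin n → ℂ) → ℂ}
    {p : Fin n → ℂ} (hf : AnalyticAt ℂ f p) :
    ∃ Q : LinearMap.BilinForm ℂ (Fin n → ℂ), (∀ ξ η, hypOp B Rp k a ξ η f p = Q ξ η) ∧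
      ∀ ξ η, Q ξ η = Q η ξ := by
  rw [← expChart_zero p] at hf
  set g := fun x => f (expChart p x) with hg
  refine ⟨LinearMap.mk₂ ℂ (fun ξ η => hypOp B Rp k a ξ η f p) ?_ ?_ ?_ ?_, fun _ _ => rfl, ?_⟩
  all_goals
    intros
    try simp only [LinearMap.mk₂_apply]
    rw [← expChart_zero p]
    simp only [hypOp_expChart hf, ← pairingL_apply, ← dualBilin_apply, map_add, map_smul,
      _root_.add_apply, _root_.smul_apply, LinearMap.add_apply, LinearMap.smul_apply,
      smul_eq_mul, mul_add, add_mul, Finset.sum_add_distrib]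
  · ring
  · simp only [Finset.mul_sum]
    congr 1
    · congr 1
      exact Finset.sum_congr rfl fun α _ => by ring
    · ring
  · ring
  · simp only [Finset.mul_sum]
    congr 1
    · congr 1
      exact Finset.sum_congr rfl fun α _ => by ring
    · ring
  · rename_i ξ η
    rw [fderiv_fderiv_comm (analyticAt_comp_expChart hf), dualBilin_apply, dualBilin_apply,
      hB.dualForm_comm]
    congr 3
    exact Finset.sum_congr rfl fun α _ => by ring

/-- The fibre of the bundle of first jets of functions. -/
abbrev Jet (n : ℕ) : Type := ℂ × ((Fin n → ℂ) →L[ℂ] ℂ)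

/-- The part of the connection form without poles. -/
noncomputable def regularPart (B : Matrix (Fin n) (Fin n) ℤ) (k a : ℂ) :
    (Fin n → ℂ) →L[ℂ] Jet n →L[ℂ] Jet n :=
  LinearMap.toContinuousLinearMap
    ((LinearMap.toContinuousLinearMap (E := Jet n) (F' := Jet n)).toLinearMap ∘ₗ
      LinearMap.mk₂ ℂ (fun w u => ((u.2 w : ℂ),
        -(a * k ^ 2 * u.1) • LinearMap.toContinuousLinearMap (dualBilin B w)))
        (fun w w' u => by
          ext
          · simp
          · simp)
        (fun c w u => by
          ext
          · simp
          · simp; ring)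
        (fun w u u' => by
          ext
          · simp
          · simp; ring)
        (fun c w u => by
          ext
          · simp
          · simp; ring))

theorem regularPart_apply (w : Fin n → ℂ) (u : Jet n) :
    regularPart B k a w u = (u.2 w,
      -(a * k ^ 2 * u.1) • LinearMap.toContinuousLinearMap (dualBilin B w)) := rfl

/-- The residue of the connection form along the mirror of `α`, up to normalisation. -/
noncomputable def residueMap (B : Matrix (Fin n) (Fin n) ℤ) (k : ℂ) (α : Fin n → ℤ) :
    Jet n →L[ℂ] Jet n :=
  (ContinuousLinearMap.inr ℂ ℂ ((Fin n → ℂ) →L[ℂ] ℂ)).comp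
    (((-(1 / 2 * k)) • (ContinuousLinearMap.apply ℂ ℂ (coroot B α)).comp
      (ContinuousLinearMap.snd ℂ ℂ ((Fin n → ℂ) →L[ℂ] ℂ))).smulRight (pairingL α))

theorem residueMap_apply (α : Fin n → ℤ) (u : Jet n) :
    residueMap B k α u = (0, (-(1 / 2 * k) * u.2 (coroot B α)) • pairingL α) := rfl

/-- The connection form of the system, in logarithmic coordinates at `p`. -/
noncomputable def connection (B : Matrix (Fin n) (Fin n) ℤ) (Rp : Finset (Fin n → ℤ)) (k a : ℂ)
    (p v : Fin n → ℂ) : (Fin n → ℂ) →L[ℂ] Jet n →L[ℂ] Jet n :=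
  regularPart B k a
    + ∑ α ∈ Rp, cot α (expChart p v) • (pairingL α).smulRight (residueMap B k α)

theorem connection_apply_fst (p v w : Fin n → ℂ) (u : Jet n) :
    (connection B Rp k a p v w u).1 = u.2 w := by
  simp [connection, regularPart_apply, residueMap_apply, Prod.fst_sum]

theorem connection_apply_snd (p v w : Fin n → ℂ) (u : Jet n) (η : Fin n → ℂ) :
    (connection B Rp k a p v w u).2 η
      = -(1 / 2 * k * ∑ α ∈ Rp, pairing α w * pairing α η * cot α (expChart p v)
          * u.2 (coroot B α)) - a * k ^ 2 * dualForm B w η * u.1 := by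
  simp only [connection, _root_.add_apply, _root_.sum_apply, _root_.smul_apply,
    ContinuousLinearMap.smulRight_apply, regularPart_apply, residueMap_apply, Prod.snd_add,
    Prod.snd_sum, Prod.smul_snd, pairingL_apply, smul_eq_mul, Finset.mul_sum,
    LinearMap.coe_toContinuousLinearMap', dualBilin_apply, ← Finset.sum_neg_distrib]
  rw [add_comm, sub_eq_add_neg]
  congr 1
  · exact Finset.sum_congr rfl fun α _ => by ring
  · ring

/-- The function component of the horizontality equation is a tautology for a jet; the differential
component prescribes the Hessian, which is the system itself. -/
theorem fderiv_jet_eq_connection_iff {f : (Fin n → ℂ) → ℂ} {p v : Fin n → ℂ}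
    (hf : AnalyticAt ℂ f (expChart p v)) :
    (∀ w, fderiv ℂ (fun x => ((f (expChart p x), fderiv ℂ (fun x => f (expChart p x)) x) : Jet n))
        v w = connection B Rp k a p v w (f (expChart p v), fderiv ℂ (fun x => f (expChart p x)) v))
      ↔ ∀ ξ η, hypOp B Rp k a ξ η f (expChart p v) = 0 := by
  have hg := analyticAt_comp_expChart hf
  have h1 := (hg.differentiableAt.hasFDerivAt.prodMk
    hg.fderiv.differentiableAt.hasFDerivAt).fderiv
  rw [h1]
  refine forall_congr' fun w => ?_
  rw [Prod.ext_iff, ContinuousLinearMap.ext_iff]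
  simp only [connection_apply_fst, ContinuousLinearMap.prod_apply, true_and,
    connection_apply_snd, hypOp_expChart hf]
  refine forall_congr' fun η => ?_
  rw [← sub_eq_zero]
  refine Eq.congr ?_ rfl
  ring

theorem eventually_expChart_mem (hRp : IsPositiveSystem B Rp) {p : Fin n → ℂ}
    (hp : p ∈ mirrorComplement B) : ∀ᶠ v in 𝓝 0, expChart p v ∈ mirrorComplement B := by
  have h1 : ∀ᶠ v in 𝓝 0, ∀ α ∈ allRoots Rp, character α (expChart p v) ≠ 1 := by
    refine (Filter.eventually_all_finset _).2 fun α hα => ?_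
    refine (analyticAt_character_expChart α p 0).continuousAt.eventually_ne ?_
    rw [expChart_zero]
    exact hp.2 α (hRp.mem_allRoots.1 hα)
  filter_upwards [h1] with v hv
  exact ⟨fun i => mul_ne_zero (hp.1 i) (Complex.exp_ne_zero _),
    fun α hα => hv α (hRp.mem_allRoots.2 hα)⟩

theorem analyticAt_connection (hRp : IsPositiveSystem B Rp) {p v : Fin n → ℂ}
    (hv : expChart p v ∈ mirrorComplement B) : AnalyticAt ℂ (connection B Rp k a p) v := by
  refine analyticAt_const.add (Finset.analyticAt_fun_sum _ fun α hα => ?_)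
  exact (hasFDerivAt_cot (one_sub_character_ne_zero hv (hRp.subset α hα))).1.smul analyticAt_const

/-- The connection form is closed: the differential of the coefficient of α is a multiple of α, and
α ∧ α = 0. -/
theorem fderiv_connection_comm (hRp : IsPositiveSystem B Rp) {p x : Fin n → ℂ}
    (hx : expChart p x ∈ mirrorComplement B) (v w : Fin n → ℂ) :
    fderiv ℂ (connection B Rp k a p) x v w = fderiv ℂ (connection B Rp k a p) x w v := by
  choose! κ hκ using fun α (hα : α ∈ Rp) =>
    (hasFDerivAt_cot (one_sub_character_ne_zero hx (hRp.subset α hα))).2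
  have h1 : HasFDerivAt (connection B Rp k a p) _ x :=
    (HasFDerivAt.fun_sum fun α hα => (hκ α hα).smul_const
      ((pairingL α).smulRight (residueMap B k α))).const_add (regularPart B k a)
  rw [h1.fderiv]
  simp only [_root_.sum_apply, ContinuousLinearMap.smulRight_apply,
    _root_.smul_apply]
  refine Finset.sum_congr rfl fun α _ => ?_
  rw [smul_smul, smul_smul]
  congr 1
  simp only [smul_eq_mul]
  ring

/-- The function component of A(v) A(w) u is visibly symmetric in v and w. In the differential
component the part containing the value u.1 is symmetric too, and the rest is k²/4 times
`sum_cot_mul_cot`; this is where the value of a enters. -/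
theorem connection_flat (hB : IsEvenScalarProduct B) {X : ADEType} (hX : IsOfType B X)
    (hRp : IsPositiveSystem B Rp) {p x : Fin n → ℂ}
    (hx : expChart p x ∈ mirrorComplement B) (v w : Fin n → ℂ) (u : Jet n) :
    connection B Rp k X.a p x v (connection B Rp k X.a p x w u)
      = connection B Rp k X.a p x w (connection B Rp k X.a p x v u) := by
  -- The differential part of the jet is represented by a vector μ, so that its value on the coroot
  -- of β becomes β(μ).
  have hdual : ∃ μ : Fin n → ℂ, ∀ ζ, u.2 ζ = dualForm B ζ μ := by
    refine ⟨B.map (fun z : ℤ => (z : ℂ)) *ᵥ fun i => u.2 (Pi.single i 1), fun ζ => ?_⟩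
    rw [hB.dualForm_comm, hB.dualForm_mulVec, dotProduct]
    conv_lhs => rw [pi_eq_sum_univ' ζ, map_sum]
    exact Finset.sum_congr rfl fun i _ => by rw [map_smul, smul_eq_mul, mul_comm]
  obtain ⟨μ, hμ⟩ := hdual
  have hμ' : ∀ β, u.2 (coroot B β) = pairing β μ := fun β => by rw [hμ, hB.dualForm_coroot]
  have key := sum_cot_mul_cot hB hX hRp (c := fun α => cot α (expChart p x))
    (fun α hα => cot_neg hx hα) (fun α hα β hβ h => cot_mul_cot_add hx hα hβ h) v w
  refine Prod.ext ?_ (ContinuousLinearMap.ext fun η => ?_)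
  · simp only [connection_apply_fst, connection_apply_snd]
    rw [hB.dualForm_comm w v]
    congr 3
    exact Finset.sum_congr rfl fun α _ => by ring
  · have hk := key η μ
    have e : ∀ v w : Fin n → ℂ, (connection B Rp k X.a p x v (connection B Rp k X.a p x w u)).2 η
        = k ^ 2 / 4 * (∑ α ∈ Rp, ∑ β ∈ Rp, (form B α β : ℂ)
            * (cot α (expChart p x) * cot β (expChart p x)) * (pairing α v * pairing β w)
            * (pairing α η * pairing β μ))
          + 1 / 2 * k * (X.a * k ^ 2 * u.1) * (∑ α ∈ Rp, pairing α v * pairing α w * pairing α η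
            * cot α (expChart p x)) - X.a * k ^ 2 * dualForm B v η * dualForm B w μ := by
      intro v w
      simp only [connection_apply_fst, connection_apply_snd]
      rw [← hμ w]
      congr 1
      simp only [Finset.mul_sum, ← Finset.sum_neg_distrib, ← Finset.sum_add_distrib]
      refine Finset.sum_congr rfl fun α _ => ?_
      rw [hB.dualForm_comm, hB.dualForm_coroot, mul_sub, mul_sub, neg_sub, sub_eq_add_neg,
        add_comm]
      simp only [Finset.mul_sum, Finset.sum_neg_distrib, mul_neg, neg_neg]
      congr 1
      · refine Finset.sum_congr rfl fun β _ => ?_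
        rw [hμ', pairing_coroot, hB.form_comm β α]
        ring
      · ring
    rw [e, e, ← sub_eq_zero]
    have hs : ∑ α ∈ Rp, pairing α v * pairing α w * pairing α η * cot α (expChart p x)
        = ∑ α ∈ Rp, pairing α w * pairing α v * pairing α η * cot α (expChart p x) :=
      Finset.sum_congr rfl fun α _ => by ring
    rw [hs]
    have hd : ∑ α ∈ Rp, ∑ β ∈ Rp, (form B α β : ℂ)
          * (cot α (expChart p x) * cot β (expChart p x)) * wedgePairing α β v w
          * (pairing α η * pairing β μ)
        = (∑ α ∈ Rp, ∑ β ∈ Rp, (form B α β : ℂ)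
            * (cot α (expChart p x) * cot β (expChart p x)) * (pairing α v * pairing β w)
            * (pairing α η * pairing β μ))
          - ∑ α ∈ Rp, ∑ β ∈ Rp, (form B α β : ℂ)
            * (cot α (expChart p x) * cot β (expChart p x)) * (pairing α w * pairing β v)
            * (pairing α η * pairing β μ) := by
      simp only [← Finset.sum_sub_distrib]
      refine Finset.sum_congr rfl fun α _ => Finset.sum_congr rfl fun β _ => ?_
      rw [wedgePairing]
      ring
    rw [hd] at hk
    linear_combination k ^ 2 / 4 * hk

end Connection

/-! ### The space of local solutions -/

section LocalSolutions

set_option maxSynthPendingDepth 3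

variable {n : ℕ} {B : Matrix (Fin n) (Fin n) ℤ} {Rp : Finset (Fin n → ℤ)} {k a : ℂ}

/-- Local solutions may satisfy each equation on a neighbourhood depending on ξ and η. Bilinearity
reduces to finitely many basis pairs, hence to one common neighbourhood. -/
theorem eventually_forall_hypOp_eq_zero (hB : IsEvenScalarProduct B) {f : (Fin n → ℂ) → ℂ}
    {p : Fin n → ℂ} (hf : AnalyticAt ℂ f p)
    (h : ∀ ξ η, ∀ᶠ x in 𝓝 p, hypOp B Rp k a ξ η f x = 0) :
    ∀ᶠ x in 𝓝 p, ∀ ξ η, hypOp B Rp k a ξ η f x = 0 := by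
  let b := Pi.basisFun ℂ (Fin n)
  have h1 : ∀ᶠ x in 𝓝 p, ∀ i j, hypOp B Rp k a (b i) (b j) f x = 0 :=
    Filter.eventually_all.2 fun i => Filter.eventually_all.2 fun j => h _ _
  filter_upwards [h1, hf.eventually_analyticAt] with x hx hfx ξ η
  obtain ⟨Q, hQ, -⟩ := exists_hypOp_eq_bilinForm (Rp := Rp) (k := k) (a := a) hB hfx
  have hQ0 : Q = 0 := by
    refine LinearMap.BilinForm.ext_basis b fun i j => ?_
    rw [← hQ, hx]
    rfl
  rw [hQ, hQ0]
  rfl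

/-- The first jet of a germ, in logarithmic coordinates. -/
noncomputable def germJet (p : Fin n → ℂ) (φ : Filter.Germ (𝓝 p) ℂ) : Jet n :=
  φ.liftOn (fun f => (f p, fderiv ℂ (fun x => f (expChart p x)) 0)) fun f g hfg => by
    have h1 : (fun x => f (expChart p x)) =ᶠ[𝓝 0] fun x => g (expChart p x) := by
      have h2 := (analyticAt_expChart p 0).continuousAt
      rw [ContinuousAt, expChart_zero] at h2
      exact h2.eventually hfg
    exact Prod.ext hfg.eq_of_nhds h1.fderiv_eq

theorem germJet_coe (p : Fin n → ℂ) (f : (Fin n → ℂ) → ℂ) :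
    germJet p (f : Filter.Germ (𝓝 p) ℂ) = (f p, fderiv ℂ (fun x => f (expChart p x)) 0) := rfl

theorem differentiableAt_comp_expChart_zero {f : (Fin n → ℂ) → ℂ} {p : Fin n → ℂ}
    (hf : AnalyticAt ℂ f p) : DifferentiableAt ℂ (fun x => f (expChart p x)) 0 := by
  refine (analyticAt_comp_expChart ?_).differentiableAt
  rwa [expChart_zero]

/-- The first jet of a local solution. -/
noncomputable def solutionJet (B : Matrix (Fin n) (Fin n) ℤ) (Rp : Finset (Fin n → ℤ)) (k a : ℂ)
    (p : Fin n → ℂ) : localSolutions B Rp k a p →ₗ[ℂ] Jet n where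
  toFun φ := germJet p φ
  map_add' := by
    rintro ⟨_, f, rfl, hf, -⟩ ⟨_, g, rfl, hg, -⟩
    change germJet p ((f + g : (Fin n → ℂ) → ℂ) : Filter.Germ (𝓝 p) ℂ) = _
    simp only [germJet_coe, Prod.mk_add_mk, Pi.add_apply]
    rw [fderiv_fun_add (differentiableAt_comp_expChart_zero hf)
      (differentiableAt_comp_expChart_zero hg)]
  map_smul' := by
    rintro c ⟨_, f, rfl, hf, -⟩
    change germJet p ((c • f : (Fin n → ℂ) → ℂ) : Filter.Germ (𝓝 p) ℂ) = _
    simp only [germJet_coe, Prod.smul_mk, Pi.smul_apply, RingHom.id_apply]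
    rw [fderiv_fun_const_smul (differentiableAt_comp_expChart_zero hf)]

/-- A solution with vanishing first jet is a horizontal section with zero initial value. -/
theorem solutionJet_injective (hB : IsEvenScalarProduct B) (hRp : IsPositiveSystem B Rp)
    {p : Fin n → ℂ} (hp : p ∈ mirrorComplement B) :
    Function.Injective (solutionJet B Rp k a p) := by
  rw [← LinearMap.ker_eq_bot, LinearMap.ker_eq_bot']
  rintro ⟨_, f, rfl, hf, hsol⟩ h0
  have hf' : AnalyticAt ℂ f (expChart p 0) := by rwa [expChart_zero]
  have hg := analyticAt_comp_expChart hf'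
  have hA : AnalyticAt ℂ (connection B Rp k a p) 0 :=
    analyticAt_connection hRp (by rwa [expChart_zero])
  have h1 := (eventually_nhds_iff_expChart hp.1).1
    ((eventually_forall_hypOp_eq_zero hB hf hsol).and hf.eventually_analyticAt)
  have h2 := eventually_eq_zero_of_fderiv_eq hA (hg.prod hg.fderiv)
    (by
      filter_upwards [h1] with v hv
      exact (fderiv_jet_eq_connection_iff hv.2).2 hv.1)
    (by
      rw [expChart_zero]
      exact h0)
  refine Subtype.ext (Filter.Germ.coe_eq.2 ((eventually_nhds_iff_expChart hp.1).2 ?_))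
  filter_upwards [h2] with v hv
  exact congrArg Prod.fst hv

/-- The Frobenius theorem gives a horizontal section F with initial value u. Its function component
is f, and the first component of the equation forces F to be the jet of f. -/
theorem solutionJet_surjective (hB : IsEvenScalarProduct B) {X : ADEType} (hX : IsOfType B X)
    (hRp : IsPositiveSystem B Rp) {p : Fin n → ℂ} (hp : p ∈ mirrorComplement B) :
    Function.Surjective (solutionJet B Rp k X.a p) := by
  intro u
  have hA : AnalyticAt ℂ (connection B Rp k X.a p) 0 :=
    analyticAt_connection hRp (by rwa [expChart_zero])
  have hflat : ∀ᶠ x in 𝓝 0, ∀ v w u, fderiv ℂ (connection B Rp k X.a p) x v w u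
      - fderiv ℂ (connection B Rp k X.a p) x w v u
        = connection B Rp k X.a p x v (connection B Rp k X.a p x w u)
          - connection B Rp k X.a p x w (connection B Rp k X.a p x v u) := by
    filter_upwards [eventually_expChart_mem hRp hp] with x hx v w u
    rw [fderiv_connection_comm hRp hx, connection_flat hB hX hRp hx v w, sub_self, sub_self]
  obtain ⟨F, hF, hF0, hFA⟩ := exists_flat_solution hA hflat u
  set f : (Fin n → ℂ) → ℂ := fun h => (F (logChart p h)).1 with hfdef
  have hf : AnalyticAt ℂ f p := by
    have h1 : AnalyticAt ℂ F (logChart p p) := by rwa [logChart_self hp.1]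
    exact analyticAt_fst.comp (h1.comp (analyticAt_logChart hp.1))
  have hfF : ∀ᶠ v in 𝓝 0, f (expChart p v) = (F v).1 := by
    filter_upwards [eventually_logChart_expChart hp.1] with v hv
    rw [hfdef]
    simp only [hv]
  have hder : ∀ᶠ v in 𝓝 0, fderiv ℂ (fun x => f (expChart p x)) v = (F v).2 := by
    filter_upwards [hfF.eventually_nhds, hFA, hF.eventually_analyticAt] with v hv hFv hFan
    have h1 : (fun x => f (expChart p x)) =ᶠ[𝓝 v] fun x => (F x).1 := hv
    rw [h1.fderiv_eq, hFan.differentiableAt.hasFDerivAt.fst.fderiv]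
    ext1 w
    change (fderiv ℂ F v w).1 = _
    rw [hFv, connection_apply_fst]
  have hjet : ∀ᶠ v in 𝓝 0,
      ((f (expChart p v), fderiv ℂ (fun x => f (expChart p x)) v) : Jet n) = F v := by
    filter_upwards [hfF, hder] with v h1 h2
    rw [h1, h2]
  have hsol : ∀ᶠ h in 𝓝 p, ∀ ξ η, hypOp B Rp k X.a ξ η f h = 0 := by
    refine (eventually_nhds_iff_expChart hp.1).2 ?_
    filter_upwards [hjet.eventually_nhds, hFA,
      (eventually_nhds_iff_expChart hp.1).1 hf.eventually_analyticAt] with v hv hFv hfan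
    refine (fderiv_jet_eq_connection_iff hfan).1 fun w => ?_
    have h1 : (fun x => ((f (expChart p x), fderiv ℂ (fun x => f (expChart p x)) x) : Jet n))
      =ᶠ[𝓝 v] F := hv
    rw [h1.fderiv_eq, hv.self_of_nhds, hFv]
  refine ⟨⟨f, f, rfl, hf, fun ξ η => hsol.mono fun h hh => hh ξ η⟩, ?_⟩
  have h1 := hjet.self_of_nhds
  rw [hF0, expChart_zero] at h1
  exact h1

theorem isIntegrable (hB : IsEvenScalarProduct B) {X : ADEType} (hX : IsOfType B X)
    (hRp : IsPositiveSystem B Rp) : IsIntegrable B Rp k X.a := by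
  intro p hp
  rw [(LinearEquiv.ofBijective (solutionJet B Rp k X.a p)
    ⟨solutionJet_injective hB hRp hp, solutionJet_surjective hB hX hRp hp⟩).finrank_eq,
    Module.finrank_prod, Module.finrank_self,
    ← (LinearMap.toContinuousLinearMap (𝕜 := ℂ) (E := Fin n → ℂ) (F' := ℂ)).finrank_eq,
    Module.finrank_linearMap]
  simp [add_comm]

end LocalSolutions

/-! ### Invariance under the extended Weyl group -/

section Invariance

variable {n : ℕ} {B : Matrix (Fin n) (Fin n) ℤ} {Rp : Finset (Fin n → ℤ)} {k a : ℂ}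
  {w : (Fin n → ℤ) ≃ₗ[ℤ] (Fin n → ℤ)}

theorem linearEquiv_apply_eq_sum (w : (Fin n → ℤ) ≃ₗ[ℤ] (Fin n → ℤ)) (lam : Fin n → ℤ) :
    w lam = ∑ i, lam i • w (Pi.single i 1) := by
  conv_lhs => rw [pi_eq_sum_univ' lam, map_sum]
  exact Finset.sum_congr rfl fun i _ => by rw [map_smul]

theorem pairing_actLie (w : (Fin n → ℤ) ≃ₗ[ℤ] (Fin n → ℤ)) (lam : Fin n → ℤ) (ξ : Fin n → ℂ) :
    pairing lam (actLie w ξ) = pairing (w⁻¹ lam) ξ := by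
  rw [linearEquiv_apply_eq_sum w⁻¹ lam]
  simp only [pairing, actLie, Finset.sum_apply, Pi.smul_apply, smul_eq_mul, Int.cast_sum,
    Int.cast_mul, Finset.mul_sum, Finset.sum_mul]
  rw [Finset.sum_comm]
  simp only [mul_assoc]

theorem inv_apply_apply (w : (Fin n → ℤ) ≃ₗ[ℤ] (Fin n → ℤ)) (lam : Fin n → ℤ) :
    w⁻¹ (w lam) = lam :=
  w.symm_apply_apply lam

/-- In logarithmic coordinates at the point 1 the character λ is e^{λ(v)}, so the claim reduces to
the linear one on 𝔥. -/
theorem character_actTorus (w : (Fin n → ℤ) ≃ₗ[ℤ] (Fin n → ℤ)) (lam : Fin n → ℤ)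
    {h : Fin n → ℂ} (hh : ∀ i, h i ≠ 0) :
    character lam (actTorus w h) = character (w⁻¹ lam) h := by
  have h1 := character_expChart lam (p := 1) (actLie w (logChart 1 h))
  have h2 := character_expChart (w⁻¹ lam) (p := 1) (logChart 1 h)
  have h3 : expChart 1 (actLie w (logChart 1 h)) = actTorus w h := by
    funext i
    rw [expChart, actLie, actTorus]
    conv_rhs => rw [← expChart_logChart (p := 1) (fun _ => one_ne_zero) hh, character_expChart]
    simp [character]
  rw [expChart_logChart (p := 1) (fun _ => one_ne_zero) hh] at h2
  rw [← h3, h1, h2, pairing_actLie]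
  simp [character]

/-- The torus action is linear in logarithmic coordinates, which reduces invariance of the operators
to the chain rule for a linear map. -/
theorem actTorus_expChart (w : (Fin n → ℤ) ≃ₗ[ℤ] (Fin n → ℤ)) (p v : Fin n → ℂ) :
    actTorus w (expChart p v) = expChart (actTorus w p) (actLie w v) := by
  funext i
  rw [actTorus, character_expChart]
  rfl

/-- The action on `𝔥` as a continuous linear map. -/
noncomputable def actLieL (w : (Fin n → ℤ) ≃ₗ[ℤ] (Fin n → ℤ)) :
    (Fin n → ℂ) →L[ℂ] (Fin n → ℂ) :=
  ContinuousLinearMap.pi fun i => pairingL (w⁻¹ (Pi.single i 1))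

theorem actLieL_apply (w : (Fin n → ℤ) ≃ₗ[ℤ] (Fin n → ℤ)) (ξ : Fin n → ℂ) :
    actLieL w ξ = actLie w ξ := by
  funext i
  exact pairingL_apply _ _

theorem pairing_single (i : Fin n) (ξ : Fin n → ℂ) : pairing (Pi.single i 1) ξ = ξ i := by
  rw [pairing, Finset.sum_eq_single i (by intro j _ hj; simp [hj]) (by simp)]
  simp

theorem actTorus_mem (hw : w ∈ extendedWeylGroup B) {h : Fin n → ℂ}
    (hh : h ∈ mirrorComplement B) : actTorus w h ∈ mirrorComplement B := by
  refine ⟨fun i => character_ne_zero _ hh.1, fun α hα => ?_⟩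
  rw [character_actTorus w α hh.1]
  exact hh.2 _ (((extendedWeylGroup B).inv_mem hw α α).trans hα)

theorem coroot_apply_eq_actLie (hw : w ∈ extendedWeylGroup B) (α : Fin n → ℤ) :
    coroot B (w α) = actLie w (coroot B α) := by
  funext i
  rw [actLie, pairing_coroot, ← pairing_single i (coroot B (w α)), pairing_coroot,
    ← (extendedWeylGroup B).inv_mem hw, inv_apply_apply]

theorem dualForm_actLie (hB : IsEvenScalarProduct B) (hw : w ∈ extendedWeylGroup B)
    (ξ η : Fin n → ℂ) : dualForm B (actLie w ξ) (actLie w η) = dualForm B ξ η := by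
  -- The coroots of the coordinate characters span 𝔥, and on a coroot the form is the pairing with
  -- its character.
  obtain ⟨x, rfl⟩ : ∃ x : Fin n → ℂ, ξ = ∑ i, x i • coroot B (Pi.single i 1) := by
    refine ⟨(B.map (fun z : ℤ => (z : ℂ)))⁻¹ *ᵥ ξ, ?_⟩
    conv_lhs => rw [← one_mulVec ξ, ← mul_nonsing_inv _ hB.isUnit_det_map, ← mulVec_mulVec]
    rw [mulVec_eq_sum]
    refine Finset.sum_congr rfl fun i _ => ?_
    rw [op_smul_eq_smul]
    congr 1
    funext j
    simp [coroot]
  simp only [← dualBilin_apply, ← actLieL_apply, map_sum, map_smul, LinearMap.sum_apply,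
    LinearMap.smul_apply]
  refine Finset.sum_congr rfl fun i _ => ?_
  rw [actLieL_apply, actLieL_apply, dualBilin_apply, dualBilin_apply,
    ← coroot_apply_eq_actLie hw, hB.dualForm_coroot, pairing_actLie, inv_apply_apply,
    hB.dualForm_coroot]

/-- An element w need not preserve the positive roots, but it permutes all roots, and for an even
summand the positive roots carry half of the total. -/
theorem sum_positive_comp (hRp : IsPositiveSystem B Rp) (hw : w ∈ extendedWeylGroup B)
    {F : (Fin n → ℤ) → ℂ} (hF : ∀ α ∈ roots B, F (-α) = F α) :
    ∑ α ∈ Rp, F (w α) = ∑ α ∈ Rp, F α := by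
  have hw' : ∀ α, w α ∈ roots B ↔ α ∈ roots B := fun α => by
    simp only [roots, Set.mem_ofPred_eq, hw α α]
  have h1 : ∑ α ∈ allRoots Rp, F (w α) = ∑ α ∈ allRoots Rp, F α :=
    Finset.sum_equiv w.toEquiv (fun α => by
      rw [hRp.mem_allRoots, hRp.mem_allRoots]
      exact (hw' α).symm) fun α _ => rfl
  rw [hRp.sum_allRoots, hRp.sum_allRoots] at h1
  have h2 : ∀ α ∈ Rp, F (w α) + F (w (-α)) = 2 * F (w α) := fun α hα => by
    rw [map_neg, hF _ ((hw' α).2 (hRp.subset α hα)), two_mul]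
  have h3 : ∀ α ∈ Rp, F α + F (-α) = 2 * F α := fun α hα => by
    rw [hF _ (hRp.subset α hα), two_mul]
  rw [Finset.sum_congr rfl h2, Finset.sum_congr rfl h3, ← Finset.mul_sum, ← Finset.mul_sum] at h1
  exact mul_left_cancel₀ two_ne_zero h1

theorem analyticAt_comp_actTorus {f : (Fin n → ℂ) → ℂ} {p : Fin n → ℂ} (hp : ∀ i, p i ≠ 0)
    (hf : AnalyticAt ℂ f (actTorus w p)) : AnalyticAt ℂ (fun x => f (actTorus w x)) p := by
  have h1 : AnalyticAt ℂ (fun v => f (expChart (actTorus w p) (actLieL w v))) (logChart p p) := by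
    have h2 : AnalyticAt ℂ f (expChart (actTorus w p) (actLieL w 0)) := by
      rwa [map_zero, expChart_zero]
    rw [logChart_self hp]
    exact (analyticAt_comp_expChart h2).comp ((actLieL w).analyticAt 0)
  refine (h1.comp (analyticAt_logChart hp)).congr ?_
  filter_upwards [eventually_ne_zero hp] with x hx
  rw [Function.comp_apply, actLieL_apply, ← actTorus_expChart, expChart_logChart hp hx]

theorem isInvariant (hB : IsEvenScalarProduct B) (hRp : IsPositiveSystem B Rp) :
    IsInvariant B Rp k a := by
  intro w hw p hp
  refine ⟨actTorus_mem hw hp, fun f hf ξ η => ?_⟩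
  set q := actTorus w p with hq
  have hq' : q ∈ mirrorComplement B := actTorus_mem hw hp
  have hf1 : AnalyticAt ℂ (fun x => f (actTorus w x)) (expChart p 0) := by
    rw [expChart_zero]
    exact analyticAt_comp_actTorus hp.1 hf
  have hf2 : AnalyticAt ℂ f (expChart q 0) := by rwa [expChart_zero]
  set g : (Fin n → ℂ) → ℂ := fun x => f (expChart q x) with hgdef
  have hg : AnalyticAt ℂ g 0 := analyticAt_comp_expChart hf2
  have hg' : ∀ᶠ v in 𝓝 (0 : Fin n → ℂ), AnalyticAt ℂ g (actLieL w v) := by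
    have := (actLieL w).continuous.continuousAt (x := 0)
    rw [ContinuousAt, map_zero] at this
    exact this.eventually hg.eventually_analyticAt
  have hcomp : (fun x => f (actTorus w (expChart p x))) = fun x => g (actLieL w x) := by
    funext x
    rw [actTorus_expChart, ← actLieL_apply]
  have hd : ∀ v, AnalyticAt ℂ g (actLieL w v) →
      fderiv ℂ (fun x => g (actLieL w x)) v = (fderiv ℂ g (actLieL w v)).comp (actLieL w) :=
    fun v hv => (hv.differentiableAt.hasFDerivAt.comp v (actLieL w).hasFDerivAt).fderiv
  have hd0 : ∀ ζ, fderiv ℂ (fun x => g (actLieL w x)) 0 ζ = fderiv ℂ g 0 (actLie w ζ) := by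
    intro ζ
    rw [hd 0 hg'.self_of_nhds, map_zero, ← actLieL_apply]
    rfl
  have hdd : fderiv ℂ (fderiv ℂ fun x => g (actLieL w x)) 0 ξ η
      = fderiv ℂ (fderiv ℂ g) 0 (actLie w ξ) (actLie w η) := by
    have h1 : (fderiv ℂ fun x => g (actLieL w x))
        =ᶠ[𝓝 0] fun v => (fderiv ℂ g (actLieL w v)).comp (actLieL w) := hg'.mono hd
    have h2 : HasFDerivAt (fderiv ℂ g) (fderiv ℂ (fderiv ℂ g) 0) (actLieL w 0) := by
      rw [map_zero]
      exact hg.fderiv.differentiableAt.hasFDerivAt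
    have h3 := (h2.comp 0 (actLieL w).hasFDerivAt).clm_comp (hasFDerivAt_const (actLieL w) 0)
    rw [h1.fderiv_eq, ← actLieL_apply, ← actLieL_apply]
    have h4 := congrArg (fun L => L ξ η) h3.fderiv
    refine h4.trans ?_
    simp
  have h1 := hypOp_expChart (B := B) (Rp := Rp) (k := k) (a := a) hf1 ξ η
  have h2 := hypOp_expChart (B := B) (Rp := Rp) (k := k) (a := a) hf2 (actLie w ξ) (actLie w η)
  simp only [hcomp] at h1
  rw [hdd] at h1
  simp only [hd0, expChart_zero] at h1 h2
  rw [h1, h2, dualForm_actLie hB hw]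
  congr 3
  symm
  -- The summand is even because the cotangent coefficient and the coroot both change sign with α.
  rw [← sum_positive_comp hRp hw]
  · refine Finset.sum_congr rfl fun α _ => ?_
    rw [pairing_actLie, pairing_actLie, inv_apply_apply, coroot_apply_eq_actLie hw, cot, cot,
      character_actTorus w _ hp.1, map_neg, inv_apply_apply]
  · intro α hα
    rw [cot_neg hq' hα, coroot_neg, map_neg, pairing_neg, pairing_neg]
    ring

end Invariance

/-! ### Linear independence of the equations -/

section Independence

variable {n : ℕ} {B : Matrix (Fin n) (Fin n) ℤ} {Rp : Finset (Fin n → ℤ)} {k a : ℂ}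

/-- The functions `log (h_i / p_i) * log (h_j / p_j)` isolate the second order terms. -/
theorem hypOp_log_mul_log {p : Fin n → ℂ} (hp : ∀ i, p i ≠ 0) (i j : Fin n) :
    AnalyticAt ℂ (fun h => logChart p h i * logChart p h j) p ∧
      ∀ ξ η, hypOp B Rp k a ξ η (fun h => logChart p h i * logChart p h j) p
        = ξ i * η j + ξ j * η i := by
  have han : AnalyticAt ℂ (fun h => logChart p h i * logChart p h j) p :=
    (analyticAt_pi_iff.1 (analyticAt_logChart hp) i).mul
      (analyticAt_pi_iff.1 (analyticAt_logChart hp) j)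
  refine ⟨han, fun ξ η => ?_⟩
  set f : (Fin n → ℂ) → ℂ := fun h => logChart p h i * logChart p h j with hf
  have han' : AnalyticAt ℂ f (expChart p 0) := by rwa [expChart_zero]
  have h1 := hypOp_expChart (B := B) (Rp := Rp) (k := k) (a := a) han' ξ η
  let P : Fin n → (Fin n → ℂ) →L[ℂ] ℂ := fun i => ContinuousLinearMap.proj i
  have hg : (fun x => f (expChart p x)) =ᶠ[𝓝 0] fun v => P i v * P j v := by
    filter_upwards [eventually_logChart_expChart hp] with v hv
    rw [hf]
    simp only [hv]
    rfl
  have hd : (fderiv ℂ fun v => P i v * P j v) = fun v => P i v • P j + P j v • P i := by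
    funext v
    exact ((P i).hasFDerivAt.fun_mul (P j).hasFDerivAt).fderiv
  have hd2 : HasFDerivAt (fun v => P i v • P j + P j v • P i)
      ((P i).smulRight (P j) + (P j).smulRight (P i)) 0 :=
    ((P i).hasFDerivAt.smul_const (P j)).add ((P j).hasFDerivAt.smul_const (P i))
  rw [hg.fderiv.fderiv_eq, hg.fderiv_eq, hd, hd2.fderiv] at h1
  simp only [expChart_zero] at h1
  rw [h1, hf]
  simp [P, logChart_self hp]

/-- The equations whose parameters are coordinate vectors, indexed by unordered pairs. -/
noncomputable def basicEquation (hB : IsEvenScalarProduct B) (Rp : Finset (Fin n → ℤ)) (k a : ℂ)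
    (p : Fin n → ℂ) : Sym2 (Fin n) → {f : (Fin n → ℂ) → ℂ // AnalyticAt ℂ f p} → ℂ :=
  Sym2.lift ⟨fun i j => equationAt B Rp k a p (Pi.single i 1) (Pi.single j 1), fun i j => by
    funext f
    obtain ⟨Q, hQ, hsymm⟩ := exists_hypOp_eq_bilinForm (Rp := Rp) (k := k) (a := a) hB f.2
    simp only [equationAt, hQ]
    exact hsymm _ _⟩

theorem equationAt_eq_sum (hB : IsEvenScalarProduct B) (p ξ η : Fin n → ℂ) :
    equationAt B Rp k a p ξ η
      = ∑ i, ∑ j, (ξ i * η j) • basicEquation hB Rp k a p s(i, j) := by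
  funext f
  obtain ⟨Q, hQ, -⟩ := exists_hypOp_eq_bilinForm (Rp := Rp) (k := k) (a := a) hB f.2
  simp only [Finset.sum_apply, Pi.smul_apply, smul_eq_mul, basicEquation, Sym2.lift_mk,
    equationAt, hQ]
  conv_lhs => rw [pi_eq_sum_univ' ξ, pi_eq_sum_univ' η]
  simp only [map_sum, map_smul, LinearMap.sum_apply, LinearMap.smul_apply, smul_eq_mul,
    Finset.mul_sum]
  rw [Finset.sum_comm]
  refine Finset.sum_congr rfl fun i _ => Finset.sum_congr rfl fun j _ => ?_
  ring

theorem span_equationAt (hB : IsEvenScalarProduct B) (p : Fin n → ℂ) :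
    Submodule.span ℂ {L | ∃ ξ η : Fin n → ℂ, L = equationAt B Rp k a p ξ η}
      = Submodule.span ℂ (Set.range (basicEquation hB Rp k a p)) := by
  refine le_antisymm (Submodule.span_le.2 ?_) (Submodule.span_mono ?_)
  · rintro _ ⟨ξ, η, rfl⟩
    rw [equationAt_eq_sum hB]
    exact Submodule.sum_mem _ fun i _ => Submodule.sum_mem _ fun j _ =>
      Submodule.smul_mem _ _ (Submodule.subset_span ⟨_, rfl⟩)
  · rintro _ ⟨s, rfl⟩
    induction s with
    | h i j => exact ⟨Pi.single i 1, Pi.single j 1, rfl⟩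

/-- The products of two logarithmic coordinates form a dual system up to scaling: on the product for
{i, j} the equation of the same pair takes the value 1, or 2 if i = j, and all other basic equations
vanish. -/
theorem linearIndependent_basicEquation (hB : IsEvenScalarProduct B) {p : Fin n → ℂ}
    (hp : ∀ i, p i ≠ 0) : LinearIndependent ℂ (basicEquation hB Rp k a p) := by
  rw [Fintype.linearIndependent_iff]
  intro c hc s
  induction s with
  | h i j =>
    obtain ⟨hf, hfv⟩ := hypOp_log_mul_log (B := B) (Rp := Rp) (k := k) (a := a) hp i j
    have h1 := congrFun hc ⟨_, hf⟩
    rw [Finset.sum_apply, Finset.sum_eq_single s(i, j)] at h1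
    · rw [Pi.smul_apply, Pi.zero_apply, smul_eq_mul] at h1
      refine (mul_eq_zero.1 h1).resolve_right ?_
      rw [basicEquation, Sym2.lift_mk]
      simp only [equationAt, hfv]
      rcases eq_or_ne i j with rfl | hij
      · simp
      · simp [hij, hij.symm]
    · intro t _ ht
      induction t with
      | h i' j' =>
        rw [Pi.smul_apply, basicEquation, Sym2.lift_mk]
        simp only [equationAt, hfv]
        rw [ne_eq, Sym2.eq_iff] at ht
        simp only [Pi.single_apply]
        split_ifs <;> simp_all
    · simp

theorem hasIndependentEquations (hB : IsEvenScalarProduct B) :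
    HasIndependentEquations B Rp k a := by
  intro p hp
  rw [span_equationAt hB, finrank_span_eq_card (linearIndependent_basicEquation hB hp.1),
    Sym2.card, Fintype.card_fin, Nat.choose_two_right, Nat.add_sub_cancel, mul_comm]

end Independence

end ToricHypergeometric

theorem mainTheorem1 {n : ℕ} (B : Matrix (Fin n) (Fin n) ℤ)
    (hB : ToricHypergeometric.IsEvenScalarProduct B)
    (X : ToricHypergeometric.ADEType) (hX : ToricHypergeometric.IsOfType B X)
    (Rp : Finset (Fin n → ℤ)) (hRp : ToricHypergeometric.IsPositiveSystem B Rp) (k : ℂ) :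
    ToricHypergeometric.HasIndependentEquations B Rp k X.a ∧
    ToricHypergeometric.IsIntegrable B Rp k X.a ∧
    ToricHypergeometric.IsInvariant B Rp k X.a :=
  ⟨ToricHypergeometric.hasIndependentEquations hB, ToricHypergeometric.isIntegrable hB hX hRp,
    ToricHypergeometric.isInvariant hB hRp⟩
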